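/- Let $\Phi:\mathbb R^2\to\mathbb R^2$ be a smooth mapping, let $\sigma(x,x')=\frac12|x'-x|^2$ be the world function of the Euclidean plane, and let $S(x)=\sigma(\Phi(x),x)$. Assume: 1. $\Phi$ has exactly one fixed point, $\{x\in\mathbb R^2:\Phi(x)=x\}=\{\xi_0\}$; 2. there are constants $p>0$, $R>0$, $C>0$ such that $S(x)\ge C[\sigma(x,0)]^p$ for all $x$ with $\sigma(x,0)>R^2/2$; 3. $\xi_0$ is a non-degenerate critical point of $S$, that is, $\nabla S(\xi_0)=0$ and the Hessian matrix of $S$ at $\xi_0$ is strictly positive or strictly negative definite. Let $U(t;x,x')=(4\pi t)^{-1}e^{-\sigma(x,x')/(2t)}$ be the heat kernel of the plane and $\Theta_\Phi(t)=\int_{\mathbb R^2}U(t;\Phi(x),x)\,dx$, $t>0$, the deformed heat trace. Write $S_{\nu_1\ldots\nu_m}=(\partial_{\nu_1}\cdots\partial_{\nu_m}S)(\xi_0)$ in Cartesian coordinates, let $Q=(Q^{\mu\nu})$ be the inverse of the Hessian matrix $(S_{\alpha\beta})$, and, with summation over repeated indices (each from $1$ to $2$), let $$S_{[2k]\nu_1\ldots\nu_m}=Q^{\mu_1\mu_2}\cdots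 Q^{\mu_{2k-1}\mu_{2k}}S_{\mu_1\mu_2\ldots\mu_{2k-1}\mu_{2k}\nu_1\ldots\nu_m}.$$ Then the integral defining $\Theta_\Phi(t)$ converges absolutely for every $t>0$; there is an asymptotic expansion $\Theta_\Phi(t)\sim\sum_{k=0}^\infty t^kA_k$ as $t\to0^+$ (that is, $\Theta_\Phi(t)-\sum_{k=0}^N t^kA_k=o(t^N)$ for every $N\ge 0$); and its coefficients satisfy $$A_0=\sqrt{\det Q},$$ $$\begin{aligned}A_1=\sqrt{\det Q}\,\Big[ &-\tfrac{1}{4} S_{[4]}\\ &+\tfrac{1}{4} S_{[2]\nu_{1}} S_{[2]\nu_{2}} Q^{\nu_{1}\nu_{2}}\\ &+\tfrac{1}{6} S_{\nu_{1}\nu_{2}\nu_{3}} S_{\nu_{4}\nu_{5}\nu_{6}} Q^{\nu_{1}\nu_{4}} Q^{\nu_{2}\nu_{5}} Q^{\nu_{3}\nu_{6}} \Big],\end{aligned}$$ $$\begin{aligned}A_2=\sqrt{\det Q}\,\Big[ &-\tfrac{1}{12} S_{[6]}\\ &+\tfrac{1}{4} S_{[2]\nu_{1}} S_{[4]\nu_{2}}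 Q^{\nu_{1}\nu_{2}}\\ &+\tfrac{1}{3} S_{\nu_{1}\nu_{2}\nu_{3}} S_{[2]\nu_{4}\nu_{5}\nu_{6}} Q^{\nu_{1}\nu_{4}} Q^{\nu_{2}\nu_{5}} Q^{\nu_{3}\nu_{6}}\\ &+\tfrac{1}{32} S_{[4]} S_{[4]}\\ &+\tfrac{1}{4} S_{[2]\nu_{1}\nu_{2}} S_{[2]\nu_{3}\nu_{4}} Q^{\nu_{1}\nu_{3}} Q^{\nu_{2}\nu_{4}}\\ &+\tfrac{1}{12} S_{\nu_{1}\nu_{2}\nu_{3}\nu_{4}} S_{\nu_{5}\nu_{6}\nu_{7}\nu_{8}} Q^{\nu_{1}\nu_{5}} Q^{\nu_{2}\nu_{6}} Q^{\nu_{3}\nu_{7}} Q^{\nu_{4}\nu_{8}}\\ &-\tfrac{1}{16} S_{[2]\nu_{1}} S_{[2]\nu_{2}} S_{[4]} Q^{\nu_{1}\nu_{2}}\\ &-\tfrac{1}{2} S_{[2]\nu_{1}} S_{\nu_{2}\nu_{3}\nu_{4}} S_{[2]\nu_{5}\nu_{6}} Q^{\nu_{1}\nu_{2}} Q^{\nu_{3}\nu_{5}}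 Q^{\nu_{4}\nu_{6}}\\ &-\tfrac{1}{4} S_{[2]\nu_{1}} S_{[2]\nu_{2}} S_{[2]\nu_{3}\nu_{4}} Q^{\nu_{1}\nu_{3}} Q^{\nu_{2}\nu_{4}}\\ &-\tfrac{1}{3} S_{[2]\nu_{1}} S_{\nu_{2}\nu_{3}\nu_{4}} S_{\nu_{5}\nu_{6}\nu_{7}\nu_{8}} Q^{\nu_{1}\nu_{5}} Q^{\nu_{2}\nu_{6}} Q^{\nu_{3}\nu_{7}} Q^{\nu_{4}\nu_{8}}\\ &-\tfrac{1}{24} S_{\nu_{1}\nu_{2}\nu_{3}} S_{\nu_{4}\nu_{5}\nu_{6}} S_{[4]} Q^{\nu_{1}\nu_{4}} Q^{\nu_{2}\nu_{5}} Q^{\nu_{3}\nu_{6}}\\ &-\tfrac{1}{2} S_{\nu_{1}\nu_{2}\nu_{3}} S_{\nu_{4}\nu_{5}\nu_{6}} S_{[2]\nu_{7}\nu_{8}} Q^{\nu_{1}\nu_{4}} Q^{\nu_{2}\nu_{5}} Q^{\nu_{3}\nu_{7}} Q^{\nu_{6}\nu_{8}}\\ &-\tfrac{1}{2} S_{\nu_{1}\nu_{2}\nu_{3}}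 S_{\nu_{4}\nu_{5}\nu_{6}} S_{\nu_{7}\nu_{8}\nu_{9}\nu_{10}} Q^{\nu_{1}\nu_{4}} Q^{\nu_{2}\nu_{7}} Q^{\nu_{3}\nu_{8}} Q^{\nu_{5}\nu_{9}} Q^{\nu_{6}\nu_{10}}\\ &+\tfrac{1}{32} S_{[2]\nu_{1}} S_{[2]\nu_{2}} S_{[2]\nu_{3}} S_{[2]\nu_{4}} Q^{\nu_{1}\nu_{2}} Q^{\nu_{3}\nu_{4}}\\ &+\tfrac{1}{24} S_{[2]\nu_{1}} S_{[2]\nu_{2}} S_{\nu_{3}\nu_{4}\nu_{5}} S_{\nu_{6}\nu_{7}\nu_{8}} Q^{\nu_{1}\nu_{2}} Q^{\nu_{3}\nu_{6}} Q^{\nu_{4}\nu_{7}} Q^{\nu_{5}\nu_{8}}\\ &+\tfrac{1}{4} S_{[2]\nu_{1}} S_{\nu_{2}\nu_{3}\nu_{4}} S_{\nu_{5}\nu_{6}\nu_{7}} S_{[2]\nu_{8}} Q^{\nu_{1}\nu_{2}} Q^{\nu_{3}\nu_{5}} Q^{\nu_{4}\nu_{6}} Q^{\nu_{7}\nu_{8}}\\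 &+\tfrac{1}{12} S_{[2]\nu_{1}} S_{\nu_{2}\nu_{3}\nu_{4}} S_{[2]\nu_{5}} S_{[2]\nu_{6}} Q^{\nu_{1}\nu_{2}} Q^{\nu_{3}\nu_{5}} Q^{\nu_{4}\nu_{6}}\\ &+\tfrac{1}{2} S_{[2]\nu_{1}} S_{\nu_{2}\nu_{3}\nu_{4}} S_{\nu_{5}\nu_{6}\nu_{7}} S_{\nu_{8}\nu_{9}\nu_{10}} Q^{\nu_{1}\nu_{2}} Q^{\nu_{3}\nu_{5}} Q^{\nu_{4}\nu_{8}} Q^{\nu_{6}\nu_{9}} Q^{\nu_{7}\nu_{10}}\\ &+\tfrac{1}{72} S_{\nu_{1}\nu_{2}\nu_{3}} S_{\nu_{4}\nu_{5}\nu_{6}} S_{\nu_{7}\nu_{8}\nu_{9}} S_{\nu_{10}\nu_{11}\nu_{12}} Q^{\nu_{1}\nu_{4}} Q^{\nu_{2}\nu_{5}} Q^{\nu_{3}\nu_{6}} Q^{\nu_{7}\nu_{10}} Q^{\nu_{8}\nu_{11}} Q^{\nu_{9}\nu_{12}}\\ &+\tfrac{1}{4} S_{\nu_{1}\nu_{2}\nu_{3}}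 S_{\nu_{4}\nu_{5}\nu_{6}} S_{\nu_{7}\nu_{8}\nu_{9}} S_{\nu_{10}\nu_{11}\nu_{12}} Q^{\nu_{1}\nu_{4}} Q^{\nu_{2}\nu_{5}} Q^{\nu_{3}\nu_{7}} Q^{\nu_{6}\nu_{10}} Q^{\nu_{8}\nu_{11}} Q^{\nu_{9}\nu_{12}}\\ &+\tfrac{1}{6} S_{\nu_{1}\nu_{2}\nu_{3}} S_{\nu_{4}\nu_{5}\nu_{6}} S_{\nu_{7}\nu_{8}\nu_{9}} S_{\nu_{10}\nu_{11}\nu_{12}} Q^{\nu_{1}\nu_{4}} Q^{\nu_{2}\nu_{7}} Q^{\nu_{3}\nu_{10}} Q^{\nu_{5}\nu_{8}} Q^{\nu_{6}\nu_{11}} Q^{\nu_{9}\nu_{12}} \Big].\end{aligned}$$ Moreover, with $\Phi^\mu{}_{\nu_1\ldots\nu_m}=(\partial_{\nu_1}\cdots\partial_{\nu_m}\Phi^\mu)(\xi_0)$, $g_{\alpha\beta}=\delta_{\alpha\beta}$, and parentheses around indices denoting symmetrization (the average over all permutations) over the indices other than the summed $\mu,\nu$, the derivatives of $S$ entering these formulas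 are $$\begin{aligned} S_{\alpha\beta}&=g_{\alpha\beta}-2g_{\mu(\alpha}\Phi^\mu{}_{\beta)}+g_{\mu\nu}\Phi^\mu{}_{(\alpha}\Phi^\nu{}_{\beta)},\\ S_{\alpha\beta\gamma}&=-3g_{\mu(\alpha}\Phi^\mu{}_{\beta\gamma)}+3g_{\mu\nu}\Phi^\mu{}_{(\alpha}\Phi^\nu{}_{\beta\gamma)},\\ S_{\alpha\beta\gamma\delta}&=-4g_{\mu(\alpha}\Phi^\mu{}_{\beta\gamma\delta)}+4g_{\mu\nu}\Phi^\mu{}_{(\alpha}\Phi^\nu{}_{\beta\gamma\delta)}+3g_{\mu\nu}\Phi^\mu{}_{(\alpha\beta}\Phi^\nu{}_{\gamma\delta)},\\ S_{\alpha\beta\gamma\delta\epsilon}&=-5g_{\mu(\alpha}\Phi^\mu{}_{\beta\gamma\delta\epsilon)}+5g_{\mu\nu}\Phi^\mu{}_{(\alpha}\Phi^\nu{}_{\beta\gamma\delta\epsilon)}+10g_{\mu\nu}\Phi^\mu{}_{(\alpha\beta}\Phi^\nu{}_{\gamma\delta\epsilon)},\\ S_{\alpha\beta\gamma\delta\epsilon\zeta}&=-6g_{\mu(\alpha}\Phi^\mu{}_{\beta\gamma\delta\epsilon\zeta)}+6g_{\mu\nu}\Phi^\mu{}_{(\alpha}\Phi^\nu{}_{\beta\gamma\delta\epsilon\zeta)}+15g_{\mu\nu}\Phi^\mu{}_{(\alpha\beta}\Phi^\nu{}_{\gamma\delta\epsilon\zeta)}+10g_{\mu\nu}\Phi^\mu{}_{(\alpha\beta\gamma}\Phi^\nu{}_{\delta\epsilon\zeta)}.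 \end{aligned}$$ -/

import Mathlib

open Filter Topology MeasureTheory

noncomputable section

/-- The Euclidean plane `ℝ²` with Cartesian coordinates `x 0`, `x 1`. -/
abbrev Plane : Type := EuclideanSpace ℝ (Fin 2)

/-- World function of the plane: half the square of the length of the geodesic joining
`x` and `x'`. -/
def worldFunction (x x' : Plane) : ℝ :=
  (1 / 2) * ∑ α : Fin 2, (x' α - x α) ^ 2

/-- Heat kernel `U(t; x, x')` of the Laplacian on the plane. -/
def planeHeatKernel (t : ℝ) (x x' : Plane) : ℝ :=
  (4 * Real.pi * t)⁻¹ * Real.exp (-(worldFunction x x' / (2 * t)))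

/-- Deformed heat trace `Θ_Φ(t) = ∫ U(t; Φ(x), x) dx`. -/
def deformedHeatTrace (Φ : Plane → Plane) (t : ℝ) : ℝ :=
  ∫ x : Plane, planeHeatKernel t (Φ x) x

/-- `f(t) ∼ ∑ₖ tᵏ Aₖ` as `t → 0⁺`, an asymptotic expansion to all orders. -/
def HasPowerAsymptotics (f : ℝ → ℝ) (A : ℕ → ℝ) : Prop :=
  ∀ N : ℕ, (fun t : ℝ => f t - ∑ k ∈ Finset.range (N + 1), t ^ k * A k)
    =o[𝓝[>] (0 : ℝ)] (fun t : ℝ => t ^ N)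

/-- Components of a covariant tensor of rank `m` at a point of the plane. -/
abbrev PlaneTensor (m : ℕ) : Type := (Fin m → Fin 2) → ℝ

/-- The partial derivatives `(∂_{ν₁} ⋯ ∂_{νₘ} f)(ξ)` in Cartesian coordinates. -/
def derivTensor (f : Plane → ℝ) (ξ : Plane) (m : ℕ) : PlaneTensor m :=
  fun ν => iteratedFDeriv ℝ m f ξ (fun i => EuclideanSpace.single (ν i) (1 : ℝ))

/-- The Hessian matrix `(∂_α ∂_β f)(ξ)`. -/
def hessianMatrix (f : Plane → ℝ) (ξ : Plane) : Matrix (Fin 2) (Fin 2) ℝ :=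
  Matrix.of fun α β => derivTensor f ξ 2 ![α, β]

/-- Non-degenerate critical point: the gradient vanishes and the Hessian matrix is either
strictly positive or strictly negative definite. -/
def IsNondegenerateCriticalPoint (f : Plane → ℝ) (ξ : Plane) : Prop :=
  fderiv ℝ f ξ = 0 ∧ ((hessianMatrix f ξ).PosDef ∨ (-hessianMatrix f ξ).PosDef)

/-- Symmetrization `T_{(ν₁ … νₘ)}`. -/
def symmetrize {m : ℕ} (T : PlaneTensor m) : PlaneTensor m :=
  fun ν => (1 / (m.factorial : ℝ)) * ∑ φ : Equiv.Perm (Fin m), T (fun i => ν (φ i))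

/-- Contraction of the first two indices with `Q`:
`(τ T)_{ν₁ … νₘ} = Q^{αβ} T_{α β ν₁ … νₘ}`. -/
def contractPair (Q : Matrix (Fin 2) (Fin 2) ℝ) {m : ℕ} (T : PlaneTensor (m + 2)) :
    PlaneTensor m :=
  fun ν => ∑ α : Fin 2, ∑ β : Fin 2, Q α β * T (Matrix.vecCons α (Matrix.vecCons β ν))

/-- `contractedDeriv Q f ξ k m` is `f_{[2k] ν₁ … νₘ}`: `k` pairs of indices of the
`(2k+m)`-th derivative of `f` at `ξ` are contracted with `Q`. -/
def contractedDeriv (Q : Matrix (Fin 2) (Fin 2) ℝ) (f : Plane → ℝ) (ξ : Plane) :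
    (k m : ℕ) → PlaneTensor m
  | 0, m => derivTensor f ξ m
  | k + 1, m => contractPair Q (contractedDeriv Q f ξ k (m + 2))

end

/-!
Since `S(x) = ½ |Φ(x) - x|²`, the trace is `Θ(t) = (4πt)⁻¹ ∫ exp (-S / 2t)`, and its expansion is
that of Laplace's method at the only zero `ξ₀` of `S`. There `S ≥ 0` forces the non-degenerate
Hessian to be positive definite.

*Existence of the expansion.* Write `S(ξ₀ + x) = q(x, x)`, where `q(x, y)` is smooth, and quadratic
in `y` (Taylor's formula with integral remainder, `eq_add_taylorQuadraticForm`). With `x = ε y` and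
`ε² = 2t` the exponent `S / 2t` becomes `q(ε y, y)`, which is smooth up to `ε = 0`. After a cut-off
`χ` near `ξ₀`, outside of which the contribution is `O(exp (-const / t))`
(`IsLaplaceExponent.tail_isLittleO`), one has `2π Θ(t) ≈ F(ε)` with
`F(ε) = ∫ χ(ε y) exp (-q(ε y, y)) dy`. Integrals `∫ ψ(ε y, y) exp (-q(ε y, y)) dy` with `ψ` smooth,
homogeneous in `y` and compactly supported in `x` form a class whose members have derivatives that
are differences of members, so `F` is smooth and may be differentiated under the integral
(`IsAmplitude.iteratedDeriv_integral`). As `F` is even, its Taylor polynomials at `0` are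
polynomials in `t`.

*The coefficients.* The derivatives of `ε ↦ q(ε y, y)` at `0` are, up to binomial factors, the
polynomials `Tₘ(y)` of the derivative tensors of `S`. Hence the coefficients are Gaussian integrals
of `secondOrderTerm` and `fourthOrderTerm`, which are polynomials in the `Tₘ(y)`. In coordinates
`y = L z` with `Q = L Lᵀ`, the Gaussian is the standard one, symmetric tensors have the components
`c 0, …, c m`, and a full contraction with `Q` along the edges of a graph becomes a sum over index
values on the edges (`IsPull.sum_mul_prod`). Wick's theorem is then, for each graph type, an
identity between polynomials in these components (`wick_three_three` to
`wick_three_three_three_three`).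

*The derivatives of `S`.* Both sides of each identity are symmetric tensors, so by polarization
(`IsSymmTensor.eq_of_tensorPoly_eq`) only their polynomials need to be compared, that is, the
derivatives of `½ |Φ - id|²` along lines, which the Leibniz rule gives.
-/

/-! ### Symmetric tensors and their polynomials -/

/-- The homogeneous polynomial `y ↦ T_{ν₁ … νₘ} y^{ν₁} ⋯ y^{νₘ}` of a tensor. -/
def tensorPoly {m : ℕ} (T : PlaneTensor m) (y : Plane) : ℝ :=
  ∑ ν : Fin m → Fin 2, T ν * ∏ i, y (ν i)

/-- A tensor is symmetric if permuting its indices does not change its components. -/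
def IsSymmTensor {m : ℕ} (T : PlaneTensor m) : Prop :=
  ∀ (σ : Equiv.Perm (Fin m)) (ν : Fin m → Fin 2), T (ν ∘ σ) = T ν

theorem isSymmTensor_symmetrize {m : ℕ} (T : PlaneTensor m) : IsSymmTensor (symmetrize T) := by
  intro σ ν
  unfold symmetrize
  congr 1
  exact Fintype.sum_equiv (Equiv.mulLeft σ) _ _ fun φ => rfl

theorem tensorPoly_symmetrize {m : ℕ} (T : PlaneTensor m) (y : Plane) :
    tensorPoly (symmetrize T) y = tensorPoly T y := by
  have key : ∀ φ : Equiv.Perm (Fin m),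
      ∑ ν : Fin m → Fin 2, T (fun i => ν (φ i)) * ∏ i, y (ν i) = tensorPoly T y := by
    intro φ
    refine Fintype.sum_equiv (Equiv.arrowCongr φ.symm (Equiv.refl (Fin 2))) _ _ fun ν => ?_
    have : (Equiv.arrowCongr φ.symm (Equiv.refl (Fin 2))) ν = fun i => ν (φ i) := rfl
    rw [this, Equiv.prod_comp φ fun i => y (ν i)]
  calc tensorPoly (symmetrize T) y
      = (1 / (m.factorial : ℝ)) * ∑ φ : Equiv.Perm (Fin m),
          ∑ ν : Fin m → Fin 2, T (fun i => ν (φ i)) * ∏ i, y (ν i) := by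
        rw [Finset.sum_comm, Finset.mul_sum]
        refine Finset.sum_congr rfl fun ν _ => ?_
        rw [symmetrize, mul_assoc, Finset.sum_mul]
    _ = tensorPoly T y := by
        rw [Finset.sum_congr rfl fun φ _ => key φ, Finset.sum_const, Finset.card_univ,
          Fintype.card_perm, Fintype.card_fin, nsmul_eq_mul]
        have : (m.factorial : ℝ) ≠ 0 := by positivity
        field_simp

/-- The components of a symmetric tensor depend only on how often each index value occurs. -/
theorem IsSymmTensor.eq_of_card_eq {m : ℕ} {T : PlaneTensor m} (hT : IsSymmTensor T)
    {ν ν' : Fin m → Fin 2}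
    (h : ∀ c, Fintype.card {i // ν' i = c} = Fintype.card {i // ν i = c}) : T ν' = T ν := by
  have he : ∀ c, Nonempty ({i // ν' i = c} ≃ {i // ν i = c}) := fun c => Fintype.card_eq.1 (h c)
  have hν : ν' = ν ∘ Equiv.ofFiberEquiv fun c => (he c).some :=
    funext fun i => (Equiv.ofFiberEquiv_map (fun c => (he c).some) i).symm
  rw [hν, hT]

/-- A symmetric tensor is given by its components `c k`, with `k` indices equal to `1`. -/
theorem IsSymmTensor.exists_components {m : ℕ} {T : PlaneTensor m} (hT : IsSymmTensor T) :
    ∃ c : ℕ → ℝ, ∀ ν, T ν = c (∑ i, (ν i : ℕ)) := by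
  have h1 : ∀ ν : Fin m → Fin 2, Fintype.card {i // ν i = 1} = ∑ i, (ν i : ℕ) := by
    intro ν
    rw [Fintype.card_subtype, Finset.card_filter]
    refine Finset.sum_congr rfl fun i _ => ?_
    generalize ν i = j
    fin_cases j <;> rfl
  have h0 : ∀ ν : Fin m → Fin 2, Fintype.card {i // ν i = 0} + ∑ i, (ν i : ℕ) = m := by
    intro ν
    rw [Fintype.card_subtype, Finset.card_filter, ← Finset.sum_add_distrib]
    rw [Finset.sum_congr rfl (g := fun _ => 1), Finset.sum_const, Finset.card_univ,
      Fintype.card_fin, smul_eq_mul, mul_one]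
    intro i _
    generalize ν i = j
    fin_cases j <;> rfl
  have hfac : Function.FactorsThrough T fun ν : Fin m → Fin 2 => ∑ i, (ν i : ℕ) := by
    intro ν ν' h
    dsimp only at h
    refine hT.eq_of_card_eq fun c => ?_
    have e0 := h0 ν
    have e0' := h0 ν'
    fin_cases c
    · show Fintype.card {i // ν i = 0} = Fintype.card {i // ν' i = 0}
      omega
    · show Fintype.card {i // ν i = 1} = Fintype.card {i // ν' i = 1}
      rw [h1, h1, h]
  exact ⟨Function.extend (fun ν : Fin m → Fin 2 => ∑ i, (ν i : ℕ)) T 0,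
    fun ν => (hfac.extend_apply 0 ν).symm⟩

/-- Polarization: a symmetric tensor is determined by its polynomial. -/
theorem IsSymmTensor.eq_of_tensorPoly_eq {m : ℕ} {T T' : PlaneTensor m} (hT : IsSymmTensor T)
    (hT' : IsSymmTensor T') (h : ∀ y, tensorPoly T y = tensorPoly T' y) : T = T' := by
  classical
  -- The coefficient of a monomial in the polynomial of `T` is a multiple of a component of `T`:
  -- by symmetry all components which contribute to the monomial `d ν` agree.
  let d : (Fin m → Fin 2) → (Fin 2 →₀ ℕ) := fun ν => ∑ i, Finsupp.single (ν i) 1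
  have hd : ∀ ν c, d ν c = Fintype.card {i // ν i = c} := by
    intro ν c
    simp only [d, Finsupp.finsetSum_apply, Finsupp.single_apply, Fintype.card_subtype,
      Finset.card_filter]
  let p : PlaneTensor m → MvPolynomial (Fin 2) ℝ := fun T =>
    ∑ ν, MvPolynomial.monomial (d ν) (T ν)
  have hp : ∀ T y, MvPolynomial.eval (fun i => y i) (p T) = tensorPoly T y := by
    intro T y
    simp only [p, map_sum, MvPolynomial.eval_monomial, tensorPoly, d]
    refine Finset.sum_congr rfl fun ν _ => ?_
    rw [Finsupp.prod_fintype _ _ (by simp)]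
    congr 1
    simp only [Finsupp.finsetSum_apply, ← Finset.prod_pow_eq_pow_sum]
    rw [Finset.prod_comm]
    refine Finset.prod_congr rfl fun i _ => ?_
    rw [Finset.prod_eq_single (ν i)] <;> simp +contextual [eq_comm]
  have hpp : p T = p T' := by
    refine MvPolynomial.funext fun x => ?_
    have := h (WithLp.toLp 2 x)
    rwa [← hp, ← hp] at this
  funext ν
  have hc : ∀ T : PlaneTensor m, IsSymmTensor T →
      (p T).coeff (d ν) = (Finset.univ.filter fun ν' => d ν' = d ν).card * T ν := by
    intro T hT
    simp only [p, MvPolynomial.coeff_sum, MvPolynomial.coeff_monomial]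
    rw [← Finset.sum_filter, ← nsmul_eq_mul]
    refine Finset.sum_eq_card_nsmul fun ν' hν' => ?_
    exact hT.eq_of_card_eq fun c => by rw [← hd, ← hd, (Finset.mem_filter.1 hν').2]
  have hcard : ((Finset.univ.filter fun ν' => d ν' = d ν).card : ℝ) ≠ 0 := by
    rw [Nat.cast_ne_zero, ← Nat.pos_iff_ne_zero, Finset.card_pos]
    exact ⟨ν, by simp⟩
  have := congrArg (MvPolynomial.coeff (d ν)) hpp
  rw [hc T hT, hc T' hT'] at this
  exact mul_left_cancel₀ hcard this

/-! ### Derivative tensors of smooth functions -/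

/-- The `m`-th derivative of a function along a line is the polynomial of the tensor of its
`m`-th partial derivatives. -/
theorem iteratedDeriv_line_eq_tensorPoly {f : Plane → ℝ} (hf : ContDiff ℝ (⊤ : ℕ∞) f) (ξ y : Plane)
    (m : ℕ) : iteratedDeriv m (fun ε : ℝ => f (ξ + ε • y)) 0 = tensorPoly (derivTensor f ξ m) y := by
  have h1 : (fun ε : ℝ => f (ξ + ε • y)) =
      (fun x => f (ξ + x)) ∘ (ContinuousLinearMap.toSpanSingleton ℝ y) := by
    funext ε; simp
  have h2 : ContDiff ℝ (⊤ : ℕ∞) (fun x => f (ξ + x)) := hf.comp (contDiff_const.add contDiff_id)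
  rw [iteratedDeriv_eq_iteratedFDeriv, h1,
    ContinuousLinearMap.iteratedFDeriv_comp_right _ h2 _ (by exact_mod_cast le_top),
    iteratedFDeriv_comp_add_left]
  simp only [ContinuousMultilinearMap.compContinuousLinearMap_apply,
    ContinuousLinearMap.toSpanSingleton_apply, one_smul, zero_smul, add_zero]
  have hy : y = ∑ j : Fin 2, y j • EuclideanSpace.single j (1 : ℝ) := by
    ext i; fin_cases i <;> simp
  conv_lhs => rw [hy]
  rw [ContinuousMultilinearMap.map_sum]
  refine Finset.sum_congr rfl fun ν _ => ?_
  rw [ContinuousMultilinearMap.map_smul_univ, smul_eq_mul, mul_comm]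
  rfl

/-- Iterated derivatives of a smooth function are symmetric. The step from `m` to `m + 1` arguments
uses the symmetry of the second derivative of the `(m - 1)`-st derivative for the first two
arguments, and differentiates the symmetry of the `m`-th derivative for all others. -/
theorem iteratedFDeriv_comp_perm_of_contDiff {E : Type*} [NormedAddCommGroup E] [NormedSpace ℝ E]
    {f : E → ℝ} (hf : ContDiff ℝ (⊤ : ℕ∞) f) :
    ∀ (m : ℕ) (σ : Equiv.Perm (Fin m)) (x : E) (v : Fin m → E),
      iteratedFDeriv ℝ m f x (v ∘ σ) = iteratedFDeriv ℝ m f x v := by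
  have hdiff : ∀ m, ContDiff ℝ (⊤ : ℕ∞) (iteratedFDeriv ℝ m f) := fun m =>
    hf.iteratedFDeriv_right (by exact_mod_cast le_top)
  have hd : ∀ m, Differentiable ℝ (iteratedFDeriv ℝ m f) := fun m =>
    (hdiff m).differentiable (by simp)
  intro m
  induction m with
  | zero => intro σ x v; congr 1; funext i; exact i.elim0
  | succ m ih =>
    let s : Submonoid (Equiv.Perm (Fin (m + 1))) :=
      { carrier := {σ | ∀ (x : E) (v : Fin (m + 1) → E),
          iteratedFDeriv ℝ (m + 1) f x (v ∘ σ) = iteratedFDeriv ℝ (m + 1) f x v}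
        one_mem' := fun x v => rfl
        mul_mem' := fun {a b} ha hb x v => by
          rw [Equiv.Perm.coe_mul, ← Function.comp_assoc, hb, ha] }
    suffices hs : s = ⊤ by
      intro σ
      have : σ ∈ s := hs ▸ Submonoid.mem_top σ
      exact this
    -- Transpositions of neighbouring arguments generate all permutations.
    rw [eq_top_iff, ← Equiv.Perm.mclosure_swap_castSucc_succ, Submonoid.closure_le]
    rintro _ ⟨i, rfl⟩ x v
    cases m with
    | zero => exact i.elim0
    | succ m =>
      refine Fin.cases ?_ (fun i => ?_) i
      · -- the first two arguments
        have hsymm : IsSymmSndFDerivAt ℝ (iteratedFDeriv ℝ m f) x :=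
          (contDiff_infty.1 (hdiff m) 2).contDiffAt.isSymmSndFDerivAt (by simp)
        have h2 : ∀ w : Fin (m + 2) → E, iteratedFDeriv ℝ (m + 2) f x w =
            fderiv ℝ (fderiv ℝ (iteratedFDeriv ℝ m f)) x (w 0) (w 1) (fun i => w i.succ.succ) := by
          intro w
          rw [iteratedFDeriv_succ_apply_left]
          have : iteratedFDeriv ℝ (m + 1) f = fun z =>
              (continuousMultilinearCurryLeftEquiv ℝ (fun _ : Fin (m + 1) => E) ℝ).symm
                (fderiv ℝ (iteratedFDeriv ℝ m f) z) := by
            funext z; rw [iteratedFDeriv_succ_eq_comp_left]; rfl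
          have hlin := ((continuousMultilinearCurryLeftEquiv ℝ (fun _ : Fin (m + 1) => E)
            ℝ).symm.toContinuousLinearEquiv.toContinuousLinearMap).hasFDerivAt.comp x
              (((contDiff_infty_iff_fderiv.1 (hdiff m)).2.differentiable
                (by simp)) x).hasFDerivAt
          rw [this]
          exact congrArg (fun L => L (w 0) (Fin.tail w)) hlin.fderiv
        rw [h2, h2]
        have e0 : (v ∘ Equiv.swap (Fin.castSucc 0) (Fin.succ 0)) (0 : Fin (m + 2)) = v 1 := by
          simp
        have e1 : (v ∘ Equiv.swap (Fin.castSucc 0) (Fin.succ 0)) (1 : Fin (m + 2)) = v 0 := by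
          simp
        rw [e0, e1, hsymm]
        congr 1
      · -- arguments after the first
        rw [iteratedFDeriv_succ_apply_left, iteratedFDeriv_succ_apply_left]
        have h0 : (v ∘ Equiv.swap (Fin.castSucc i.succ) (Fin.succ i.succ)) 0 = v 0 := by
          simp only [Function.comp_apply]
          rw [Equiv.swap_apply_of_ne_of_ne] <;> simp [Fin.ext_iff]
        have h1 : Fin.tail (v ∘ Equiv.swap (Fin.castSucc i.succ) (Fin.succ i.succ)) =
            Fin.tail v ∘ Equiv.swap (Fin.castSucc i) (Fin.succ i) := by
          funext j
          simp only [Fin.tail, Function.comp_apply]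
          congr 1
          rw [← Fin.succ_castSucc]
          exact (Fin.succ_injective _).swap_apply _ _ _
        rw [h0, h1]
        have key : ∀ w : Fin (m + 1) → E, fderiv ℝ (iteratedFDeriv ℝ (m + 1) f) x (v 0) w =
            fderiv ℝ (fun z => iteratedFDeriv ℝ (m + 1) f z w) x (v 0) := by
          intro w
          exact (DFunLike.congr_fun (((ContinuousMultilinearMap.apply ℝ _ ℝ w).hasFDerivAt.comp x
            (hd (m + 1) x).hasFDerivAt).fderiv) (v 0)).symm
        rw [key, key]
        congr 2
        funext z
        exact ih _ z _

theorem isSymmTensor_derivTensor {f : Plane → ℝ} (hf : ContDiff ℝ (⊤ : ℕ∞) f) (ξ : Plane) (m : ℕ) :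
    IsSymmTensor (derivTensor f ξ m) := fun σ ν =>
  iteratedFDeriv_comp_perm_of_contDiff hf m σ ξ fun i => EuclideanSpace.single (ν i) (1 : ℝ)

/-! ### The derivatives of the world function at a fixed point -/

theorem sum_append_mul {m n : ℕ} (f : (Fin m → Fin 2) → ℝ) (g : (Fin n → Fin 2) → ℝ) :
    ∑ ν : Fin (m + n) → Fin 2, f (fun i => ν (Fin.castAdd n i)) * g (fun i => ν (Fin.natAdd m i)) =
      (∑ ν, f ν) * ∑ ν, g ν := by
  rw [← (Fin.appendEquiv m n).sum_comp, Fintype.sum_prod_type, Finset.sum_mul_sum]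
  simp [Fin.appendEquiv]

/-- The polynomial of a tensor product is the product of the polynomials. -/
theorem tensorPoly_mul {m n : ℕ} (T : PlaneTensor m) (T' : PlaneTensor n) (y : Plane) :
    tensorPoly (fun ν : Fin (m + n) → Fin 2 =>
      T (fun i => ν (Fin.castAdd n i)) * T' (fun i => ν (Fin.natAdd m i))) y =
      tensorPoly T y * tensorPoly T' y := by
  unfold tensorPoly
  rw [← sum_append_mul (fun ν => T ν * ∏ i, y (ν i)) (fun ν => T' ν * ∏ i, y (ν i))]
  refine Finset.sum_congr rfl fun ν _ => ?_
  rw [Fin.prod_univ_add]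
  ring

theorem tensorPoly_add {m : ℕ} (T T' : PlaneTensor m) (y : Plane) :
    tensorPoly (fun ν => T ν + T' ν) y = tensorPoly T y + tensorPoly T' y := by
  simp only [tensorPoly, add_mul, Finset.sum_add_distrib]

theorem tensorPoly_sub {m : ℕ} (T T' : PlaneTensor m) (y : Plane) :
    tensorPoly (fun ν => T ν - T' ν) y = tensorPoly T y - tensorPoly T' y := by
  simp only [tensorPoly, sub_mul, Finset.sum_sub_distrib]

theorem tensorPoly_const_mul {m : ℕ} (c : ℝ) (T : PlaneTensor m) (y : Plane) :
    tensorPoly (fun ν => c * T ν) y = c * tensorPoly T y := by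
  simp only [tensorPoly, mul_assoc, Finset.mul_sum]

theorem tensorPoly_sum {m : ℕ} (T : Fin 2 → PlaneTensor m) (y : Plane) :
    tensorPoly (fun ν => ∑ μ, T μ ν) y = ∑ μ, tensorPoly (T μ) y := by
  simp only [tensorPoly, Finset.sum_mul]
  rw [Finset.sum_comm]

/-- The polynomial of a tensor with a distinguished first index. -/
theorem tensorPoly_one {m : ℕ} (T : Fin 2 → PlaneTensor m) (y : Plane) :
    tensorPoly (fun ν : Fin (1 + m) → Fin 2 => T (ν (Fin.castAdd m 0))
      (fun i => ν (Fin.natAdd 1 i))) y = ∑ μ, y μ * tensorPoly (T μ) y := by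
  have h : ∀ μ : Fin 2, tensorPoly (fun ν : Fin 1 → Fin 2 => if ν 0 = μ then (1 : ℝ) else 0) y =
      y μ := by
    intro μ
    rw [tensorPoly, ← (Equiv.funUnique (Fin 1) (Fin 2)).symm.sum_comp]
    simp
  conv_rhs =>
    enter [2, μ]
    rw [← h μ, ← tensorPoly_mul]
  rw [← tensorPoly_sum]
  simp

/-- The derivatives at a zero of a map `u` of half its squared norm: the Leibniz rule, with the
terms of `u` itself missing. -/
theorem tensorPoly_derivTensor_half_sq {S : Plane → ℝ} {u : Fin 2 → Plane → ℝ} {ξ : Plane}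
    (hu : ∀ μ, ContDiff ℝ (⊤ : ℕ∞) (u μ)) (hS : ∀ x, S x = 1 / 2 * ∑ μ, u μ x ^ 2) (m : ℕ) (y : Plane) :
    tensorPoly (derivTensor S ξ m) y = 1 / 2 * ∑ μ, ∑ i ∈ Finset.range (m + 1), (m.choose i : ℝ) *
      tensorPoly (derivTensor (u μ) ξ i) y * tensorPoly (derivTensor (u μ) ξ (m - i)) y := by
  have hSc : ContDiff ℝ (⊤ : ℕ∞) S := by
    rw [funext hS]; fun_prop
  have hline : ∀ μ, ContDiff ℝ (⊤ : ℕ∞) (fun ε : ℝ => u μ (ξ + ε • y)) := fun μ =>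
    (hu μ).comp (by fun_prop)
  have hat : ∀ μ, ContDiffAt ℝ m (fun ε : ℝ => u μ (ξ + ε • y)) 0 := fun μ =>
    (contDiff_infty.1 (hline μ) m).contDiffAt
  rw [← iteratedDeriv_line_eq_tensorPoly hSc]
  simp only [hS, pow_two]
  rw [iteratedDeriv_const_mul_field, iteratedDeriv_fun_sum fun μ _ => (hat μ).mul (hat μ)]
  congr 1
  refine Finset.sum_congr rfl fun μ _ => ?_
  rw [iteratedDeriv_fun_mul (hat μ) (hat μ)]
  simp only [iteratedDeriv_line_eq_tensorPoly (hu μ)]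

theorem tensorPoly_derivTensor_coord_one (μ : Fin 2) (ξ y : Plane) :
    tensorPoly (derivTensor (fun x : Plane => x μ) ξ 1) y = y μ := by
  rw [← iteratedDeriv_line_eq_tensorPoly (by fun_prop)]
  simp [iteratedDeriv_one]

theorem tensorPoly_derivTensor_coord_of_two_le (μ : Fin 2) (ξ y : Plane) {k : ℕ} (hk : 2 ≤ k) :
    tensorPoly (derivTensor (fun x : Plane => x μ) ξ k) y = 0 := by
  obtain ⟨k, rfl⟩ := Nat.exists_eq_add_of_le' hk
  rw [← iteratedDeriv_line_eq_tensorPoly (by fun_prop), iteratedDeriv_succ', iteratedDeriv_succ']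
  have : deriv (fun ε : ℝ => (ξ + ε • y) μ) = fun _ => y μ := by
    funext ε; simp
  rw [this]
  simp

theorem tensorPoly_derivTensor_sub {f g : Plane → ℝ} (hf : ContDiff ℝ (⊤ : ℕ∞) f)
    (hg : ContDiff ℝ (⊤ : ℕ∞) g) (ξ y : Plane) (m : ℕ) :
    tensorPoly (derivTensor (fun x => f x - g x) ξ m) y =
      tensorPoly (derivTensor f ξ m) y - tensorPoly (derivTensor g ξ m) y := by
  have h : ∀ {f : Plane → ℝ}, ContDiff ℝ (⊤ : ℕ∞) f →
      ContDiffAt ℝ m (fun ε : ℝ => f (ξ + ε • y)) 0 := fun hf =>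
    (contDiff_infty.1 (hf.comp (by fun_prop : ContDiff ℝ (⊤ : ℕ∞) fun ε : ℝ => ξ + ε • y))
      m).contDiffAt
  rw [← iteratedDeriv_line_eq_tensorPoly hf, ← iteratedDeriv_line_eq_tensorPoly hg,
    ← iteratedDeriv_line_eq_tensorPoly (hf.sub hg), ← iteratedDeriv_fun_sub (h hf) (h hg)]

theorem tensorPoly_zero_rank (f : Plane → ℝ) (ξ y : Plane) :
    tensorPoly (derivTensor f ξ 0) y = f ξ := by
  simp [tensorPoly, derivTensor]

section WorldFunctionDerivatives

variable {Φ : Plane → Plane} {S : Plane → ℝ} {ξ₀ : Plane}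

/-- The Leibniz rule for `S = ½|Φ - id|²` at a fixed point of `Φ`. Here `d μ k` is the `k`-th
derivative of the `μ`-th component of `Φ - id` in the direction `y`. -/
theorem tensorPoly_derivTensor_worldFunction (hΦ : ContDiff ℝ (⊤ : ℕ∞) Φ)
    (hS : ∀ x, S x = worldFunction (Φ x) x) (hξ : Φ ξ₀ = ξ₀) {P : (m : ℕ) → Fin 2 → PlaneTensor m}
    (hP : ∀ m μ, P m μ = derivTensor (fun x => Φ x μ) ξ₀ m) (y : Plane) :
    ∃ d : Fin 2 → ℕ → ℝ, (∀ μ, d μ 0 = 0) ∧ (∀ μ, d μ 1 = tensorPoly (P 1 μ) y - y μ) ∧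
      (∀ μ k, 2 ≤ k → d μ k = tensorPoly (P k μ) y) ∧
      ∀ m, tensorPoly (derivTensor S ξ₀ m) y =
        1 / 2 * ∑ μ, ∑ i ∈ Finset.range (m + 1), (m.choose i : ℝ) * d μ i * d μ (m - i) := by
  have hc : ∀ μ : Fin 2, ContDiff ℝ (⊤ : ℕ∞) fun x => Φ x μ := fun μ => by fun_prop
  have hsub := fun μ m => tensorPoly_derivTensor_sub (hc μ)
    (by fun_prop : ContDiff ℝ (⊤ : ℕ∞) fun x : Plane => x μ) ξ₀ y m
  refine ⟨fun μ i => tensorPoly (derivTensor (fun x => Φ x μ - x μ) ξ₀ i) y, fun μ => ?_,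
    fun μ => ?_, fun μ k hk => ?_, fun m => ?_⟩
  · simp [tensorPoly_zero_rank, hξ]
  · simp only [hsub, hP, tensorPoly_derivTensor_coord_one]
  · simp only [hsub, hP, tensorPoly_derivTensor_coord_of_two_le _ _ _ hk, sub_zero]
  · refine tensorPoly_derivTensor_half_sq (u := fun μ x => Φ x μ - x μ)
      (fun μ => by fun_prop) (fun x => ?_) m y
    rw [hS, worldFunction]
    congr 1
    exact Finset.sum_congr rfl fun μ _ => by ring

theorem contDiff_worldFunction_comp (hΦ : ContDiff ℝ (⊤ : ℕ∞) Φ)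
    (hS : ∀ x, S x = worldFunction (Φ x) x) : ContDiff ℝ (⊤ : ℕ∞) S := by
  rw [funext hS]
  unfold worldFunction
  fun_prop

/-- By polarization, an identity for the derivatives of `S` holds as soon as the two sides have the
same polynomial. -/
theorem derivTensor_eq_symmetrize (hΦ : ContDiff ℝ (⊤ : ℕ∞) Φ)
    (hS : ∀ x, S x = worldFunction (Φ x) x) {m : ℕ} {T : PlaneTensor m}
    (h : ∀ y, tensorPoly (derivTensor S ξ₀ m) y = tensorPoly T y) :
    derivTensor S ξ₀ m = symmetrize T :=
  (isSymmTensor_derivTensor (contDiff_worldFunction_comp hΦ hS) ξ₀ m).eq_of_tensorPoly_eq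
    (isSymmTensor_symmetrize T) fun y => by rw [tensorPoly_symmetrize, h]

theorem derivTensor_two (hΦ : ContDiff ℝ (⊤ : ℕ∞) Φ) (hS : ∀ x, S x = worldFunction (Φ x) x)
    (hξ : Φ ξ₀ = ξ₀) {P : (m : ℕ) → Fin 2 → PlaneTensor m}
    (hP : ∀ m μ, P m μ = derivTensor (fun x => Φ x μ) ξ₀ m) :
    derivTensor S ξ₀ 2 = symmetrize (fun a : Fin 2 → Fin 2 =>
      (1 : Matrix (Fin 2) (Fin 2) ℝ) (a 0) (a 1) - 2 * P 1 (a 0) ![a 1]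
        + ∑ μ : Fin 2, P 1 μ ![a 0] * P 1 μ ![a 1]) := by
  refine derivTensor_eq_symmetrize hΦ hS fun y => ?_
  have e1 : ∀ (P : Fin 2 → PlaneTensor 1), tensorPoly (fun a : Fin 2 → Fin 2 =>
      P (a 0) ![a 1]) y = ∑ μ, y μ * tensorPoly (P μ) y := fun P => by
    rw [← tensorPoly_one]
    congr 1; funext a; congr 1; funext i; fin_cases i; rfl
  have e2 : ∀ (P P' : PlaneTensor 1), tensorPoly (fun a : Fin 2 → Fin 2 =>
      P ![a 0] * P' ![a 1]) y = tensorPoly P y * tensorPoly P' y := fun P P' => by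
    rw [← tensorPoly_mul]
    congr 1; funext a; congr 2 <;> funext i <;> fin_cases i <;> rfl
  have e4 : ∀ μ, tensorPoly (fun ν : Fin 1 → Fin 2 => (1 : Matrix (Fin 2) (Fin 2) ℝ) μ (ν 0)) y
      = y μ := fun μ => by
    rw [tensorPoly, ← (Equiv.funUnique (Fin 1) (Fin 2)).symm.sum_comp]
    simp [Matrix.one_apply]
  have e3 : tensorPoly (fun a : Fin 2 → Fin 2 => (1 : Matrix (Fin 2) (Fin 2) ℝ) (a 0) (a 1)) y =
      ∑ μ, y μ * y μ :=
    (e1 fun μ ν => (1 : Matrix (Fin 2) (Fin 2) ℝ) μ (ν 0)).trans (by simp only [e4])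
  obtain ⟨d, d0, d1, d2, hd⟩ := tensorPoly_derivTensor_worldFunction hΦ hS hξ hP y
  rw [hd, tensorPoly_add, tensorPoly_sub,
    tensorPoly_const_mul, tensorPoly_sum, e3, e1 (P 1)]
  simp only [e2, Finset.sum_range_succ, Finset.sum_range_zero, Fin.sum_univ_two, Nat.reduceSub,
    Nat.reduceAdd, Nat.reduceLeDiff, d0, d1, d2, Nat.sub_zero, Nat.sub_self]
  norm_num [Nat.choose]
  ring

theorem derivTensor_three (hΦ : ContDiff ℝ (⊤ : ℕ∞) Φ) (hS : ∀ x, S x = worldFunction (Φ x) x)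
    (hξ : Φ ξ₀ = ξ₀) {P : (m : ℕ) → Fin 2 → PlaneTensor m}
    (hP : ∀ m μ, P m μ = derivTensor (fun x => Φ x μ) ξ₀ m) :
    derivTensor S ξ₀ 3 = symmetrize (fun a : Fin 3 → Fin 2 =>
      -3 * P 2 (a 0) ![a 1, a 2]
        + 3 * ∑ μ : Fin 2, P 1 μ ![a 0] * P 2 μ ![a 1, a 2]) := by
  refine derivTensor_eq_symmetrize hΦ hS fun y => ?_
  have e1 : tensorPoly (fun a : Fin 3 → Fin 2 => P 2 (a 0) ![a 1, a 2]) y =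
      ∑ μ, y μ * tensorPoly (P 2 μ) y := by
    rw [← tensorPoly_one]
    congr 1; funext a; congr 1; funext i; fin_cases i <;> rfl
  have e2 : ∀ μ, tensorPoly (fun a : Fin 3 → Fin 2 => P 1 μ ![a 0] * P 2 μ ![a 1, a 2]) y =
      tensorPoly (P 1 μ) y * tensorPoly (P 2 μ) y := fun μ => by
    rw [← tensorPoly_mul]
    congr 1; funext a; congr 2 <;> funext i <;> fin_cases i <;> rfl
  obtain ⟨d, d0, d1, d2, hd⟩ := tensorPoly_derivTensor_worldFunction hΦ hS hξ hP y
  rw [hd, tensorPoly_add,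
    tensorPoly_const_mul, tensorPoly_const_mul, tensorPoly_sum, e1]
  simp only [e2, Finset.sum_range_succ, Finset.sum_range_zero, Fin.sum_univ_two, Nat.reduceSub,
    Nat.reduceAdd, Nat.reduceLeDiff, d0, d1, d2, Nat.sub_zero, Nat.sub_self]
  norm_num [Nat.choose]
  ring

theorem derivTensor_four (hΦ : ContDiff ℝ (⊤ : ℕ∞) Φ) (hS : ∀ x, S x = worldFunction (Φ x) x)
    (hξ : Φ ξ₀ = ξ₀) {P : (m : ℕ) → Fin 2 → PlaneTensor m}
    (hP : ∀ m μ, P m μ = derivTensor (fun x => Φ x μ) ξ₀ m) :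
    derivTensor S ξ₀ 4 = symmetrize (fun a : Fin 4 → Fin 2 =>
      -4 * P 3 (a 0) ![a 1, a 2, a 3]
        + 4 * (∑ μ : Fin 2, P 1 μ ![a 0] * P 3 μ ![a 1, a 2, a 3])
        + 3 * (∑ μ : Fin 2, P 2 μ ![a 0, a 1] * P 2 μ ![a 2, a 3])) := by
  refine derivTensor_eq_symmetrize hΦ hS fun y => ?_
  have e1 : tensorPoly (fun a : Fin 4 → Fin 2 => P 3 (a 0) ![a 1, a 2, a 3]) y =
      ∑ μ, y μ * tensorPoly (P 3 μ) y := by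
    rw [← tensorPoly_one]
    congr 1; funext a; congr 1; funext i; fin_cases i <;> rfl
  have e2 : ∀ μ, tensorPoly (fun a : Fin 4 → Fin 2 => P 1 μ ![a 0] * P 3 μ ![a 1, a 2, a 3]) y =
      tensorPoly (P 1 μ) y * tensorPoly (P 3 μ) y := fun μ => by
    rw [← tensorPoly_mul]
    congr 1; funext a; congr 2 <;> funext i <;> fin_cases i <;> rfl
  have e3 : ∀ μ, tensorPoly (fun a : Fin 4 → Fin 2 => P 2 μ ![a 0, a 1] * P 2 μ ![a 2, a 3]) y =
      tensorPoly (P 2 μ) y * tensorPoly (P 2 μ) y := fun μ => by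
    rw [← tensorPoly_mul]
    congr 1; funext a; congr 2 <;> funext i <;> fin_cases i <;> rfl
  obtain ⟨d, d0, d1, d2, hd⟩ := tensorPoly_derivTensor_worldFunction hΦ hS hξ hP y
  rw [hd, tensorPoly_add, tensorPoly_add,
    tensorPoly_const_mul, tensorPoly_const_mul, tensorPoly_const_mul, tensorPoly_sum,
    tensorPoly_sum, e1]
  simp only [e2, e3, Finset.sum_range_succ, Finset.sum_range_zero, Fin.sum_univ_two, Nat.reduceSub,
    Nat.reduceAdd, Nat.reduceLeDiff, d0, d1, d2, Nat.sub_zero, Nat.sub_self]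
  norm_num [Nat.choose]
  ring

theorem derivTensor_five (hΦ : ContDiff ℝ (⊤ : ℕ∞) Φ) (hS : ∀ x, S x = worldFunction (Φ x) x)
    (hξ : Φ ξ₀ = ξ₀) {P : (m : ℕ) → Fin 2 → PlaneTensor m}
    (hP : ∀ m μ, P m μ = derivTensor (fun x => Φ x μ) ξ₀ m) :
    derivTensor S ξ₀ 5 = symmetrize (fun a : Fin 5 → Fin 2 =>
      -5 * P 4 (a 0) ![a 1, a 2, a 3, a 4]
        + 5 * (∑ μ : Fin 2, P 1 μ ![a 0] * P 4 μ ![a 1, a 2, a 3, a 4])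
        + 10 * (∑ μ : Fin 2, P 2 μ ![a 0, a 1] * P 3 μ ![a 2, a 3, a 4])) := by
  refine derivTensor_eq_symmetrize hΦ hS fun y => ?_
  have e1 : tensorPoly (fun a : Fin 5 → Fin 2 => P 4 (a 0) ![a 1, a 2, a 3, a 4]) y =
      ∑ μ, y μ * tensorPoly (P 4 μ) y := by
    rw [← tensorPoly_one]
    congr 1; funext a; congr 1; funext i; fin_cases i <;> rfl
  have e2 : ∀ μ, tensorPoly (fun a : Fin 5 → Fin 2 =>
      P 1 μ ![a 0] * P 4 μ ![a 1, a 2, a 3, a 4]) y =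
      tensorPoly (P 1 μ) y * tensorPoly (P 4 μ) y := fun μ => by
    rw [← tensorPoly_mul]
    congr 1; funext a; congr 2 <;> funext i <;> fin_cases i <;> rfl
  have e3 : ∀ μ, tensorPoly (fun a : Fin 5 → Fin 2 =>
      P 2 μ ![a 0, a 1] * P 3 μ ![a 2, a 3, a 4]) y =
      tensorPoly (P 2 μ) y * tensorPoly (P 3 μ) y := fun μ => by
    rw [← tensorPoly_mul]
    congr 1; funext a; congr 2 <;> funext i <;> fin_cases i <;> rfl
  obtain ⟨d, d0, d1, d2, hd⟩ := tensorPoly_derivTensor_worldFunction hΦ hS hξ hP y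
  rw [hd, tensorPoly_add, tensorPoly_add,
    tensorPoly_const_mul, tensorPoly_const_mul, tensorPoly_const_mul, tensorPoly_sum,
    tensorPoly_sum, e1]
  simp only [e2, e3, Finset.sum_range_succ, Finset.sum_range_zero, Fin.sum_univ_two, Nat.reduceSub,
    Nat.reduceAdd, Nat.reduceLeDiff, d0, d1, d2, Nat.sub_zero, Nat.sub_self]
  norm_num [Nat.choose]
  ring

theorem derivTensor_six (hΦ : ContDiff ℝ (⊤ : ℕ∞) Φ) (hS : ∀ x, S x = worldFunction (Φ x) x)
    (hξ : Φ ξ₀ = ξ₀) {P : (m : ℕ) → Fin 2 → PlaneTensor m}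
    (hP : ∀ m μ, P m μ = derivTensor (fun x => Φ x μ) ξ₀ m) :
    derivTensor S ξ₀ 6 = symmetrize (fun a : Fin 6 → Fin 2 =>
      -6 * P 5 (a 0) ![a 1, a 2, a 3, a 4, a 5]
        + 6 * (∑ μ : Fin 2, P 1 μ ![a 0] * P 5 μ ![a 1, a 2, a 3, a 4, a 5])
        + 15 * (∑ μ : Fin 2, P 2 μ ![a 0, a 1] * P 4 μ ![a 2, a 3, a 4, a 5])
        + 10 * (∑ μ : Fin 2, P 3 μ ![a 0, a 1, a 2] * P 3 μ ![a 3, a 4, a 5])) := by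
  refine derivTensor_eq_symmetrize hΦ hS fun y => ?_
  have e1 : tensorPoly (fun a : Fin 6 → Fin 2 => P 5 (a 0) ![a 1, a 2, a 3, a 4, a 5]) y =
      ∑ μ, y μ * tensorPoly (P 5 μ) y := by
    rw [← tensorPoly_one]
    congr 1; funext a; congr 1; funext i; fin_cases i <;> rfl
  have e2 : ∀ μ, tensorPoly (fun a : Fin 6 → Fin 2 =>
      P 1 μ ![a 0] * P 5 μ ![a 1, a 2, a 3, a 4, a 5]) y =
      tensorPoly (P 1 μ) y * tensorPoly (P 5 μ) y := fun μ => by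
    rw [← tensorPoly_mul]
    congr 1; funext a; congr 2 <;> funext i <;> fin_cases i <;> rfl
  have e3 : ∀ μ, tensorPoly (fun a : Fin 6 → Fin 2 =>
      P 2 μ ![a 0, a 1] * P 4 μ ![a 2, a 3, a 4, a 5]) y =
      tensorPoly (P 2 μ) y * tensorPoly (P 4 μ) y := fun μ => by
    rw [← tensorPoly_mul]
    congr 1; funext a; congr 2 <;> funext i <;> fin_cases i <;> rfl
  have e4 : ∀ μ, tensorPoly (fun a : Fin 6 → Fin 2 =>
      P 3 μ ![a 0, a 1, a 2] * P 3 μ ![a 3, a 4, a 5]) y =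
      tensorPoly (P 3 μ) y * tensorPoly (P 3 μ) y := fun μ => by
    rw [← tensorPoly_mul]
    congr 1; funext a; congr 2 <;> funext i <;> fin_cases i <;> rfl
  obtain ⟨d, d0, d1, d2, hd⟩ := tensorPoly_derivTensor_worldFunction hΦ hS hξ hP y
  rw [hd, tensorPoly_add, tensorPoly_add, tensorPoly_add,
    tensorPoly_const_mul, tensorPoly_const_mul, tensorPoly_const_mul, tensorPoly_const_mul,
    tensorPoly_sum, tensorPoly_sum, tensorPoly_sum, e1]
  simp only [e2, e3, e4, Finset.sum_range_succ, Finset.sum_range_zero, Fin.sum_univ_two, Nat.reduceSub,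
    Nat.reduceAdd, Nat.reduceLeDiff, d0, d1, d2, Nat.sub_zero, Nat.sub_self]
  norm_num [Nat.choose]
  ring

end WorldFunctionDerivatives

/-! ### Linear changes of coordinates and contractions along graphs -/

theorem sum_fin_succ_fun {m : ℕ} (f : (Fin (m + 1) → Fin 2) → ℝ) :
    ∑ ν, f ν = ∑ i : Fin 2, ∑ ν : Fin m → Fin 2, f (Matrix.vecCons i ν) := by
  rw [← (Fin.consEquiv fun _ => Fin 2).sum_comp, Fintype.sum_prod_type]
  rfl

theorem sum_fin_zero_fun (f : (Fin 0 → Fin 2) → ℝ) : ∑ ν, f ν = f ![] := by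
  rw [Fintype.sum_unique]
  exact congrArg f (Subsingleton.elim _ _)

/-- The tensor `T_{ν₁ … νₘ} L^{ν₁}_{κ₁} ⋯ L^{νₘ}_{κₘ}`, that is, `T` in the coordinates `z` with
`y = L z`. -/
def tensorPull (L : Matrix (Fin 2) (Fin 2) ℝ) {m : ℕ} (T : PlaneTensor m) : PlaneTensor m :=
  fun κ => ∑ ν : Fin m → Fin 2, T ν * ∏ i, L (ν i) (κ i)

/-- `T'` expresses `T` in the coordinates `z` with `y = L z`. -/
def IsPull (L : Matrix (Fin 2) (Fin 2) ℝ) {m : ℕ} (T T' : PlaneTensor m) : Prop :=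
  ∀ κ, tensorPull L T κ = T' κ

section Pull

variable {L Q : Matrix (Fin 2) (Fin 2) ℝ}

theorem IsPull.mul {m n : ℕ} {T T' : PlaneTensor m} {R R' : PlaneTensor n} (hT : IsPull L T T')
    (hR : IsPull L R R') :
    IsPull L (fun ν : Fin (m + n) → Fin 2 =>
        T (fun i => ν (Fin.castAdd n i)) * R (fun i => ν (Fin.natAdd m i)))
      (fun κ : Fin (m + n) → Fin 2 =>
        T' (fun i => κ (Fin.castAdd n i)) * R' (fun i => κ (Fin.natAdd m i))) := by
  intro κ
  dsimp only
  rw [← hT, ← hR, tensorPull, tensorPull, tensorPull, ← sum_append_mul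
    (fun ν => T ν * ∏ i, L (ν i) (κ (Fin.castAdd n i)))
    (fun ν => R ν * ∏ i, L (ν i) (κ (Fin.natAdd m i)))]
  refine Finset.sum_congr rfl fun ν _ => ?_
  rw [Fin.prod_univ_add]
  ring

theorem vec_eta_one (w : Fin 1 → Fin 2) : ![w 0] = w := by
  funext i; fin_cases i; rfl

theorem vec_eta_two (w : Fin 2 → Fin 2) : ![w 0, w 1] = w := by
  funext i; fin_cases i <;> rfl

theorem vec_eta_three (w : Fin 3 → Fin 2) : ![w 0, w 1, w 2] = w := by
  funext i; fin_cases i <;> rfl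

theorem vec_eta_four (w : Fin 4 → Fin 2) : ![w 0, w 1, w 2, w 3] = w := by
  funext i; fin_cases i <;> rfl

/-- Contraction of a tensor with copies of `Q = L Lᵀ` along the edges `(a e, b e)` of a graph whose
half-edges are the indices of the tensor: in the coordinates `z` the matrix `Q` becomes the
identity, and the indices of each edge coincide. The map `s` sends a half-edge to its edge. -/
theorem IsPull.sum_mul_prod (hL : ∀ i j, Q i j = ∑ k, L i k * L j k) {m n : ℕ}
    {F F' : PlaneTensor m} (hF : IsPull L F F') (a b : Fin n → Fin m) (s : Fin m → Fin n)
    (hs : ∀ x : Fin m → Fin n → ℝ, ∏ e, (x (a e) e * x (b e) e) = ∏ i, x i (s i)) :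
    ∑ ν, F ν * ∏ e, Q (ν (a e)) (ν (b e)) = ∑ κ : Fin n → Fin 2, F' (fun i => κ (s i)) := by
  simp only [← hF _, tensorPull]
  rw [Finset.sum_comm]
  refine Finset.sum_congr rfl fun ν _ => ?_
  rw [← Finset.mul_sum]
  congr 1
  simp only [hL]
  rw [Finset.prod_univ_sum]
  simp only [Fintype.piFinset_univ]
  refine Finset.sum_congr rfl fun κ _ => ?_
  exact hs fun i e => L (ν i) (κ e)

theorem IsPull.sum_edges_one (hL : ∀ i j, Q i j = ∑ k, L i k * L j k) {m : ℕ}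
    {F F' : PlaneTensor m} (hF : IsPull L F F') (a b : Fin 1 → Fin m) (s : Fin m → Fin 1)
    (hs : ∀ x : Fin m → Fin 1 → ℝ, ∏ e, (x (a e) e * x (b e) e) = ∏ i, x i (s i)) :
    ∑ ν, F ν * Q (ν (a 0)) (ν (b 0)) = ∑ κ : Fin 1 → Fin 2, F' (fun i => κ (s i)) := by
  simpa only [Fin.prod_univ_one, ← mul_assoc] using hF.sum_mul_prod hL a b s hs

theorem IsPull.sum_edges_two (hL : ∀ i j, Q i j = ∑ k, L i k * L j k) {m : ℕ}
    {F F' : PlaneTensor m} (hF : IsPull L F F') (a b : Fin 2 → Fin m) (s : Fin m → Fin 2)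
    (hs : ∀ x : Fin m → Fin 2 → ℝ, ∏ e, (x (a e) e * x (b e) e) = ∏ i, x i (s i)) :
    ∑ ν, F ν * Q (ν (a 0)) (ν (b 0)) * Q (ν (a 1)) (ν (b 1)) =
      ∑ κ : Fin 2 → Fin 2, F' (fun i => κ (s i)) := by
  simpa only [Fin.prod_univ_two, ← mul_assoc] using hF.sum_mul_prod hL a b s hs

theorem IsPull.sum_edges_three (hL : ∀ i j, Q i j = ∑ k, L i k * L j k) {m : ℕ}
    {F F' : PlaneTensor m} (hF : IsPull L F F') (a b : Fin 3 → Fin m) (s : Fin m → Fin 3)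
    (hs : ∀ x : Fin m → Fin 3 → ℝ, ∏ e, (x (a e) e * x (b e) e) = ∏ i, x i (s i)) :
    ∑ ν, F ν * Q (ν (a 0)) (ν (b 0)) * Q (ν (a 1)) (ν (b 1)) * Q (ν (a 2)) (ν (b 2)) =
      ∑ κ : Fin 3 → Fin 2, F' (fun i => κ (s i)) := by
  simpa only [Fin.prod_univ_three, ← mul_assoc] using hF.sum_mul_prod hL a b s hs

theorem IsPull.sum_edges_four (hL : ∀ i j, Q i j = ∑ k, L i k * L j k) {m : ℕ}
    {F F' : PlaneTensor m} (hF : IsPull L F F') (a b : Fin 4 → Fin m) (s : Fin m → Fin 4)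
    (hs : ∀ x : Fin m → Fin 4 → ℝ, ∏ e, (x (a e) e * x (b e) e) = ∏ i, x i (s i)) :
    ∑ ν, F ν * Q (ν (a 0)) (ν (b 0)) * Q (ν (a 1)) (ν (b 1)) * Q (ν (a 2)) (ν (b 2)) *
        Q (ν (a 3)) (ν (b 3)) =
      ∑ κ : Fin 4 → Fin 2, F' (fun i => κ (s i)) := by
  simpa only [Fin.prod_univ_four, ← mul_assoc] using hF.sum_mul_prod hL a b s hs

theorem IsPull.sum_edges_five (hL : ∀ i j, Q i j = ∑ k, L i k * L j k) {m : ℕ}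
    {F F' : PlaneTensor m} (hF : IsPull L F F') (a b : Fin 5 → Fin m) (s : Fin m → Fin 5)
    (hs : ∀ x : Fin m → Fin 5 → ℝ, ∏ e, (x (a e) e * x (b e) e) = ∏ i, x i (s i)) :
    ∑ ν, F ν * Q (ν (a 0)) (ν (b 0)) * Q (ν (a 1)) (ν (b 1)) * Q (ν (a 2)) (ν (b 2)) *
        Q (ν (a 3)) (ν (b 3)) * Q (ν (a 4)) (ν (b 4)) =
      ∑ κ : Fin 5 → Fin 2, F' (fun i => κ (s i)) := by
  simpa only [Fin.prod_univ_five, ← mul_assoc] using hF.sum_mul_prod hL a b s hs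

theorem IsPull.sum_edges_six (hL : ∀ i j, Q i j = ∑ k, L i k * L j k) {m : ℕ}
    {F F' : PlaneTensor m} (hF : IsPull L F F') (a b : Fin 6 → Fin m) (s : Fin m → Fin 6)
    (hs : ∀ x : Fin m → Fin 6 → ℝ, ∏ e, (x (a e) e * x (b e) e) = ∏ i, x i (s i)) :
    ∑ ν, F ν * Q (ν (a 0)) (ν (b 0)) * Q (ν (a 1)) (ν (b 1)) * Q (ν (a 2)) (ν (b 2)) *
        Q (ν (a 3)) (ν (b 3)) * Q (ν (a 4)) (ν (b 4)) * Q (ν (a 5)) (ν (b 5)) =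
      ∑ κ : Fin 6 → Fin 2, F' (fun i => κ (s i)) := by
  simpa only [Fin.prod_univ_six, ← mul_assoc] using hF.sum_mul_prod hL a b s hs

/-- A contraction with `Q = L Lᵀ` becomes a contraction with the identity. -/
theorem IsPull.contractPair (hL : ∀ i j, Q i j = ∑ k, L i k * L j k) {m : ℕ}
    {T T' : PlaneTensor (m + 2)} (hT : IsPull L T T') :
    IsPull L (_root_.contractPair Q T) (_root_.contractPair 1 T') := by
  intro κ
  have h1 : _root_.contractPair 1 T' κ = ∑ k, T' (Matrix.vecCons k (Matrix.vecCons k κ)) := by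
    simp [_root_.contractPair, Matrix.one_apply]
  rw [h1]
  simp only [← hT _, tensorPull, _root_.contractPair, hL, sum_fin_succ_fun (m := m + 1),
    sum_fin_succ_fun (m := m), Fin.prod_univ_succ, Matrix.cons_val_zero, Matrix.cons_val_succ,
    Fin.sum_univ_two, ← Finset.sum_add_distrib]
  refine Finset.sum_congr rfl fun ν _ => ?_
  ring

theorem tensorPoly_toEuclideanLin (L : Matrix (Fin 2) (Fin 2) ℝ) {m : ℕ} (T : PlaneTensor m)
    (z : Plane) : tensorPoly T (Matrix.toEuclideanLin L z) = tensorPoly (tensorPull L T) z := by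
  have h : ∀ i, (Matrix.toEuclideanLin L z) i = ∑ k, L i k * z k := fun i => by
    simp [Matrix.toEuclideanLin, Matrix.mulVec, dotProduct]
  simp only [tensorPoly, tensorPull, h, Finset.sum_mul]
  rw [Finset.sum_comm]
  refine Finset.sum_congr rfl fun ν _ => ?_
  rw [Finset.prod_univ_sum]
  simp only [Fintype.piFinset_univ, Finset.mul_sum, Finset.prod_mul_distrib, mul_assoc]

theorem IsSymmTensor.tensorPull {m : ℕ} {T : PlaneTensor m} (hT : IsSymmTensor T)
    (L : Matrix (Fin 2) (Fin 2) ℝ) : IsSymmTensor (_root_.tensorPull L T) := by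
  intro σ κ
  refine Fintype.sum_equiv (Equiv.arrowCongr σ (Equiv.refl (Fin 2))) _ _ fun ν => ?_
  have : (Equiv.arrowCongr σ (Equiv.refl (Fin 2))) ν = ν ∘ σ.symm := rfl
  rw [this, hT, ← Equiv.prod_comp σ fun i => L ((ν ∘ σ.symm) i) (κ i)]
  simp

end Pull

/-- The Cholesky factor of a positive definite `2 × 2` matrix. -/
theorem exists_cholesky {Q : Matrix (Fin 2) (Fin 2) ℝ} (hQ : Q.PosDef) :
    ∃ L : Matrix (Fin 2) (Fin 2) ℝ, (∀ i j, Q i j = ∑ k, L i k * L j k) ∧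
      L.det = Real.sqrt Q.det := by
  have h00 : 0 < Q 0 0 := hQ.diag_pos
  have hdet := hQ.det_pos
  have h10 : Q 1 0 = Q 0 1 := by simpa using hQ.isHermitian.apply 0 1
  rw [Matrix.det_fin_two, h10] at hdet ⊢
  set l := Real.sqrt (Q 0 0) with hl
  have hl0 : 0 < l := Real.sqrt_pos.2 h00
  have hl2 : l * l = Q 0 0 := Real.mul_self_sqrt h00.le
  set d := Real.sqrt (Q 0 0 * Q 1 1 - Q 0 1 * Q 0 1) with hd
  have hd2 : d * d = Q 0 0 * Q 1 1 - Q 0 1 * Q 0 1 := Real.mul_self_sqrt hdet.le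
  refine ⟨!![l, 0; Q 0 1 / l, d / l], fun i j => ?_, ?_⟩
  · fin_cases i <;> fin_cases j <;> simp [Fin.sum_univ_two]
    · exact hl2.symm
    · field_simp
    · rw [h10]; field_simp
    · field_simp
      rw [pow_two, hl2, pow_two, pow_two]
      linarith
  · simp [Matrix.det_fin_two]
    field_simp

/-! ### Contractions of symmetric tensors along particular graphs -/

/-- In the coordinates `z` with `y = L z`, the components of the symmetric tensor `T` are `c k`,
where `k` is the number of indices equal to `1`. -/
def HasComponentsIn (L : Matrix (Fin 2) (Fin 2) ℝ) {m : ℕ} (T : PlaneTensor m) (c : ℕ → ℝ) : Prop :=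
  IsPull L T fun κ => c (∑ i, (κ i : ℕ))

section Graphs

variable {L Q : Matrix (Fin 2) (Fin 2) ℝ}

theorem IsPull.mul_const {m : ℕ} {T T' : PlaneTensor m} (h : IsPull L T T') (q : ℝ) :
    IsPull L (fun ν => T ν * q) (fun κ => T' κ * q) := by
  intro κ
  show _ = T' κ * q
  rw [← h κ, tensorPull, tensorPull, Finset.sum_mul]
  exact Finset.sum_congr rfl fun ν _ => by ring

theorem HasComponentsIn.one {T : PlaneTensor 1} {c : ℕ → ℝ} (h : HasComponentsIn L T c) :
    IsPull L (fun w : Fin 1 → Fin 2 => T ![w 0]) (fun w : Fin 1 → Fin 2 => c (w 0 : ℕ)) := by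
  simpa only [HasComponentsIn, Fin.sum_univ_one, vec_eta_one] using h

theorem HasComponentsIn.two {T : PlaneTensor 2} {c : ℕ → ℝ} (h : HasComponentsIn L T c) :
    IsPull L (fun w : Fin 2 → Fin 2 => T ![w 0, w 1])
      (fun w : Fin 2 → Fin 2 => c ((w 0 : ℕ) + w 1)) := by
  simpa only [HasComponentsIn, Fin.sum_univ_two, vec_eta_two] using h

theorem HasComponentsIn.three {T : PlaneTensor 3} {c : ℕ → ℝ} (h : HasComponentsIn L T c) :
    IsPull L (fun w : Fin 3 → Fin 2 => T ![w 0, w 1, w 2])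
      (fun w : Fin 3 → Fin 2 => c ((w 0 : ℕ) + w 1 + w 2)) := by
  simpa only [HasComponentsIn, Fin.sum_univ_three, vec_eta_three] using h

theorem HasComponentsIn.four {T : PlaneTensor 4} {c : ℕ → ℝ} (h : HasComponentsIn L T c) :
    IsPull L (fun w : Fin 4 → Fin 2 => T ![w 0, w 1, w 2, w 3])
      (fun w : Fin 4 → Fin 2 => c ((w 0 : ℕ) + w 1 + w 2 + w 3)) := by
  simpa only [HasComponentsIn, Fin.sum_univ_four, vec_eta_four] using h

theorem HasComponentsIn.zero {T : PlaneTensor 0} {c : ℕ → ℝ} (h : HasComponentsIn L T c) :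
    T ![] = c 0 := by
  have h0 := h ![]
  rw [tensorPull, sum_fin_zero_fun] at h0
  simpa using h0

theorem HasComponentsIn.contractPair (hL : ∀ i j, Q i j = ∑ k, L i k * L j k) {m : ℕ}
    {T : PlaneTensor (m + 2)} {c : ℕ → ℝ} (h : HasComponentsIn L T c) :
    HasComponentsIn L (_root_.contractPair Q T) fun k => c k + c (k + 2) := by
  intro κ
  rw [IsPull.contractPair hL h κ]
  simp [_root_.contractPair, Matrix.one_apply, Fin.sum_univ_succ (n := m + 1),
    Fin.sum_univ_succ (n := m)]
  congr 1
  omega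

/-! The name of each `sum_graph` lemma lists the valences of the vertices in the order in which the
tensors stand in the product, or the shape of the graph. The two vectors in the proof give the ends
of the edges, the third one the edge at each index. -/

theorem sum_graph_one_one (hL : ∀ i j, Q i j = ∑ k, L i k * L j k)
    {A : PlaneTensor 1} {B : PlaneTensor 1} {a b : ℕ → ℝ}
    (hA : HasComponentsIn L A a) (hB : HasComponentsIn L B b) :
    ∑ ν : Fin 2 → Fin 2,
        A ![ν 0] * B ![ν 1]
          * Q (ν 0) (ν 1) =
      ∑ κ : Fin 1 → Fin 2, a ((κ 0 : ℕ)) * b ((κ 0 : ℕ)) :=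
  (hA.one.mul hB.one).sum_edges_one hL ![0] ![1]
    ![0, 0] (fun x => by simp)

theorem sum_graph_one_one_mul (hL : ∀ i j, Q i j = ∑ k, L i k * L j k)
    {A : PlaneTensor 1} {B : PlaneTensor 1} {a b : ℕ → ℝ} (q : ℝ)
    (hA : HasComponentsIn L A a) (hB : HasComponentsIn L B b) :
    ∑ ν : Fin 2 → Fin 2,
        A ![ν 0] * B ![ν 1] * q
          * Q (ν 0) (ν 1) =
      ∑ κ : Fin 1 → Fin 2, a ((κ 0 : ℕ)) * b ((κ 0 : ℕ)) * q :=
  ((hA.one.mul hB.one).mul_const q).sum_edges_one hL ![0] ![1]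
    ![0, 0] (fun x => by simp)

theorem sum_graph_three_three (hL : ∀ i j, Q i j = ∑ k, L i k * L j k)
    {A : PlaneTensor 3} {B : PlaneTensor 3} {a b : ℕ → ℝ}
    (hA : HasComponentsIn L A a) (hB : HasComponentsIn L B b) :
    ∑ ν : Fin 6 → Fin 2,
        A ![ν 0, ν 1, ν 2] * B ![ν 3, ν 4, ν 5]
          * Q (ν 0) (ν 3) * Q (ν 1) (ν 4) * Q (ν 2) (ν 5) =
      ∑ κ : Fin 3 → Fin 2, a ((κ 0 : ℕ) + κ 1 + κ 2) * b ((κ 0 : ℕ) + κ 1 + κ 2) :=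
  (hA.three.mul hB.three).sum_edges_three hL ![0, 1, 2] ![3, 4, 5]
    ![0, 1, 2, 0, 1, 2] (fun x => by simp [Fin.prod_univ_succ]; ring)

theorem sum_graph_three_three_mul (hL : ∀ i j, Q i j = ∑ k, L i k * L j k)
    {A : PlaneTensor 3} {B : PlaneTensor 3} {a b : ℕ → ℝ} (q : ℝ)
    (hA : HasComponentsIn L A a) (hB : HasComponentsIn L B b) :
    ∑ ν : Fin 6 → Fin 2,
        A ![ν 0, ν 1, ν 2] * B ![ν 3, ν 4, ν 5] * q
          * Q (ν 0) (ν 3) * Q (ν 1) (ν 4) * Q (ν 2) (ν 5) =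
      ∑ κ : Fin 3 → Fin 2, a ((κ 0 : ℕ) + κ 1 + κ 2) * b ((κ 0 : ℕ) + κ 1 + κ 2) * q :=
  ((hA.three.mul hB.three).mul_const q).sum_edges_three hL ![0, 1, 2] ![3, 4, 5]
    ![0, 1, 2, 0, 1, 2] (fun x => by simp [Fin.prod_univ_succ]; ring)

theorem sum_graph_two_two (hL : ∀ i j, Q i j = ∑ k, L i k * L j k)
    {A : PlaneTensor 2} {B : PlaneTensor 2} {a b : ℕ → ℝ}
    (hA : HasComponentsIn L A a) (hB : HasComponentsIn L B b) :
    ∑ ν : Fin 4 → Fin 2,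
        A ![ν 0, ν 1] * B ![ν 2, ν 3]
          * Q (ν 0) (ν 2) * Q (ν 1) (ν 3) =
      ∑ κ : Fin 2 → Fin 2, a ((κ 0 : ℕ) + κ 1) * b ((κ 0 : ℕ) + κ 1) :=
  (hA.two.mul hB.two).sum_edges_two hL ![0, 1] ![2, 3]
    ![0, 1, 0, 1] (fun x => by simp [Fin.prod_univ_succ]; ring)

theorem sum_graph_four_four (hL : ∀ i j, Q i j = ∑ k, L i k * L j k)
    {A : PlaneTensor 4} {B : PlaneTensor 4} {a b : ℕ → ℝ}
    (hA : HasComponentsIn L A a) (hB : HasComponentsIn L B b) :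
    ∑ ν : Fin 8 → Fin 2,
        A ![ν 0, ν 1, ν 2, ν 3] * B ![ν 4, ν 5, ν 6, ν 7]
          * Q (ν 0) (ν 4) * Q (ν 1) (ν 5) * Q (ν 2) (ν 6) * Q (ν 3) (ν 7) =
      ∑ κ : Fin 4 → Fin 2, a ((κ 0 : ℕ) + κ 1 + κ 2 + κ 3) * b ((κ 0 : ℕ) + κ 1 + κ 2 + κ 3) :=
  (hA.four.mul hB.four).sum_edges_four hL ![0, 1, 2, 3] ![4, 5, 6, 7]
    ![0, 1, 2, 3, 0, 1, 2, 3] (fun x => by simp [Fin.prod_univ_succ]; ring)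

theorem sum_graph_one_three_two (hL : ∀ i j, Q i j = ∑ k, L i k * L j k)
    {A : PlaneTensor 1} {B : PlaneTensor 3} {C : PlaneTensor 2} {a b c : ℕ → ℝ}
    (hA : HasComponentsIn L A a) (hB : HasComponentsIn L B b) (hC : HasComponentsIn L C c) :
    ∑ ν : Fin 6 → Fin 2,
        A ![ν 0] * B ![ν 1, ν 2, ν 3] * C ![ν 4, ν 5]
          * Q (ν 0) (ν 1) * Q (ν 2) (ν 4) * Q (ν 3) (ν 5) =
      ∑ κ : Fin 3 → Fin 2, a ((κ 0 : ℕ)) * b ((κ 0 : ℕ) + κ 1 + κ 2) * c ((κ 1 : ℕ) + κ 2) :=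
  ((hA.one.mul hB.three).mul hC.two).sum_edges_three hL ![0, 2, 3] ![1, 4, 5]
    ![0, 0, 1, 2, 1, 2] (fun x => by simp [Fin.prod_univ_succ]; ring)

theorem sum_graph_one_one_two (hL : ∀ i j, Q i j = ∑ k, L i k * L j k)
    {A : PlaneTensor 1} {B : PlaneTensor 1} {C : PlaneTensor 2} {a b c : ℕ → ℝ}
    (hA : HasComponentsIn L A a) (hB : HasComponentsIn L B b) (hC : HasComponentsIn L C c) :
    ∑ ν : Fin 4 → Fin 2,
        A ![ν 0] * B ![ν 1] * C ![ν 2, ν 3]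
          * Q (ν 0) (ν 2) * Q (ν 1) (ν 3) =
      ∑ κ : Fin 2 → Fin 2, a ((κ 0 : ℕ)) * b ((κ 1 : ℕ)) * c ((κ 0 : ℕ) + κ 1) :=
  ((hA.one.mul hB.one).mul hC.two).sum_edges_two hL ![0, 1] ![2, 3]
    ![0, 1, 0, 1] (fun x => by simp [Fin.prod_univ_succ]; ring)

theorem sum_graph_one_three_four (hL : ∀ i j, Q i j = ∑ k, L i k * L j k)
    {A : PlaneTensor 1} {B : PlaneTensor 3} {C : PlaneTensor 4} {a b c : ℕ → ℝ}
    (hA : HasComponentsIn L A a) (hB : HasComponentsIn L B b) (hC : HasComponentsIn L C c) :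
    ∑ ν : Fin 8 → Fin 2,
        A ![ν 0] * B ![ν 1, ν 2, ν 3] * C ![ν 4, ν 5, ν 6, ν 7]
          * Q (ν 0) (ν 4) * Q (ν 1) (ν 5) * Q (ν 2) (ν 6) * Q (ν 3) (ν 7) =
      ∑ κ : Fin 4 → Fin 2, a ((κ 0 : ℕ)) * b ((κ 1 : ℕ) + κ 2 + κ 3) * c ((κ 0 : ℕ) + κ 1 + κ 2 + κ 3) :=
  ((hA.one.mul hB.three).mul hC.four).sum_edges_four hL ![0, 1, 2, 3] ![4, 5, 6, 7]
    ![0, 1, 2, 3, 0, 1, 2, 3] (fun x => by simp [Fin.prod_univ_succ]; ring)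

theorem sum_graph_three_three_two (hL : ∀ i j, Q i j = ∑ k, L i k * L j k)
    {A : PlaneTensor 3} {B : PlaneTensor 3} {C : PlaneTensor 2} {a b c : ℕ → ℝ}
    (hA : HasComponentsIn L A a) (hB : HasComponentsIn L B b) (hC : HasComponentsIn L C c) :
    ∑ ν : Fin 8 → Fin 2,
        A ![ν 0, ν 1, ν 2] * B ![ν 3, ν 4, ν 5] * C ![ν 6, ν 7]
          * Q (ν 0) (ν 3) * Q (ν 1) (ν 4) * Q (ν 2) (ν 6) * Q (ν 5) (ν 7) =
      ∑ κ : Fin 4 → Fin 2, a ((κ 0 : ℕ) + κ 1 + κ 2) * b ((κ 0 : ℕ) + κ 1 + κ 3) * c ((κ 2 : ℕ) + κ 3) :=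
  ((hA.three.mul hB.three).mul hC.two).sum_edges_four hL ![0, 1, 2, 5] ![3, 4, 6, 7]
    ![0, 1, 2, 0, 1, 3, 2, 3] (fun x => by simp [Fin.prod_univ_succ]; ring)

theorem sum_graph_three_three_four (hL : ∀ i j, Q i j = ∑ k, L i k * L j k)
    {A : PlaneTensor 3} {B : PlaneTensor 3} {C : PlaneTensor 4} {a b c : ℕ → ℝ}
    (hA : HasComponentsIn L A a) (hB : HasComponentsIn L B b) (hC : HasComponentsIn L C c) :
    ∑ ν : Fin 10 → Fin 2,
        A ![ν 0, ν 1, ν 2] * B ![ν 3, ν 4, ν 5] * C ![ν 6, ν 7, ν 8, ν 9]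
          * Q (ν 0) (ν 3) * Q (ν 1) (ν 6) * Q (ν 2) (ν 7) * Q (ν 4) (ν 8) * Q (ν 5) (ν 9) =
      ∑ κ : Fin 5 → Fin 2, a ((κ 0 : ℕ) + κ 1 + κ 2) * b ((κ 0 : ℕ) + κ 3 + κ 4) * c ((κ 1 : ℕ) + κ 2 + κ 3 + κ 4) :=
  ((hA.three.mul hB.three).mul hC.four).sum_edges_five hL ![0, 1, 2, 4, 5] ![3, 6, 7, 8, 9]
    ![0, 1, 2, 0, 3, 4, 1, 2, 3, 4] (fun x => by simp [Fin.prod_univ_succ]; ring)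

theorem sum_graph_one_one_one_one (hL : ∀ i j, Q i j = ∑ k, L i k * L j k)
    {A : PlaneTensor 1} {a : ℕ → ℝ}
    (hA : HasComponentsIn L A a) :
    ∑ ν : Fin 4 → Fin 2,
        A ![ν 0] * A ![ν 1] * A ![ν 2] * A ![ν 3]
          * Q (ν 0) (ν 1) * Q (ν 2) (ν 3) =
      ∑ κ : Fin 2 → Fin 2, a ((κ 0 : ℕ)) * a ((κ 0 : ℕ)) * a ((κ 1 : ℕ)) * a ((κ 1 : ℕ)) :=
  (((hA.one.mul hA.one).mul hA.one).mul hA.one).sum_edges_two hL ![0, 2] ![1, 3]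
    ![0, 0, 1, 1] (fun x => by simp [Fin.prod_univ_succ]; ring)

theorem sum_graph_one_one_three_three (hL : ∀ i j, Q i j = ∑ k, L i k * L j k)
    {A : PlaneTensor 1} {B : PlaneTensor 3} {a b : ℕ → ℝ}
    (hA : HasComponentsIn L A a) (hB : HasComponentsIn L B b) :
    ∑ ν : Fin 8 → Fin 2,
        A ![ν 0] * A ![ν 1] * B ![ν 2, ν 3, ν 4] * B ![ν 5, ν 6, ν 7]
          * Q (ν 0) (ν 1) * Q (ν 2) (ν 5) * Q (ν 3) (ν 6) * Q (ν 4) (ν 7) =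
      ∑ κ : Fin 4 → Fin 2, a ((κ 0 : ℕ)) * a ((κ 0 : ℕ)) * b ((κ 1 : ℕ) + κ 2 + κ 3) * b ((κ 1 : ℕ) + κ 2 + κ 3) :=
  (((hA.one.mul hA.one).mul hB.three).mul hB.three).sum_edges_four hL ![0, 2, 3, 4] ![1, 5, 6, 7]
    ![0, 0, 1, 2, 3, 1, 2, 3] (fun x => by simp [Fin.prod_univ_succ]; ring)

theorem sum_graph_one_three_three_one (hL : ∀ i j, Q i j = ∑ k, L i k * L j k)
    {A : PlaneTensor 1} {B : PlaneTensor 3} {a b : ℕ → ℝ}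
    (hA : HasComponentsIn L A a) (hB : HasComponentsIn L B b) :
    ∑ ν : Fin 8 → Fin 2,
        A ![ν 0] * B ![ν 1, ν 2, ν 3] * B ![ν 4, ν 5, ν 6] * A ![ν 7]
          * Q (ν 0) (ν 1) * Q (ν 2) (ν 4) * Q (ν 3) (ν 5) * Q (ν 6) (ν 7) =
      ∑ κ : Fin 4 → Fin 2, a ((κ 0 : ℕ)) * b ((κ 0 : ℕ) + κ 1 + κ 2) * b ((κ 1 : ℕ) + κ 2 + κ 3) * a ((κ 3 : ℕ)) :=
  (((hA.one.mul hB.three).mul hB.three).mul hA.one).sum_edges_four hL ![0, 2, 3, 6] ![1, 4, 5, 7]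
    ![0, 0, 1, 2, 1, 2, 3, 3] (fun x => by simp [Fin.prod_univ_succ]; ring)

theorem sum_graph_one_three_one_one (hL : ∀ i j, Q i j = ∑ k, L i k * L j k)
    {A : PlaneTensor 1} {B : PlaneTensor 3} {a b : ℕ → ℝ}
    (hA : HasComponentsIn L A a) (hB : HasComponentsIn L B b) :
    ∑ ν : Fin 6 → Fin 2,
        A ![ν 0] * B ![ν 1, ν 2, ν 3] * A ![ν 4] * A ![ν 5]
          * Q (ν 0) (ν 1) * Q (ν 2) (ν 4) * Q (ν 3) (ν 5) =
      ∑ κ : Fin 3 → Fin 2, a ((κ 0 : ℕ)) * b ((κ 0 : ℕ) + κ 1 + κ 2) * a ((κ 1 : ℕ)) * a ((κ 2 : ℕ)) :=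
  (((hA.one.mul hB.three).mul hA.one).mul hA.one).sum_edges_three hL ![0, 2, 3] ![1, 4, 5]
    ![0, 0, 1, 2, 1, 2] (fun x => by simp [Fin.prod_univ_succ]; ring)

theorem sum_graph_one_three_three_three (hL : ∀ i j, Q i j = ∑ k, L i k * L j k)
    {A : PlaneTensor 1} {B : PlaneTensor 3} {a b : ℕ → ℝ}
    (hA : HasComponentsIn L A a) (hB : HasComponentsIn L B b) :
    ∑ ν : Fin 10 → Fin 2,
        A ![ν 0] * B ![ν 1, ν 2, ν 3] * B ![ν 4, ν 5, ν 6] * B ![ν 7, ν 8, ν 9]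
          * Q (ν 0) (ν 1) * Q (ν 2) (ν 4) * Q (ν 3) (ν 7) * Q (ν 5) (ν 8) * Q (ν 6) (ν 9) =
      ∑ κ : Fin 5 → Fin 2, a ((κ 0 : ℕ)) * b ((κ 0 : ℕ) + κ 1 + κ 2) * b ((κ 1 : ℕ) + κ 3 + κ 4) * b ((κ 2 : ℕ) + κ 3 + κ 4) :=
  (((hA.one.mul hB.three).mul hB.three).mul hB.three).sum_edges_five hL ![0, 2, 3, 5, 6] ![1, 4, 7, 8, 9]
    ![0, 0, 1, 2, 1, 3, 4, 2, 3, 4] (fun x => by simp [Fin.prod_univ_succ]; ring)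

theorem sum_graph_three_pairs (hL : ∀ i j, Q i j = ∑ k, L i k * L j k)
    {A : PlaneTensor 3} {a : ℕ → ℝ}
    (hA : HasComponentsIn L A a) :
    ∑ ν : Fin 12 → Fin 2,
        A ![ν 0, ν 1, ν 2] * A ![ν 3, ν 4, ν 5] * A ![ν 6, ν 7, ν 8] * A ![ν 9, ν 10, ν 11]
          * Q (ν 0) (ν 3) * Q (ν 1) (ν 4) * Q (ν 2) (ν 5) * Q (ν 6) (ν 9) * Q (ν 7) (ν 10) * Q (ν 8) (ν 11) =
      ∑ κ : Fin 6 → Fin 2, a ((κ 0 : ℕ) + κ 1 + κ 2) * a ((κ 0 : ℕ) + κ 1 + κ 2) * a ((κ 3 : ℕ) + κ 4 + κ 5) * a ((κ 3 : ℕ) + κ 4 + κ 5) :=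
  (((hA.three.mul hA.three).mul hA.three).mul hA.three).sum_edges_six hL ![0, 1, 2, 6, 7, 8] ![3, 4, 5, 9, 10, 11]
    ![0, 1, 2, 0, 1, 2, 3, 4, 5, 3, 4, 5] (fun x => by simp [Fin.prod_univ_succ]; ring)

theorem sum_graph_three_square (hL : ∀ i j, Q i j = ∑ k, L i k * L j k)
    {A : PlaneTensor 3} {a : ℕ → ℝ}
    (hA : HasComponentsIn L A a) :
    ∑ ν : Fin 12 → Fin 2,
        A ![ν 0, ν 1, ν 2] * A ![ν 3, ν 4, ν 5] * A ![ν 6, ν 7, ν 8] * A ![ν 9, ν 10, ν 11]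
          * Q (ν 0) (ν 3) * Q (ν 1) (ν 4) * Q (ν 2) (ν 6) * Q (ν 5) (ν 9) * Q (ν 7) (ν 10) * Q (ν 8) (ν 11) =
      ∑ κ : Fin 6 → Fin 2, a ((κ 0 : ℕ) + κ 1 + κ 2) * a ((κ 0 : ℕ) + κ 1 + κ 3) * a ((κ 2 : ℕ) + κ 4 + κ 5) * a ((κ 3 : ℕ) + κ 4 + κ 5) :=
  (((hA.three.mul hA.three).mul hA.three).mul hA.three).sum_edges_six hL ![0, 1, 2, 5, 7, 8] ![3, 4, 6, 9, 10, 11]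
    ![0, 1, 2, 0, 1, 3, 2, 4, 5, 3, 4, 5] (fun x => by simp [Fin.prod_univ_succ]; ring)

theorem sum_graph_three_tetrahedron (hL : ∀ i j, Q i j = ∑ k, L i k * L j k)
    {A : PlaneTensor 3} {a : ℕ → ℝ}
    (hA : HasComponentsIn L A a) :
    ∑ ν : Fin 12 → Fin 2,
        A ![ν 0, ν 1, ν 2] * A ![ν 3, ν 4, ν 5] * A ![ν 6, ν 7, ν 8] * A ![ν 9, ν 10, ν 11]
          * Q (ν 0) (ν 3) * Q (ν 1) (ν 6) * Q (ν 2) (ν 9) * Q (ν 4) (ν 7) * Q (ν 5) (ν 10) * Q (ν 8) (ν 11) =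
      ∑ κ : Fin 6 → Fin 2, a ((κ 0 : ℕ) + κ 1 + κ 2) * a ((κ 0 : ℕ) + κ 3 + κ 4) * a ((κ 1 : ℕ) + κ 3 + κ 5) * a ((κ 2 : ℕ) + κ 4 + κ 5) :=
  (((hA.three.mul hA.three).mul hA.three).mul hA.three).sum_edges_six hL ![0, 1, 2, 4, 5, 8] ![3, 6, 9, 7, 10, 11]
    ![0, 1, 2, 0, 3, 4, 1, 3, 5, 2, 4, 5] (fun x => by simp [Fin.prod_univ_succ]; ring)

end Graphs

/-! ### Gaussian integrals -/

/-- The moments of the standard normal distribution: `(k - 1)!!` for even `k`, zero for odd `k`. -/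
def gaussMoment : ℕ → ℝ
  | 0 => 1
  | 1 => 0
  | k + 2 => (k + 1) * gaussMoment k

theorem integrable_pow_mul_exp_neg_half_sq (k : ℕ) :
    Integrable fun x : ℝ => x ^ k * Real.exp (-(x ^ 2 / 2)) := by
  have h := integrable_rpow_mul_exp_neg_mul_sq (b := 1 / 2) (by norm_num)
    (s := (k : ℝ)) (by have : (0 : ℝ) ≤ k := Nat.cast_nonneg k; linarith)
  refine h.congr (Eventually.of_forall fun x => ?_)
  dsimp only
  rw [Real.rpow_natCast]
  congr 2
  ring

theorem integral_pow_mul_exp_neg_half_sq :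
    ∀ k : ℕ, ∫ x : ℝ, x ^ k * Real.exp (-(x ^ 2 / 2)) = Real.sqrt (2 * Real.pi) * gaussMoment k
  | 0 => by
    have h := integral_gaussian (1 / 2)
    simp only [pow_zero, one_mul, gaussMoment, mul_one]
    rw [show 2 * Real.pi = Real.pi / (1 / 2) by ring, ← h]
    congr 1
    funext x
    congr 1
    ring
  | 1 => by
    have hderiv : ∀ x : ℝ, HasDerivAt (fun x : ℝ => -Real.exp (-(x ^ 2 / 2)))
        (x ^ 1 * Real.exp (-(x ^ 2 / 2))) x := fun x => by
      have := (((hasDerivAt_pow 2 x).div_const 2).fun_neg.exp).fun_neg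
      refine this.congr_deriv ?_
      simp only [Nat.cast_ofNat]
      ring
    have h0 : Integrable fun x : ℝ => -Real.exp (-(x ^ 2 / 2)) := by
      simpa using (integrable_pow_mul_exp_neg_half_sq 0).neg
    rw [integral_eq_zero_of_hasDerivAt_of_integrable hderiv
      (integrable_pow_mul_exp_neg_half_sq 1) h0]
    simp [gaussMoment]
  | k + 2 => by
    have hderiv : ∀ x : ℝ, HasDerivAt (fun x : ℝ => x ^ (k + 1) * Real.exp (-(x ^ 2 / 2)))
        ((k + 1) * (x ^ k * Real.exp (-(x ^ 2 / 2))) - x ^ (k + 2) * Real.exp (-(x ^ 2 / 2))) x :=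
      fun x => by
        have := (hasDerivAt_pow (k + 1) x).fun_mul (((hasDerivAt_pow 2 x).div_const 2).fun_neg.exp)
        refine this.congr_deriv ?_
        simp only [Nat.cast_ofNat, Nat.cast_add, Nat.cast_one, Nat.add_sub_cancel]
        ring
    have h := integral_eq_zero_of_hasDerivAt_of_integrable hderiv
      (((integrable_pow_mul_exp_neg_half_sq k).const_mul _).sub
        (integrable_pow_mul_exp_neg_half_sq (k + 2))) (integrable_pow_mul_exp_neg_half_sq (k + 1))
    rw [integral_sub ((integrable_pow_mul_exp_neg_half_sq k).const_mul _)
      (integrable_pow_mul_exp_neg_half_sq (k + 2)), integral_const_mul, sub_eq_zero] at h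
    rw [← h, integral_pow_mul_exp_neg_half_sq k, gaussMoment]
    ring

theorem integrable_monomial_mul_gaussian (a b : ℕ) :
    Integrable fun z : Plane => z 0 ^ a * z 1 ^ b * Real.exp (-(‖z‖ ^ 2 / 2)) := by
  have h := Integrable.fintype_prod (ι := Fin 2) (μ := fun _ => volume)
    (f := fun i (x : ℝ) => x ^ (![a, b] i) * Real.exp (-(x ^ 2 / 2)))
    (fun i => integrable_pow_mul_exp_neg_half_sq _)
  rw [← volume_pi, ← (PiLp.volume_preserving_ofLp (Fin 2)).integrable_comp_emb
    (MeasurableEquiv.toLp 2 (Fin 2 → ℝ)).symm.measurableEmbedding] at h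
  refine h.congr (Eventually.of_forall fun z => ?_)
  simp only [Function.comp_apply, Fin.prod_univ_two, Matrix.cons_val_zero, Matrix.cons_val_one,
    EuclideanSpace.norm_sq_eq, Fin.sum_univ_two, Real.norm_eq_abs, sq_abs]
  rw [show -((z 0 ^ 2 + z 1 ^ 2) / 2) = -(z 0 ^ 2 / 2) + -(z 1 ^ 2 / 2) by ring, Real.exp_add]
  ring

theorem integral_monomial_mul_gaussian (a b : ℕ) :
    ∫ z : Plane, z 0 ^ a * z 1 ^ b * Real.exp (-(‖z‖ ^ 2 / 2)) =
      2 * Real.pi * (gaussMoment a * gaussMoment b) := by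
  have h := integral_fintype_prod_volume_eq_prod (ι := Fin 2) (𝕜 := ℝ)
    (fun i (x : ℝ) => x ^ (![a, b] i) * Real.exp (-(x ^ 2 / 2)))
  rw [← (PiLp.volume_preserving_ofLp (Fin 2)).integral_comp
    (MeasurableEquiv.toLp 2 (Fin 2 → ℝ)).symm.measurableEmbedding] at h
  simp only [Fin.prod_univ_two, Matrix.cons_val_zero, Matrix.cons_val_one,
    integral_pow_mul_exp_neg_half_sq] at h
  rw [show 2 * Real.pi = Real.sqrt (2 * Real.pi) * Real.sqrt (2 * Real.pi) from
    (Real.mul_self_sqrt (by positivity)).symm]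
  calc _ = _ := by
        refine (integral_congr_ae (Eventually.of_forall fun z => ?_)).trans h
        simp only [EuclideanSpace.norm_sq_eq, Fin.sum_univ_two, Real.norm_eq_abs, sq_abs]
        rw [show -((z 0 ^ 2 + z 1 ^ 2) / 2) = -(z 0 ^ 2 / 2) + -(z 1 ^ 2 / 2) by ring,
          Real.exp_add]
        ring
    _ = _ := by ring

/-- Gaussian integral of a homogeneous polynomial of degree `n`. -/
theorem integral_homogeneous_mul_gaussian (n : ℕ) (b : ℕ → ℝ) :
    ∫ z : Plane, (∑ j ∈ Finset.range (n + 1), b j * (z 0 ^ (n - j) * z 1 ^ j)) *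
        Real.exp (-(‖z‖ ^ 2 / 2)) =
      2 * Real.pi * ∑ j ∈ Finset.range (n + 1), b j * (gaussMoment (n - j) * gaussMoment j) := by
  simp only [Finset.sum_mul, mul_assoc (b _)]
  rw [integral_finsetSum _ fun j _ => (integrable_monomial_mul_gaussian (n - j) j).const_mul (b j),
    Finset.mul_sum]
  refine Finset.sum_congr rfl fun j _ => ?_
  rw [integral_const_mul, integral_monomial_mul_gaussian]
  ring

theorem integrable_homogeneous_mul_gaussian (n : ℕ) (b : ℕ → ℝ) :
    Integrable fun z : Plane => (∑ j ∈ Finset.range (n + 1), b j * (z 0 ^ (n - j) * z 1 ^ j)) *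
        Real.exp (-(‖z‖ ^ 2 / 2)) := by
  simp only [Finset.sum_mul, mul_assoc (b _)]
  exact integrable_finsetSum _ fun j _ => (integrable_monomial_mul_gaussian (n - j) j).const_mul (b j)

theorem integrable_norm_pow_mul_exp_neg_mul_sq (n : ℕ) {c : ℝ} (hc : 0 < c) :
    Integrable fun y : Plane => ‖y‖ ^ n * Real.exp (-(c * ‖y‖ ^ 2)) := by
  have h0 : Integrable fun y : Plane => Real.exp (-(c / 2 * ‖y‖ ^ 2)) := by
    have := (GaussianFourier.integrable_cexp_neg_mul_sq_norm_add (V := Plane) (b := (c / 2 : ℝ))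
      (by simpa using hc) 0 0).norm
    refine this.congr (Eventually.of_forall fun y => ?_)
    simp only [Complex.norm_exp, zero_mul, add_zero]
    congr 1
    norm_cast
    ring
  refine (h0.const_mul (1 + n.factorial * (2 / c) ^ n)).mono' (by fun_prop)
    (Eventually.of_forall fun y => ?_)
  have hn := norm_nonneg y
  rw [Real.norm_of_nonneg (by positivity)]
  have h1 : (c / 2 * ‖y‖ ^ 2) ^ n / n.factorial ≤ Real.exp (c / 2 * ‖y‖ ^ 2) :=
    Real.pow_div_factorial_le_exp _ (by positivity) n
  have h2 : ‖y‖ ^ n ≤ 1 + (‖y‖ ^ n) ^ 2 := by nlinarith [sq_nonneg (‖y‖ ^ n - 1)]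
  have h3 : (‖y‖ ^ n) ^ 2 ≤ n.factorial * (2 / c) ^ n * Real.exp (c / 2 * ‖y‖ ^ 2) := by
    rw [div_le_iff₀ (by positivity), mul_pow] at h1
    have h4 : (2 / c) ^ n * (c / 2) ^ n = 1 := by
      rw [← mul_pow, show 2 / c * (c / 2) = 1 by field_simp, one_pow]
    calc (‖y‖ ^ n) ^ 2 = (2 / c) ^ n * ((c / 2) ^ n * (‖y‖ ^ 2) ^ n) := by
          rw [← mul_assoc, h4, one_mul, ← pow_mul, ← pow_mul, mul_comm]
      _ ≤ (2 / c) ^ n * (Real.exp (c / 2 * ‖y‖ ^ 2) * n.factorial) := by gcongr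
      _ = _ := by ring
  have h5 : (1 : ℝ) ≤ Real.exp (c / 2 * ‖y‖ ^ 2) := Real.one_le_exp (by positivity)
  have h6 : Real.exp (-(c * ‖y‖ ^ 2)) * Real.exp (c / 2 * ‖y‖ ^ 2) =
      Real.exp (-(c / 2 * ‖y‖ ^ 2)) := by
    rw [← Real.exp_add]; congr 1; ring
  calc ‖y‖ ^ n * Real.exp (-(c * ‖y‖ ^ 2))
      ≤ ((1 + n.factorial * (2 / c) ^ n) * Real.exp (c / 2 * ‖y‖ ^ 2)) *
          Real.exp (-(c * ‖y‖ ^ 2)) := by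
        gcongr
        linarith
    _ = _ := by rw [← h6]; ring

/-- Change of variables `y = L z` in the plane. -/
theorem integral_comp_toEuclideanLin {L : Matrix (Fin 2) (Fin 2) ℝ} (hL : 0 < L.det)
    (f : Plane → ℝ) : ∫ y, f y = L.det * ∫ z, f (Matrix.toEuclideanLin L z) := by
  have hdet : LinearMap.det (Matrix.toEuclideanLin L) = L.det := by
    have h := DFunLike.congr_fun (Matrix.toLpLin_eq_toLin (R := ℝ) (m := Fin 2) (n := Fin 2) 2 2) L
    exact (congrArg LinearMap.det h).trans (LinearMap.det_toLin _ _)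
  have hdet0 : LinearMap.det (Matrix.toEuclideanLin L) ≠ 0 := by rw [hdet]; exact hL.ne'
  let e : Plane ≃L[ℝ] Plane :=
    (LinearEquiv.ofIsUnitDet (f := Matrix.toEuclideanLin L)
      (v := EuclideanSpace.basisFun (Fin 2) ℝ |>.toBasis)
      (v' := EuclideanSpace.basisFun (Fin 2) ℝ |>.toBasis)
      (by rw [LinearMap.det_toMatrix]; exact hdet0.isUnit)).toContinuousLinearEquiv
  have he : ∀ z, e z = Matrix.toEuclideanLin L z := fun z => rfl
  have h := Measure.map_linearMap_addHaar_eq_smul_addHaar (volume : Measure Plane) hdet0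
  have h2 : ∫ y, f y ∂(Measure.map (Matrix.toEuclideanLin L) volume) =
      ∫ z, f (Matrix.toEuclideanLin L z) :=
    e.toHomeomorph.measurableEmbedding.integral_map f
  rw [h, integral_smul_measure, hdet, ENNReal.toReal_ofReal (abs_nonneg _),
    abs_of_pos (inv_pos.2 hL), smul_eq_mul] at h2
  rw [← h2, mul_inv_cancel_left₀ hL.ne']

/-! ### Gaussian integrals of binary forms and Wick's theorem -/

/-- The binary form of degree `n` with coefficients `b`. -/
def binaryForm (n : ℕ) (b : ℕ → ℝ) (z : Plane) : ℝ :=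
  ∑ j ∈ Finset.range (n + 1), b j * (z 0 ^ (n - j) * z 1 ^ j)

/-- Coefficients of the binary form of a symmetric tensor of rank `m` with components `c`. -/
def binomialCoeffs (m : ℕ) (c : ℕ → ℝ) : ℕ → ℝ := fun j => m.choose j * c j

/-- Coefficients of the square of the binary cubic form with coefficients `binomialCoeffs 3 c`. -/
def squareCoeffs (c : ℕ → ℝ) : ℕ → ℝ
  | 0 => c 0 ^ 2
  | 1 => 6 * c 0 * c 1
  | 2 => 6 * c 0 * c 2 + 9 * c 1 ^ 2
  | 3 => 2 * c 0 * c 3 + 18 * c 1 * c 2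
  | 4 => 6 * c 1 * c 3 + 9 * c 2 ^ 2
  | 5 => 6 * c 2 * c 3
  | 6 => c 3 ^ 2
  | _ => 0

/-- Standard Gaussian expectation of a binary form of degree `n` with coefficients `b`. -/
def gaussForm (n : ℕ) (b : ℕ → ℝ) : ℝ :=
  ∑ j ∈ Finset.range (n + 1), b j * (gaussMoment (n - j) * gaussMoment j)

/-- Standard Gaussian expectation of the product of two binary forms. -/
def gaussPairing (m n : ℕ) (b b' : ℕ → ℝ) : ℝ :=
  ∑ i ∈ Finset.range (m + 1), ∑ j ∈ Finset.range (n + 1),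
    b i * b' j * (gaussMoment (m - i + (n - j)) * gaussMoment (i + j))

theorem binaryForm_mul_self_three (c : ℕ → ℝ) (z : Plane) :
    binaryForm 3 (binomialCoeffs 3 c) z ^ 2 = binaryForm 6 (squareCoeffs c) z := by
  simp [binaryForm, binomialCoeffs, squareCoeffs, Finset.sum_range_succ, Nat.choose]
  ring

theorem integrable_binaryForm (n : ℕ) (b : ℕ → ℝ) :
    Integrable fun z : Plane => binaryForm n b z * Real.exp (-(‖z‖ ^ 2 / 2)) :=
  integrable_homogeneous_mul_gaussian n b

theorem integral_binaryForm (n : ℕ) (b : ℕ → ℝ) :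
    ∫ z : Plane, binaryForm n b z * Real.exp (-(‖z‖ ^ 2 / 2)) = 2 * Real.pi * gaussForm n b :=
  integral_homogeneous_mul_gaussian n b

theorem binaryForm_mul_mul (m n : ℕ) (b b' : ℕ → ℝ) (z : Plane) (r : ℝ) :
    binaryForm m b z * binaryForm n b' z * r = ∑ i ∈ Finset.range (m + 1),
      ∑ j ∈ Finset.range (n + 1), b i * b' j * (z 0 ^ (m - i + (n - j)) * z 1 ^ (i + j) * r) := by
  rw [binaryForm, binaryForm, Finset.sum_mul_sum, Finset.sum_mul]
  refine Finset.sum_congr rfl fun i _ => ?_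
  rw [Finset.sum_mul]
  refine Finset.sum_congr rfl fun j _ => ?_
  rw [pow_add, pow_add]
  ring

theorem integrable_binaryForm_mul (m n : ℕ) (b b' : ℕ → ℝ) :
    Integrable fun z : Plane =>
      binaryForm m b z * binaryForm n b' z * Real.exp (-(‖z‖ ^ 2 / 2)) := by
  simp only [binaryForm_mul_mul]
  exact integrable_finsetSum _ fun i _ => integrable_finsetSum _ fun j _ =>
    (integrable_monomial_mul_gaussian _ _).const_mul _

theorem integral_binaryForm_mul (m n : ℕ) (b b' : ℕ → ℝ) :
    ∫ z : Plane, binaryForm m b z * binaryForm n b' z * Real.exp (-(‖z‖ ^ 2 / 2)) =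
      2 * Real.pi * gaussPairing m n b b' := by
  simp only [binaryForm_mul_mul]
  have hint := fun i j : ℕ => (integrable_monomial_mul_gaussian (m - i + (n - j)) (i + j)).const_mul
    (b i * b' j)
  rw [integral_finsetSum _ fun i _ => integrable_finsetSum _ fun j _ => hint i j, gaussPairing,
    Finset.mul_sum]
  refine Finset.sum_congr rfl fun i _ => ?_
  rw [integral_finsetSum _ fun j _ => hint i j, Finset.mul_sum]
  refine Finset.sum_congr rfl fun j _ => ?_
  rw [integral_const_mul, integral_monomial_mul_gaussian]
  ring

section Wick

variable {L Q : Matrix (Fin 2) (Fin 2) ℝ}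

theorem HasComponentsIn.tensorPoly_eq {m : ℕ} {T : PlaneTensor m} {c : ℕ → ℝ}
    (h : HasComponentsIn L T c) (z : Plane) :
    tensorPoly T (Matrix.toEuclideanLin L z) =
      ∑ κ : Fin m → Fin 2, c (∑ i, (κ i : ℕ)) * ∏ i, z (κ i) := by
  rw [tensorPoly_toEuclideanLin]
  simp only [tensorPoly, h _]

/-- The multinomial expansion: `m.choose i` of the multi-indices have `i` entries equal to `1`. -/
theorem sum_components_eq_antidiagonal (z : Plane) (m : ℕ) (c : ℕ → ℝ) :
    ∑ κ : Fin m → Fin 2, c (∑ i, (κ i : ℕ)) * ∏ i, z (κ i) =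
      ∑ ij ∈ Finset.HasAntidiagonal.antidiagonal m, (m.choose ij.1 : ℝ) * (c ij.1 * (z 0 ^ ij.2 * z 1 ^ ij.1)) := by
  induction m generalizing c with
  | zero => simp
  | succ m ih =>
    rw [sum_fin_succ_fun, Fin.sum_univ_two,
      Finset.sum_antidiagonal_choose_succ_mul fun i j => c i * (z 0 ^ j * z 1 ^ i)]
    simp only [Fin.sum_univ_succ, Fin.prod_univ_succ, Matrix.cons_val_zero, Matrix.cons_val_succ,
      Fin.val_zero, Fin.val_one, zero_add]
    have e0 := congrArg (z 0 * ·) (ih c)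
    have e1 := congrArg (z 1 * ·) (ih fun k => c (1 + k))
    simp only [Finset.mul_sum] at e0 e1
    refine congrArg₂ (· + ·) ?_ ?_
    · refine Eq.trans (Finset.sum_congr rfl fun κ _ => ?_) (e0.trans
        (Finset.sum_congr rfl fun ij _ => ?_))
      · ring
      · ring
    · refine Eq.trans (Finset.sum_congr rfl fun κ _ => ?_) (e1.trans
        (Finset.sum_congr rfl fun ij hij => ?_))
      · ring
      · rw [← Finset.HasAntidiagonal.mem_antidiagonal.1 hij, Nat.choose_symm_add, add_comm 1]
        ring

theorem HasComponentsIn.tensorPoly_eq_binaryForm {m : ℕ} {T : PlaneTensor m} {c : ℕ → ℝ}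
    (h : HasComponentsIn L T c) (z : Plane) :
    tensorPoly T (Matrix.toEuclideanLin L z) = binaryForm m (binomialCoeffs m c) z := by
  rw [h.tensorPoly_eq, sum_components_eq_antidiagonal,
    Finset.Nat.sum_antidiagonal_eq_sum_range_succ
      fun i j => (m.choose i : ℝ) * (c i * (z 0 ^ j * z 1 ^ i))]
  exact Finset.sum_congr rfl fun j _ => by rw [binomialCoeffs]; ring

/-! In the lemmas below `B` and `E` stand for the third and fourth derivatives, and contractions with
`Q` over loops at a vertex are tensors of their own: `A` is the contraction of `B`, `D` and `q` are
the single and double contractions of `E`, and `G` and `F` those of the fifth derivative. In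
coordinates, the contraction of a tensor with components `b k` has the components
`b k + b (k + 2)`. The number on the right is the power of `2` from `ε² = 2t`, times the coefficient
of the corresponding product in the expansion of the exponential. Both sides are polynomials in the
components. -/

/-- The vacuum graphs with two vertices of valence `3`. -/
theorem wick_three_three (hL : ∀ i j, Q i j = ∑ k, L i k * L j k)
    {A : PlaneTensor 1} {B : PlaneTensor 3} {b : ℕ → ℝ}
    (hA : HasComponentsIn L A fun k => b k + b (k + 2))
    (hB : HasComponentsIn L B b) :
    (1 / 4) * (∑ ν : Fin 2 → Fin 2, A ![ν 0] * A ![ν 1] * Q (ν 0) (ν 1))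
      + (1 / 6) * (∑ ν : Fin 6 → Fin 2,
          B ![ν 0, ν 1, ν 2] * B ![ν 3, ν 4, ν 5]
            * Q (ν 0) (ν 3) * Q (ν 1) (ν 4) * Q (ν 2) (ν 5)) =
    2 / 72 * gaussForm 6 (squareCoeffs b) := by
  rw [sum_graph_one_one hL hA hA, sum_graph_three_three hL hB hB]
  simp only [sum_fin_succ_fun, sum_fin_zero_fun, Fin.sum_univ_two]
  simp [gaussForm, squareCoeffs, gaussMoment, Finset.sum_range_succ]
  ring

/-- The vacuum graphs with the vertices of valence `3` and `5`. -/
theorem wick_three_five (hL : ∀ i j, Q i j = ∑ k, L i k * L j k)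
    {A : PlaneTensor 1} {B : PlaneTensor 3} {F : PlaneTensor 1} {G : PlaneTensor 3} {b f : ℕ → ℝ}
    (hA : HasComponentsIn L A fun k => b k + b (k + 2))
    (hB : HasComponentsIn L B b)
    (hF : HasComponentsIn L F fun k => f k + f (k + 2) + (f (k + 2) + f (k + 2 + 2)))
    (hG : HasComponentsIn L G fun k => f k + f (k + 2)) :
    (1 / 4) * (∑ ν : Fin 2 → Fin 2, A ![ν 0] * F ![ν 1] * Q (ν 0) (ν 1))
      + (1 / 3) * (∑ ν : Fin 6 → Fin 2,
          B ![ν 0, ν 1, ν 2] * G ![ν 3, ν 4, ν 5]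
          * Q (ν 0) (ν 3) * Q (ν 1) (ν 4) * Q (ν 2) (ν 5)) =
    4 / 720 * gaussPairing 3 5 (binomialCoeffs 3 b) (binomialCoeffs 5 f) := by
  rw [sum_graph_one_one hL hA hF,
    sum_graph_three_three hL hB hG]
  simp only [sum_fin_succ_fun, sum_fin_zero_fun, Fin.sum_univ_two]
  simp [gaussPairing, binomialCoeffs, gaussMoment, Finset.sum_range_succ, Nat.choose]
  ring

/-- The vacuum graphs with two vertices of valence `4`. -/
theorem wick_four_four (hL : ∀ i j, Q i j = ∑ k, L i k * L j k)
    {D : PlaneTensor 2} {E : PlaneTensor 4} {q : ℝ} {e : ℕ → ℝ}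
    (hD : HasComponentsIn L D fun k => e k + e (k + 2))
    (hE : HasComponentsIn L E e)
    (hq : q = e 0 + 2 * e 2 + e 4) :
    (1 / 32) * (q * q)
      + (1 / 4) * (∑ ν : Fin 4 → Fin 2,
          D ![ν 0, ν 1] * D ![ν 2, ν 3]
          * Q (ν 0) (ν 2) * Q (ν 1) (ν 3))
      + (1 / 12) * (∑ ν : Fin 8 → Fin 2,
          E ![ν 0, ν 1, ν 2, ν 3] * E ![ν 4, ν 5, ν 6, ν 7]
          * Q (ν 0) (ν 4) * Q (ν 1) (ν 5) * Q (ν 2) (ν 6) * Q (ν 3) (ν 7)) =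
    4 / 1152 * gaussPairing 4 4 (binomialCoeffs 4 e) (binomialCoeffs 4 e) := by
  rw [sum_graph_two_two hL hD hD,
    sum_graph_four_four hL hE hE,
    hq]
  simp only [sum_fin_succ_fun, sum_fin_zero_fun, Fin.sum_univ_two]
  simp [gaussPairing, binomialCoeffs, gaussMoment, Finset.sum_range_succ, Nat.choose]
  ring

/-- The vacuum graphs with two vertices of valence `3` and one of valence `4`. -/
theorem wick_three_three_four (hL : ∀ i j, Q i j = ∑ k, L i k * L j k)
    {A : PlaneTensor 1} {B : PlaneTensor 3} {D : PlaneTensor 2} {E : PlaneTensor 4} {q : ℝ} {b e : ℕ → ℝ}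
    (hA : HasComponentsIn L A fun k => b k + b (k + 2))
    (hB : HasComponentsIn L B b)
    (hD : HasComponentsIn L D fun k => e k + e (k + 2))
    (hE : HasComponentsIn L E e)
    (hq : q = e 0 + 2 * e 2 + e 4) :
    -(1 / 16) * (∑ ν : Fin 2 → Fin 2,
          A ![ν 0] * A ![ν 1] * q
          * Q (ν 0) (ν 1))
      - (1 / 2) * (∑ ν : Fin 6 → Fin 2,
          A ![ν 0] * B ![ν 1, ν 2, ν 3] * D ![ν 4, ν 5]
          * Q (ν 0) (ν 1) * Q (ν 2) (ν 4) * Q (ν 3) (ν 5))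
      - (1 / 4) * (∑ ν : Fin 4 → Fin 2,
          A ![ν 0] * A ![ν 1] * D ![ν 2, ν 3]
          * Q (ν 0) (ν 2) * Q (ν 1) (ν 3))
      - (1 / 3) * (∑ ν : Fin 8 → Fin 2,
          A ![ν 0] * B ![ν 1, ν 2, ν 3] * E ![ν 4, ν 5, ν 6, ν 7]
          * Q (ν 0) (ν 4) * Q (ν 1) (ν 5) * Q (ν 2) (ν 6) * Q (ν 3) (ν 7))
      - (1 / 24) * (∑ ν : Fin 6 → Fin 2,
          B ![ν 0, ν 1, ν 2] * B ![ν 3, ν 4, ν 5] * q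
          * Q (ν 0) (ν 3) * Q (ν 1) (ν 4) * Q (ν 2) (ν 5))
      - (1 / 2) * (∑ ν : Fin 8 → Fin 2,
          B ![ν 0, ν 1, ν 2] * B ![ν 3, ν 4, ν 5] * D ![ν 6, ν 7]
          * Q (ν 0) (ν 3) * Q (ν 1) (ν 4) * Q (ν 2) (ν 6) * Q (ν 5) (ν 7))
      - (1 / 2) * (∑ ν : Fin 10 → Fin 2,
          B ![ν 0, ν 1, ν 2] * B ![ν 3, ν 4, ν 5] * E ![ν 6, ν 7, ν 8, ν 9]
          * Q (ν 0) (ν 3) * Q (ν 1) (ν 6) * Q (ν 2) (ν 7) * Q (ν 4) (ν 8) * Q (ν 5) (ν 9)) =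
    -(4 / 1728) * gaussPairing 6 4 (squareCoeffs b) (binomialCoeffs 4 e) := by
  rw [sum_graph_one_one_mul hL q hA hA,
    sum_graph_one_three_two hL hA hB hD,
    sum_graph_one_one_two hL hA hA hD,
    sum_graph_one_three_four hL hA hB hE,
    sum_graph_three_three_mul hL q hB hB,
    sum_graph_three_three_two hL hB hB hD,
    sum_graph_three_three_four hL hB hB hE,
    hq]
  simp only [sum_fin_succ_fun, sum_fin_zero_fun, Fin.sum_univ_two]
  simp [gaussPairing, binomialCoeffs, squareCoeffs, gaussMoment, Finset.sum_range_succ, Nat.choose]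
  ring

/-- The vacuum graphs with four vertices of valence `3`. -/
theorem wick_three_three_three_three (hL : ∀ i j, Q i j = ∑ k, L i k * L j k)
    {A : PlaneTensor 1} {B : PlaneTensor 3} {b : ℕ → ℝ}
    (hA : HasComponentsIn L A fun k => b k + b (k + 2))
    (hB : HasComponentsIn L B b) :
    (1 / 32) * (∑ ν : Fin 4 → Fin 2,
          A ![ν 0] * A ![ν 1] * A ![ν 2] * A ![ν 3]
          * Q (ν 0) (ν 1) * Q (ν 2) (ν 3))
      + (1 / 24) * (∑ ν : Fin 8 → Fin 2,
          A ![ν 0] * A ![ν 1] * B ![ν 2, ν 3, ν 4] * B ![ν 5, ν 6, ν 7]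
          * Q (ν 0) (ν 1) * Q (ν 2) (ν 5) * Q (ν 3) (ν 6) * Q (ν 4) (ν 7))
      + (1 / 4) * (∑ ν : Fin 8 → Fin 2,
          A ![ν 0] * B ![ν 1, ν 2, ν 3] * B ![ν 4, ν 5, ν 6] * A ![ν 7]
          * Q (ν 0) (ν 1) * Q (ν 2) (ν 4) * Q (ν 3) (ν 5) * Q (ν 6) (ν 7))
      + (1 / 12) * (∑ ν : Fin 6 → Fin 2,
          A ![ν 0] * B ![ν 1, ν 2, ν 3] * A ![ν 4] * A ![ν 5]
          * Q (ν 0) (ν 1) * Q (ν 2) (ν 4) * Q (ν 3) (ν 5))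
      + (1 / 2) * (∑ ν : Fin 10 → Fin 2,
          A ![ν 0] * B ![ν 1, ν 2, ν 3] * B ![ν 4, ν 5, ν 6] * B ![ν 7, ν 8, ν 9]
          * Q (ν 0) (ν 1) * Q (ν 2) (ν 4) * Q (ν 3) (ν 7) * Q (ν 5) (ν 8) * Q (ν 6) (ν 9))
      + (1 / 72) * (∑ ν : Fin 12 → Fin 2,
          B ![ν 0, ν 1, ν 2] * B ![ν 3, ν 4, ν 5] * B ![ν 6, ν 7, ν 8] * B ![ν 9, ν 10, ν 11]
          * Q (ν 0) (ν 3) * Q (ν 1) (ν 4) * Q (ν 2) (ν 5) * Q (ν 6) (ν 9) * Q (ν 7) (ν 10)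
            * Q (ν 8) (ν 11))
      + (1 / 4) * (∑ ν : Fin 12 → Fin 2,
          B ![ν 0, ν 1, ν 2] * B ![ν 3, ν 4, ν 5] * B ![ν 6, ν 7, ν 8] * B ![ν 9, ν 10, ν 11]
          * Q (ν 0) (ν 3) * Q (ν 1) (ν 4) * Q (ν 2) (ν 6) * Q (ν 5) (ν 9) * Q (ν 7) (ν 10)
            * Q (ν 8) (ν 11))
      + (1 / 6) * (∑ ν : Fin 12 → Fin 2,
          B ![ν 0, ν 1, ν 2] * B ![ν 3, ν 4, ν 5] * B ![ν 6, ν 7, ν 8] * B ![ν 9, ν 10, ν 11]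
          * Q (ν 0) (ν 3) * Q (ν 1) (ν 6) * Q (ν 2) (ν 9) * Q (ν 4) (ν 7) * Q (ν 5) (ν 10)
            * Q (ν 8) (ν 11)) =
    4 / 31104 * gaussPairing 6 6 (squareCoeffs b) (squareCoeffs b) := by
  rw [sum_graph_one_one_one_one hL hA,
    sum_graph_one_one_three_three hL hA hB,
    sum_graph_one_three_three_one hL hA hB,
    sum_graph_one_three_one_one hL hA hB,
    sum_graph_one_three_three_three hL hA hB,
    sum_graph_three_pairs hL hB,
    sum_graph_three_square hL hB,
    sum_graph_three_tetrahedron hL hB]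
  simp only [sum_fin_succ_fun, sum_fin_zero_fun, Fin.sum_univ_two]
  simp [gaussPairing, squareCoeffs, gaussMoment, Finset.sum_range_succ]
  ring

end Wick

/-! ### Gaussian integrals of the terms of second and fourth order -/

section GaussianCoefficients

variable {Q L : Matrix (Fin 2) (Fin 2) ℝ} {T : (m : ℕ) → PlaneTensor m}
  {C : (k m : ℕ) → PlaneTensor m}

/-- If `Q = L Lᵀ` is the inverse of the Hessian, then the Hessian is the identity in the coordinates
`z` with `y = L z`. -/
theorem tensorPoly_two_eq_norm_sq (hQ : Q * Matrix.of (fun α β => T 2 ![α, β]) = 1)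
    (hL : ∀ i j, Q i j = ∑ k, L i k * L j k) (z : Plane) :
    tensorPoly (T 2) (Matrix.toEuclideanLin L z) = ‖z‖ ^ 2 := by
  have hQL : Q = L * L.transpose := by
    ext i j
    rw [hL, Matrix.mul_apply]
    rfl
  rw [hQL, mul_assoc, mul_eq_one_comm] at hQ
  have hp : ∀ k l, tensorPull L (T 2) ![k, l] = (1 : Matrix (Fin 2) (Fin 2) ℝ) k l := by
    intro k l
    rw [← hQ]
    simp only [tensorPull, sum_fin_succ_fun, sum_fin_zero_fun, Fin.sum_univ_two,
      Fin.prod_univ_two, Matrix.mul_apply, Matrix.transpose_apply, Matrix.of_apply,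
      Matrix.cons_val_zero, Matrix.cons_val_one]
    ring
  rw [tensorPoly_toEuclideanLin, tensorPoly, EuclideanSpace.norm_sq_eq]
  simp only [sum_fin_succ_fun, sum_fin_zero_fun, hp, Fin.sum_univ_two, Fin.prod_univ_two,
    Matrix.one_apply, Real.norm_eq_abs, sq_abs, Matrix.cons_val_zero, Matrix.cons_val_one]
  norm_num
  ring

/-- Gaussian integrals in the coordinates in which the quadratic form is `|z|²`. -/
theorem integral_mul_exp_neg_half_quadratic (hdet : 0 < L.det)
    (hT : ∀ z, tensorPoly (T 2) (Matrix.toEuclideanLin L z) = ‖z‖ ^ 2) (f : Plane → ℝ) :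
    ∫ y, f y * Real.exp (-(tensorPoly (T 2) y / 2)) =
      L.det * ∫ z, f (Matrix.toEuclideanLin L z) * Real.exp (-(‖z‖ ^ 2 / 2)) := by
  rw [integral_comp_toEuclideanLin hdet]
  simp only [hT]

/-- The coefficient of `ε ^ 2` in `exp (-∑ ε ^ (m - 2) Tₘ(y) / m!)`, the sum being over `m ≥ 3`. -/
noncomputable def secondOrderTerm (T : (m : ℕ) → PlaneTensor m) (y : Plane) : ℝ :=
  -(1 / 24) * tensorPoly (T 4) y + 1 / 72 * tensorPoly (T 3) y ^ 2

/-- The coefficient of `ε ^ 4` in `exp (-∑ ε ^ (m - 2) Tₘ(y) / m!)`, the sum being over `m ≥ 3`. -/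
noncomputable def fourthOrderTerm (T : (m : ℕ) → PlaneTensor m) (y : Plane) : ℝ :=
  -(1 / 720) * tensorPoly (T 6) y + 1 / 720 * (tensorPoly (T 3) y * tensorPoly (T 5) y)
    + 1 / 1152 * (tensorPoly (T 4) y * tensorPoly (T 4) y)
    + -(1 / 1728) * (tensorPoly (T 3) y ^ 2 * tensorPoly (T 4) y)
    + 1 / 31104 * (tensorPoly (T 3) y ^ 2 * tensorPoly (T 3) y ^ 2)

theorem integral_exp_neg_half_quadratic (hQ : Q * Matrix.of (fun α β => T 2 ![α, β]) = 1)
    (hpos : Q.PosDef) :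
    ∫ y, Real.exp (-(tensorPoly (T 2) y / 2)) = 2 * Real.pi * Real.sqrt Q.det := by
  obtain ⟨L, hL, hdet⟩ := exists_cholesky hpos
  have hdet0 : 0 < L.det := hdet ▸ Real.sqrt_pos.2 hpos.det_pos
  have h := integral_mul_exp_neg_half_quadratic hdet0 (tensorPoly_two_eq_norm_sq hQ hL)
    fun _ => 1
  have h0 := integral_monomial_mul_gaussian 0 0
  simp only [pow_zero, one_mul, gaussMoment, mul_one] at h h0
  rw [h, h0, hdet]
  ring

theorem exists_hasComponentsIn {m : ℕ} {T : PlaneTensor m} (hT : IsSymmTensor T) (L) :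
    ∃ c, HasComponentsIn L T c :=
  (hT.tensorPull L).exists_components

theorem integral_secondOrderTerm (hQ : Q * Matrix.of (fun α β => T 2 ![α, β]) = 1)
    (hpos : Q.PosDef) (hT : ∀ m, IsSymmTensor (T m)) (hC₀ : ∀ m, C 0 m = T m)
    (hC₁ : ∀ k m, C (k + 1) m = contractPair Q (C k (m + 2))) :
    2 * ∫ y, secondOrderTerm T y * Real.exp (-(tensorPoly (T 2) y / 2)) =
      2 * Real.pi * (Real.sqrt Q.det * (
          -(1 / 4) * C 2 0 ![]
          + (1 / 4) * (∑ ν : Fin 2 → Fin 2, C 1 1 ![ν 0] * C 1 1 ![ν 1] * Q (ν 0) (ν 1))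
          + (1 / 6) * (∑ ν : Fin 6 → Fin 2,
              T 3 ![ν 0, ν 1, ν 2] * T 3 ![ν 3, ν 4, ν 5]
              * Q (ν 0) (ν 3) * Q (ν 1) (ν 4) * Q (ν 2) (ν 5)))) := by
  obtain ⟨L, hL, hdet⟩ := exists_cholesky hpos
  have hdet0 : 0 < L.det := hdet ▸ Real.sqrt_pos.2 hpos.det_pos
  rw [integral_mul_exp_neg_half_quadratic hdet0 (tensorPoly_two_eq_norm_sq hQ hL)]
  obtain ⟨b, hb⟩ := exists_hasComponentsIn (hT 3) L
  obtain ⟨e, he⟩ := exists_hasComponentsIn (hT 4) L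
  have hC11 : C 1 1 = contractPair Q (T 3) := by rw [hC₁, hC₀]
  have hC20 : C 2 0 = contractPair Q (contractPair Q (T 4)) := by rw [hC₁, hC₁, hC₀]
  have hA := hC11 ▸ hb.contractPair hL
  have hq := (hC20 ▸ (he.contractPair hL).contractPair hL).zero
  have hint : ∫ z, secondOrderTerm T (Matrix.toEuclideanLin L z) * Real.exp (-(‖z‖ ^ 2 / 2)) =
      2 * Real.pi * (-(1 / 24) * gaussForm 4 (binomialCoeffs 4 e)
        + 1 / 72 * gaussForm 6 (squareCoeffs b)) := by
    simp only [secondOrderTerm, hb.tensorPoly_eq_binaryForm, he.tensorPoly_eq_binaryForm,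
      binaryForm_mul_self_three, add_mul, mul_assoc]
    rw [integral_add ((integrable_binaryForm _ _).const_mul _)
      ((integrable_binaryForm _ _).const_mul _)]
    simp only [integral_const_mul, integral_binaryForm]
    ring
  have hE : gaussForm 4 (binomialCoeffs 4 e) = 3 * C 2 0 ![] := by
    rw [hq]
    simp [gaussForm, binomialCoeffs, gaussMoment, Finset.sum_range_succ, Nat.choose]
    ring
  have hw := wick_three_three hL hA hb
  rw [hint, hdet]
  linear_combination (4 * Real.pi * Real.sqrt Q.det) * (-(1 / 24) * hE) -
    (2 * Real.pi * Real.sqrt Q.det) * hw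

theorem integral_fourthOrderTerm (hQ : Q * Matrix.of (fun α β => T 2 ![α, β]) = 1)
    (hpos : Q.PosDef) (hT : ∀ m, IsSymmTensor (T m)) (hC₀ : ∀ m, C 0 m = T m)
    (hC₁ : ∀ k m, C (k + 1) m = contractPair Q (C k (m + 2))) :
    4 * ∫ y, fourthOrderTerm T y * Real.exp (-(tensorPoly (T 2) y / 2)) =
      2 * Real.pi * (Real.sqrt Q.det * (
          -(1 / 12) * C 3 0 ![]
          + (1 / 4) * (∑ ν : Fin 2 → Fin 2, C 1 1 ![ν 0] * C 2 1 ![ν 1] * Q (ν 0) (ν 1))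
          + (1 / 3) * (∑ ν : Fin 6 → Fin 2,
              T 3 ![ν 0, ν 1, ν 2] * C 1 3 ![ν 3, ν 4, ν 5]
              * Q (ν 0) (ν 3) * Q (ν 1) (ν 4) * Q (ν 2) (ν 5))
          + (1 / 32) * (C 2 0 ![] * C 2 0 ![])
          + (1 / 4) * (∑ ν : Fin 4 → Fin 2,
              C 1 2 ![ν 0, ν 1] * C 1 2 ![ν 2, ν 3]
              * Q (ν 0) (ν 2) * Q (ν 1) (ν 3))
          + (1 / 12) * (∑ ν : Fin 8 → Fin 2,
              T 4 ![ν 0, ν 1, ν 2, ν 3] * T 4 ![ν 4, ν 5, ν 6, ν 7]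
              * Q (ν 0) (ν 4) * Q (ν 1) (ν 5) * Q (ν 2) (ν 6) * Q (ν 3) (ν 7))
          - (1 / 16) * (∑ ν : Fin 2 → Fin 2,
              C 1 1 ![ν 0] * C 1 1 ![ν 1] * C 2 0 ![]
              * Q (ν 0) (ν 1))
          - (1 / 2) * (∑ ν : Fin 6 → Fin 2,
              C 1 1 ![ν 0] * T 3 ![ν 1, ν 2, ν 3] * C 1 2 ![ν 4, ν 5]
              * Q (ν 0) (ν 1) * Q (ν 2) (ν 4) * Q (ν 3) (ν 5))
          - (1 / 4) * (∑ ν : Fin 4 → Fin 2,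
              C 1 1 ![ν 0] * C 1 1 ![ν 1] * C 1 2 ![ν 2, ν 3]
              * Q (ν 0) (ν 2) * Q (ν 1) (ν 3))
          - (1 / 3) * (∑ ν : Fin 8 → Fin 2,
              C 1 1 ![ν 0] * T 3 ![ν 1, ν 2, ν 3] * T 4 ![ν 4, ν 5, ν 6, ν 7]
              * Q (ν 0) (ν 4) * Q (ν 1) (ν 5) * Q (ν 2) (ν 6) * Q (ν 3) (ν 7))
          - (1 / 24) * (∑ ν : Fin 6 → Fin 2,
              T 3 ![ν 0, ν 1, ν 2] * T 3 ![ν 3, ν 4, ν 5] * C 2 0 ![]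
              * Q (ν 0) (ν 3) * Q (ν 1) (ν 4) * Q (ν 2) (ν 5))
          - (1 / 2) * (∑ ν : Fin 8 → Fin 2,
              T 3 ![ν 0, ν 1, ν 2] * T 3 ![ν 3, ν 4, ν 5] * C 1 2 ![ν 6, ν 7]
              * Q (ν 0) (ν 3) * Q (ν 1) (ν 4) * Q (ν 2) (ν 6) * Q (ν 5) (ν 7))
          - (1 / 2) * (∑ ν : Fin 10 → Fin 2,
              T 3 ![ν 0, ν 1, ν 2] * T 3 ![ν 3, ν 4, ν 5] * T 4 ![ν 6, ν 7, ν 8, ν 9]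
              * Q (ν 0) (ν 3) * Q (ν 1) (ν 6) * Q (ν 2) (ν 7) * Q (ν 4) (ν 8) * Q (ν 5) (ν 9))
          + (1 / 32) * (∑ ν : Fin 4 → Fin 2,
              C 1 1 ![ν 0] * C 1 1 ![ν 1] * C 1 1 ![ν 2] * C 1 1 ![ν 3]
              * Q (ν 0) (ν 1) * Q (ν 2) (ν 3))
          + (1 / 24) * (∑ ν : Fin 8 → Fin 2,
              C 1 1 ![ν 0] * C 1 1 ![ν 1] * T 3 ![ν 2, ν 3, ν 4] * T 3 ![ν 5, ν 6, ν 7]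
              * Q (ν 0) (ν 1) * Q (ν 2) (ν 5) * Q (ν 3) (ν 6) * Q (ν 4) (ν 7))
          + (1 / 4) * (∑ ν : Fin 8 → Fin 2,
              C 1 1 ![ν 0] * T 3 ![ν 1, ν 2, ν 3] * T 3 ![ν 4, ν 5, ν 6] * C 1 1 ![ν 7]
              * Q (ν 0) (ν 1) * Q (ν 2) (ν 4) * Q (ν 3) (ν 5) * Q (ν 6) (ν 7))
          + (1 / 12) * (∑ ν : Fin 6 → Fin 2,
              C 1 1 ![ν 0] * T 3 ![ν 1, ν 2, ν 3] * C 1 1 ![ν 4] * C 1 1 ![ν 5]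
              * Q (ν 0) (ν 1) * Q (ν 2) (ν 4) * Q (ν 3) (ν 5))
          + (1 / 2) * (∑ ν : Fin 10 → Fin 2,
              C 1 1 ![ν 0] * T 3 ![ν 1, ν 2, ν 3] * T 3 ![ν 4, ν 5, ν 6] * T 3 ![ν 7, ν 8, ν 9]
              * Q (ν 0) (ν 1) * Q (ν 2) (ν 4) * Q (ν 3) (ν 7) * Q (ν 5) (ν 8) * Q (ν 6) (ν 9))
          + (1 / 72) * (∑ ν : Fin 12 → Fin 2,
              T 3 ![ν 0, ν 1, ν 2] * T 3 ![ν 3, ν 4, ν 5] * T 3 ![ν 6, ν 7, ν 8] * T 3 ![ν 9, ν 10, ν 11]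
              * Q (ν 0) (ν 3) * Q (ν 1) (ν 4) * Q (ν 2) (ν 5) * Q (ν 6) (ν 9) * Q (ν 7) (ν 10) * Q (ν 8) (ν 11))
          + (1 / 4) * (∑ ν : Fin 12 → Fin 2,
              T 3 ![ν 0, ν 1, ν 2] * T 3 ![ν 3, ν 4, ν 5] * T 3 ![ν 6, ν 7, ν 8] * T 3 ![ν 9, ν 10, ν 11]
              * Q (ν 0) (ν 3) * Q (ν 1) (ν 4) * Q (ν 2) (ν 6) * Q (ν 5) (ν 9) * Q (ν 7) (ν 10) * Q (ν 8) (ν 11))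
          + (1 / 6) * (∑ ν : Fin 12 → Fin 2,
              T 3 ![ν 0, ν 1, ν 2] * T 3 ![ν 3, ν 4, ν 5] * T 3 ![ν 6, ν 7, ν 8] * T 3 ![ν 9, ν 10, ν 11]
              * Q (ν 0) (ν 3) * Q (ν 1) (ν 6) * Q (ν 2) (ν 9) * Q (ν 4) (ν 7) * Q (ν 5) (ν 10) * Q (ν 8) (ν 11)))) := by
  obtain ⟨L, hL, hdet⟩ := exists_cholesky hpos
  have hdet0 : 0 < L.det := hdet ▸ Real.sqrt_pos.2 hpos.det_pos
  rw [integral_mul_exp_neg_half_quadratic hdet0 (tensorPoly_two_eq_norm_sq hQ hL)]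
  obtain ⟨b, hb⟩ := exists_hasComponentsIn (hT 3) L
  obtain ⟨e, he⟩ := exists_hasComponentsIn (hT 4) L
  obtain ⟨f, hf⟩ := exists_hasComponentsIn (hT 5) L
  obtain ⟨g, hg⟩ := exists_hasComponentsIn (hT 6) L
  have hC11 : C 1 1 = contractPair Q (T 3) := by rw [hC₁, hC₀]
  have hC12 : C 1 2 = contractPair Q (T 4) := by rw [hC₁, hC₀]
  have hC13 : C 1 3 = contractPair Q (T 5) := by rw [hC₁, hC₀]
  have hC20 : C 2 0 = contractPair Q (contractPair Q (T 4)) := by rw [hC₁, hC₁, hC₀]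
  have hC21 : C 2 1 = contractPair Q (contractPair Q (T 5)) := by rw [hC₁, hC₁, hC₀]
  have hC30 : C 3 0 = contractPair Q (contractPair Q (contractPair Q (T 6))) := by
    rw [hC₁, hC₁, hC₁, hC₀]
  have hA := hC11 ▸ hb.contractPair hL
  have hD := hC12 ▸ he.contractPair hL
  have hG := hC13 ▸ hf.contractPair hL
  have hF := hC21 ▸ (hf.contractPair hL).contractPair hL
  have hq : C 2 0 ![] = e 0 + 2 * e 2 + e 4 := by
    have h := (hC20 ▸ (he.contractPair hL).contractPair hL).zero
    rw [h]
    ring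
  have hs := (hC30 ▸ ((hg.contractPair hL).contractPair hL).contractPair hL).zero
  have hint : ∫ z, fourthOrderTerm T (Matrix.toEuclideanLin L z) * Real.exp (-(‖z‖ ^ 2 / 2)) =
      2 * Real.pi * (-(1 / 720) * gaussForm 6 (binomialCoeffs 6 g)
        + 1 / 720 * gaussPairing 3 5 (binomialCoeffs 3 b) (binomialCoeffs 5 f)
        + 1 / 1152 * gaussPairing 4 4 (binomialCoeffs 4 e) (binomialCoeffs 4 e)
        - 1 / 1728 * gaussPairing 6 4 (squareCoeffs b) (binomialCoeffs 4 e)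
        + 1 / 31104 * gaussPairing 6 6 (squareCoeffs b) (squareCoeffs b)) := by
    have hp := fun (r : ℝ) m n b b' => (integrable_binaryForm_mul m n b b').const_mul r
    have hi := fun (r : ℝ) n b => (integrable_binaryForm n b).const_mul r
    simp only [fourthOrderTerm, hb.tensorPoly_eq_binaryForm, he.tensorPoly_eq_binaryForm,
      hf.tensorPoly_eq_binaryForm, hg.tensorPoly_eq_binaryForm, binaryForm_mul_self_three,
      add_mul, mul_assoc (_ / _ : ℝ), mul_assoc (-_ : ℝ)]
    rw [integral_add (((hi _ _ _).fun_add (hp _ _ _ _ _)).fun_add (hp _ _ _ _ _) |>.fun_add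
        (hp _ _ _ _ _)) (hp _ _ _ _ _),
      integral_add (((hi _ _ _).fun_add (hp _ _ _ _ _)).fun_add (hp _ _ _ _ _)) (hp _ _ _ _ _),
      integral_add ((hi _ _ _).fun_add (hp _ _ _ _ _)) (hp _ _ _ _ _),
      integral_add (hi _ _ _) (hp _ _ _ _ _)]
    simp only [integral_const_mul, integral_binaryForm, integral_binaryForm_mul]
    ring
  have hE : gaussForm 6 (binomialCoeffs 6 g) = 15 * C 3 0 ![] := by
    rw [hs]
    simp [gaussForm, binomialCoeffs, gaussMoment, Finset.sum_range_succ, Nat.choose]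
    ring
  have h35 := wick_three_five hL hA hb hF hG
  have h44 := wick_four_four hL hD he hq
  have h334 := wick_three_three_four hL hA hb hD he hq
  have h3333 := wick_three_three_three_three hL hA hb
  rw [hint, hdet]
  linear_combination (8 * Real.pi * Real.sqrt Q.det) * (-(1 / 720) * hE) -
    (2 * Real.pi * Real.sqrt Q.det) * (h35 + h44 + h334 + h3333)

end GaussianCoefficients

/-! ### Taylor's formula with a quadratic form as remainder -/

section TaylorQuadraticForm

/-- The integral of a smooth function over one of its variables is smooth in the other. -/
theorem contDiff_intervalIntegral_of_contDiff {E F : Type} [NormedAddCommGroup E]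
    [NormedSpace ℝ E] [ProperSpace E] [NormedAddCommGroup F] [NormedSpace ℝ F]
    [CompleteSpace F] {f : E → ℝ → F} (hf : ContDiff ℝ (⊤ : ℕ∞) (Function.uncurry f)) :
    ContDiff ℝ (⊤ : ℕ∞) fun x => ∫ s in (0 : ℝ)..1, f x s := by
  refine contDiff_infty.2 fun n => ?_
  induction n generalizing F with
  | zero =>
    exact contDiff_zero.2
      (intervalIntegral.continuous_parametric_intervalIntegral_of_continuous' hf.continuous 0 1)
  | succ n ih =>
    set f' : E → ℝ → E →L[ℝ] F := fun x s =>
      (fderiv ℝ (Function.uncurry f) (x, s)).comp (ContinuousLinearMap.inl ℝ E ℝ) with hf'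
    have hsmooth : ContDiff ℝ (⊤ : ℕ∞) (Function.uncurry f') :=
      ((hf.fderiv_right (by simp)).clm_comp contDiff_const)
    have hder : ∀ x s, HasFDerivAt (fun x => f x s) (f' x s) x := fun x s =>
      HasFDerivAt.comp x (g := Function.uncurry f) (f := fun x => (x, s))
        (hf.differentiable (by simp) (x, s)).hasFDerivAt (hasFDerivAt_prodMk_left x s)
    refine contDiff_succ_iff_hasFDerivAt.2 ⟨fun x => ∫ s in (0 : ℝ)..1, f' x s, ih hsmooth,
      fun x₀ => ?_⟩
    have hcont : ∀ x, Continuous (f x) := fun x =>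
      hf.continuous.comp (Continuous.prodMk_right x)
    have hcont' : Continuous (f' x₀) := hsmooth.continuous.comp (Continuous.prodMk_right x₀)
    obtain ⟨M, hM⟩ := ((isCompact_closedBall x₀ 1).prod
      (isCompact_Icc (a := (0 : ℝ)) (b := 1))).exists_bound_of_continuousOn
        hsmooth.continuous.continuousOn
    refine intervalIntegral.hasFDerivAt_integral_of_dominated_of_fderiv_le
      (bound := fun _ => M) (Metric.closedBall_mem_nhds x₀ one_pos)
      (Eventually.of_forall fun x => (hcont x).aestronglyMeasurable)
      ((hcont x₀).intervalIntegrable _ _) hcont'.aestronglyMeasurable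
      (Eventually.of_forall fun s hs x hx => hM (x, s) ⟨hx, ?_⟩)
      intervalIntegrable_const (Eventually.of_forall fun s _ x _ => hder x s)
    rw [Set.uIoc_of_le zero_le_one] at hs
    exact ⟨hs.1.le, hs.2⟩

/-- The quadratic form in `y` which represents the second-order Taylor remainder of `f` at `ξ`:
`f (ξ + x) = f ξ + Df(ξ) x + q(x, x)`. It is a smooth function of the pair `(x, y)`. -/
noncomputable def taylorQuadraticForm (f : Plane → ℝ) (ξ : Plane) (p : Plane × Plane) : ℝ :=
  ∫ s in (0 : ℝ)..1, (1 - s) * fderiv ℝ (fderiv ℝ f) (ξ + s • p.1) p.2 p.2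

variable {f : Plane → ℝ}

theorem contDiff_taylorQuadraticForm (hf : ContDiff ℝ (⊤ : ℕ∞) f) (ξ : Plane) :
    ContDiff ℝ (⊤ : ℕ∞) (taylorQuadraticForm f ξ) := by
  refine contDiff_intervalIntegral_of_contDiff (f := fun (p : Plane × Plane) s =>
    (1 - s) * fderiv ℝ (fderiv ℝ f) (ξ + s • p.1) p.2 p.2) ?_
  have h2 : ContDiff ℝ (⊤ : ℕ∞) (fderiv ℝ (fderiv ℝ f)) :=
    (hf.fderiv_right (m := (⊤ : ℕ∞)) (by simp)).fderiv_right (by simp)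
  have h3 : ContDiff ℝ (⊤ : ℕ∞) fun p : (Plane × Plane) × ℝ =>
      fderiv ℝ (fderiv ℝ f) (ξ + p.2 • p.1.1) := h2.comp (by fun_prop)
  have hy : ContDiff ℝ (⊤ : ℕ∞) fun p : (Plane × Plane) × ℝ => p.1.2 := by fun_prop
  exact (contDiff_const.sub contDiff_snd).mul ((h3.clm_apply hy).clm_apply hy)

theorem taylorQuadraticForm_smul (ξ x y : Plane) (r : ℝ) :
    taylorQuadraticForm f ξ (x, r • y) = r ^ 2 * taylorQuadraticForm f ξ (x, y) := by
  rw [taylorQuadraticForm, taylorQuadraticForm, ← intervalIntegral.integral_const_mul]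
  congr 1
  ext s
  simp only [map_smul, smul_apply, smul_eq_mul]
  ring

theorem hasDerivAt_comp_line (hf : ContDiff ℝ (⊤ : ℕ∞) f) (ξ x : Plane) (s : ℝ) :
    HasDerivAt (fun s : ℝ => f (ξ + s • x)) (fderiv ℝ f (ξ + s • x) x) s :=
  (hf.differentiable (by simp) _).hasFDerivAt.comp_hasDerivAt s
    (by simpa using ((hasDerivAt_id s).smul_const x).const_add ξ)

theorem hasDerivAt_fderiv_comp_line (hf : ContDiff ℝ (⊤ : ℕ∞) f) (ξ x : Plane) (s : ℝ) :
    HasDerivAt (fun s : ℝ => fderiv ℝ f (ξ + s • x) x)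
      (fderiv ℝ (fderiv ℝ f) (ξ + s • x) x x) s := by
  have hf1 : ContDiff ℝ (⊤ : ℕ∞) (fderiv ℝ f) := hf.fderiv_right (by simp)
  have h := ((hf1.differentiable (by simp) (ξ + s • x)).hasFDerivAt.comp_hasDerivAt s
    (f := fun s : ℝ => ξ + s • x) (f' := x)
    (by simpa using ((hasDerivAt_id s).smul_const x).const_add ξ)).clm_apply (hasDerivAt_const s x)
  simpa using h

theorem eq_add_taylorQuadraticForm (hf : ContDiff ℝ (⊤ : ℕ∞) f) (ξ x : Plane) :
    f (ξ + x) = f ξ + fderiv ℝ f ξ x + taylorQuadraticForm f ξ (x, x) := by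
  have hf1 : ContDiff ℝ (⊤ : ℕ∞) (fderiv ℝ f) := hf.fderiv_right (by simp)
  have hf2 : ContDiff ℝ (⊤ : ℕ∞) (fderiv ℝ (fderiv ℝ f)) := hf1.fderiv_right (by simp)
  have h2 : ∀ s : ℝ, HasDerivAt
      (fun s : ℝ => (1 - s) * fderiv ℝ f (ξ + s • x) x + f (ξ + s • x))
      ((1 - s) * fderiv ℝ (fderiv ℝ f) (ξ + s • x) x x) s := fun s => by
    have h := (((hasDerivAt_id s).const_sub 1).mul
      (hasDerivAt_fderiv_comp_line hf ξ x s)).add (hasDerivAt_comp_line hf ξ x s)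
    convert! h using 1
    simp
  have hc : Continuous fun s : ℝ => (1 - s) * fderiv ℝ (fderiv ℝ f) (ξ + s • x) x x := by
    have := hf2.continuous
    fun_prop
  have h := intervalIntegral.integral_eq_sub_of_hasDerivAt (fun s _ => h2 s)
    (hc.intervalIntegrable 0 1)
  simp only [sub_self, zero_mul, zero_add, one_smul, sub_zero, one_mul, zero_smul, add_zero] at h
  rw [taylorQuadraticForm, h]
  ring

theorem taylorQuadraticForm_zero_left (hf : ContDiff ℝ (⊤ : ℕ∞) f) (ξ y : Plane) :
    taylorQuadraticForm f ξ (0, y) = tensorPoly (derivTensor f ξ 2) y / 2 := by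
  have h : fderiv ℝ (fderiv ℝ f) ξ y y = tensorPoly (derivTensor f ξ 2) y := by
    rw [← iteratedDeriv_line_eq_tensorPoly hf, iteratedDeriv_succ, iteratedDeriv_one,
      funext fun s => (hasDerivAt_comp_line hf ξ y s).deriv,
      (hasDerivAt_fderiv_comp_line hf ξ y 0).deriv, zero_smul, add_zero]
  simp only [taylorQuadraticForm, smul_zero, add_zero, intervalIntegral.integral_mul_const, h]
  have : ∫ s in (0 : ℝ)..1, (1 - s) = 1 / 2 := by
    rw [intervalIntegral.integral_sub (by simp) (by simp)]
    norm_num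
  rw [this]
  ring

/-- If the Hessian at `ξ` is positive definite, the form stays uniformly positive near the point. -/
theorem exists_le_taylorQuadraticForm (hf : ContDiff ℝ (⊤ : ℕ∞) f) {ξ : Plane}
    (hpos : ∀ y : Plane, y ≠ 0 → 0 < tensorPoly (derivTensor f ξ 2) y) :
    ∃ δ > 0, ∃ c > 0, ∀ x y : Plane, ‖x‖ ≤ δ →
      c * ‖y‖ ^ 2 ≤ taylorQuadraticForm f ξ (x, y) := by
  have hcont := (contDiff_taylorQuadraticForm hf ξ).continuous
  have hK : IsCompact (Metric.sphere (0 : Plane) 1) := isCompact_sphere 0 1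
  have hne : (Metric.sphere (0 : Plane) 1).Nonempty := NormedSpace.sphere_nonempty.2 zero_le_one
  obtain ⟨w, hw, hmin⟩ := hK.exists_isMinOn hne
    (f := fun y => taylorQuadraticForm f ξ (0, y))
    (hcont.comp (Continuous.prodMk_right 0)).continuousOn
  set m := taylorQuadraticForm f ξ (0, w) with hm
  have hm0 : 0 < m := by
    rw [hm, taylorQuadraticForm_zero_left hf]
    exact half_pos (hpos w (ne_zero_of_mem_unit_sphere ⟨w, hw⟩))
  have hev : ∀ᶠ x in 𝓝 (0 : Plane), ∀ y ∈ Metric.sphere (0 : Plane) 1,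
      m / 2 < taylorQuadraticForm f ξ (x, y) := by
    refine hK.eventually_forall_of_forall_eventually
      (P := fun x y => m / 2 < taylorQuadraticForm f ξ (x, y)) fun y hy => ?_
    exact hcont.continuousAt.eventually_const_lt
      (lt_of_lt_of_le (half_lt_self hm0) (hmin hy))
  obtain ⟨δ, hδ, hball⟩ := Metric.nhds_basis_closedBall.eventually_iff.1 hev
  refine ⟨δ, hδ, m / 2, half_pos hm0, fun x y hx => ?_⟩
  rcases eq_or_ne y 0 with rfl | hy
  · have := taylorQuadraticForm_smul (f := f) ξ x 0 0
    simp only [smul_zero, ne_eq, OfNat.ofNat_ne_zero, not_false_eq_true, zero_pow, zero_mul] at this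
    simp [this]
  · have hn : ‖y‖ ≠ 0 := norm_ne_zero_iff.2 hy
    have h1 : y = ‖y‖ • (‖y‖⁻¹ • y) := by rw [smul_smul, mul_inv_cancel₀ hn, one_smul]
    rw [h1, taylorQuadraticForm_smul, ← h1, mul_comm]
    refine mul_le_mul_of_nonneg_left (hball (by simpa using hx) _ ?_).le (sq_nonneg _)
    simp [norm_smul, hn]

end TaylorQuadraticForm

/-! ### Smooth dependence of Laplace integrals on the parameter -/

section LaplaceIntegral

/-- Amplitudes of a Laplace integral: smooth functions `ψ(x, y)`, homogeneous of degree `n` in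
`y`, which vanish for `‖x‖ > δ`. -/
structure IsAmplitude (δ : ℝ) (n : ℕ) (ψ : Plane × Plane → ℝ) : Prop where
  contDiff : ContDiff ℝ (⊤ : ℕ∞) ψ
  map_smul : ∀ (x y : Plane) (r : ℝ), ψ (x, r • y) = r ^ n * ψ (x, y)
  eq_zero : ∀ x y : Plane, δ < ‖x‖ → ψ (x, y) = 0

/-- `(∂ψ/∂x)(x, y)` in the direction `y`. It is the derivative of `ε ↦ ψ(ε y, y)` at `x = ε y`. -/
noncomputable def radialDeriv (ψ : Plane × Plane → ℝ) (p : Plane × Plane) : ℝ :=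
  fderiv ℝ ψ p (p.2, 0)

/-- The integrand `ψ(ε y, y) exp (-q(ε y, y))`. -/
noncomputable def laplaceIntegrand (q ψ : Plane × Plane → ℝ) (ε : ℝ) (y : Plane) : ℝ :=
  ψ (ε • y, y) * Real.exp (-q (ε • y, y))

variable {q ψ : Plane × Plane → ℝ} {δ c : ℝ} {n : ℕ}

theorem contDiff_radialDeriv (hψ : ContDiff ℝ (⊤ : ℕ∞) ψ) :
    ContDiff ℝ (⊤ : ℕ∞) (radialDeriv ψ) :=
  (hψ.fderiv_right (by simp)).clm_apply (contDiff_snd.prodMk contDiff_const)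

theorem hasDerivAt_comp_smul_prod (hψ : ContDiff ℝ (⊤ : ℕ∞) ψ) (y : Plane) (ε : ℝ) :
    HasDerivAt (fun ε : ℝ => ψ (ε • y, y)) (radialDeriv ψ (ε • y, y)) ε := by
  have h : HasDerivAt (fun ε : ℝ => (ε • y, y)) ((y, 0) : Plane × Plane) ε := by
    simpa using ((hasDerivAt_id ε).smul_const y).prodMk (hasDerivAt_const ε y)
  exact (hψ.differentiable (by simp) _).hasFDerivAt.comp_hasDerivAt ε h

theorem radialDeriv_smul (hψ : ContDiff ℝ (⊤ : ℕ∞) ψ)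
    (hs : ∀ (x y : Plane) (r : ℝ), ψ (x, r • y) = r ^ n * ψ (x, y)) (x y : Plane) (r : ℝ) :
    radialDeriv ψ (x, r • y) = r ^ (n + 1) * radialDeriv ψ (x, y) := by
  have h : ∀ z v : Plane, HasDerivAt (fun t : ℝ => ψ (x + t • v, z))
      (fderiv ℝ ψ (x, z) (v, 0)) 0 := by
    intro z v
    have hl : HasDerivAt (fun t : ℝ => (x + t • v, z)) ((v, 0) : Plane × Plane) 0 := by
      simpa using (((hasDerivAt_id (0 : ℝ)).smul_const v).const_add x).prodMk
        (hasDerivAt_const (0 : ℝ) z)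
    have h2 := (hψ.differentiable (by simp) (x + (0 : ℝ) • v, z)).hasFDerivAt.comp_hasDerivAt
      (0 : ℝ) hl
    simp only [zero_smul, add_zero] at h2
    exact h2
  have h1 := (h y y).const_mul (r ^ n)
  simp only [← hs] at h1
  have h2 := h1.unique (h (r • y) y)
  have h3 : ((r • y, 0) : Plane × Plane) = r • (y, 0) := by simp
  simp only [radialDeriv]
  rw [h3, map_smul, ← h2, smul_eq_mul]
  ring

theorem IsAmplitude.radialDeriv (hψ : IsAmplitude δ n ψ) :
    IsAmplitude δ (n + 1) (radialDeriv ψ) where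
  contDiff := contDiff_radialDeriv hψ.contDiff
  map_smul := radialDeriv_smul hψ.contDiff hψ.map_smul
  eq_zero x y hx := by
    have h : ψ =ᶠ[𝓝 (x, y)] fun _ => 0 :=
      (((continuous_fst.norm).continuousAt (x := (x, y))).eventually_const_lt hx).mono
        fun p hp => hψ.eq_zero p.1 p.2 hp
    simp [_root_.radialDeriv, h.fderiv_eq]

theorem IsAmplitude.mul (hψ : IsAmplitude δ n ψ) {m : ℕ} {φ : Plane × Plane → ℝ}
    (hφ : ContDiff ℝ (⊤ : ℕ∞) φ)
    (hs : ∀ (x y : Plane) (r : ℝ), φ (x, r • y) = r ^ m * φ (x, y)) :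
    IsAmplitude δ (n + m) fun p => ψ p * φ p where
  contDiff := hψ.contDiff.mul hφ
  map_smul x y r := by
    simp only [hψ.map_smul, hs]
    ring
  eq_zero x y hx := by simp only [hψ.eq_zero x y hx, zero_mul]

/-- By homogeneity and compactness, amplitudes have polynomial growth in `y`, uniformly in `x`. -/
theorem IsAmplitude.exists_bound (hψ : IsAmplitude δ n ψ) :
    ∃ M, 0 ≤ M ∧ ∀ x y : Plane, |ψ (x, y)| ≤ M * ‖y‖ ^ n := by
  obtain ⟨M, hM⟩ := ((isCompact_closedBall (0 : Plane) δ).prod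
    (isCompact_sphere (0 : Plane) 1)).exists_bound_of_continuousOn
      hψ.contDiff.continuous.continuousOn
  have hunit : ∀ x w : Plane, ‖w‖ = 1 → |ψ (x, w)| ≤ max M 0 := by
    intro x w hw
    rcases lt_or_ge δ ‖x‖ with hx | hx
    · simp [hψ.eq_zero x w hx]
    · exact (hM (x, w) ⟨by simpa using hx, by simpa using hw⟩).trans (le_max_left _ _)
  have hpolar : ∀ y : Plane, ∃ w : Plane, ‖w‖ = 1 ∧ y = ‖y‖ • w := by
    intro y
    rcases eq_or_ne y 0 with rfl | hy
    · exact ⟨EuclideanSpace.single 0 1, by simp, by simp⟩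
    · have hn : ‖y‖ ≠ 0 := norm_ne_zero_iff.2 hy
      exact ⟨‖y‖⁻¹ • y, by simp [norm_smul, hn], by rw [smul_smul, mul_inv_cancel₀ hn, one_smul]⟩
  refine ⟨max M 0, le_max_right _ _, fun x y => ?_⟩
  obtain ⟨w, hw, hy⟩ := hpolar y
  have h := hψ.map_smul x w ‖y‖
  rw [← hy] at h
  rw [h, abs_mul, abs_pow, abs_norm, mul_comm]
  exact mul_le_mul_of_nonneg_right (hunit x w hw) (by positivity)

/-- Phases of a Laplace integral: smooth, quadratic in `y`, and coercive for `‖x‖ ≤ δ`. -/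
structure IsPhase (δ c : ℝ) (q : Plane × Plane → ℝ) : Prop where
  contDiff : ContDiff ℝ (⊤ : ℕ∞) q
  map_smul : ∀ (x y : Plane) (r : ℝ), q (x, r • y) = r ^ 2 * q (x, y)
  le : ∀ x y : Plane, ‖x‖ ≤ δ → c * ‖y‖ ^ 2 ≤ q (x, y)

theorem IsAmplitude.exists_bound_laplaceIntegrand (hψ : IsAmplitude δ n ψ) (hq : IsPhase δ c q) :
    ∃ M, ∀ ε y, ‖laplaceIntegrand q ψ ε y‖ ≤ M * (‖y‖ ^ n * Real.exp (-(c * ‖y‖ ^ 2))) := by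
  obtain ⟨M, hM0, hM⟩ := hψ.exists_bound
  refine ⟨M, fun ε y => ?_⟩
  rw [laplaceIntegrand, norm_mul, Real.norm_eq_abs, Real.norm_eq_abs, Real.abs_exp, ← mul_assoc]
  rcases lt_or_ge δ ‖ε • y‖ with hx | hx
  · rw [hψ.eq_zero _ _ hx, abs_zero, zero_mul]
    positivity
  · gcongr
    · exact hM _ _
    · exact hq.le _ _ hx

theorem continuous_laplaceIntegrand (hψ : Continuous ψ) (hq : Continuous q) (ε : ℝ) :
    Continuous (laplaceIntegrand q ψ ε) := by
  unfold laplaceIntegrand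
  fun_prop

theorem IsAmplitude.integrable_laplaceIntegrand (hψ : IsAmplitude δ n ψ) (hq : IsPhase δ c q)
    (hc : 0 < c) (ε : ℝ) : Integrable (laplaceIntegrand q ψ ε) := by
  obtain ⟨M, hM⟩ := hψ.exists_bound_laplaceIntegrand hq
  exact ((integrable_norm_pow_mul_exp_neg_mul_sq n hc).const_mul M).mono'
    (continuous_laplaceIntegrand hψ.contDiff.continuous hq.contDiff.continuous ε).aestronglyMeasurable
    (Eventually.of_forall (hM ε))

theorem hasDerivAt_laplaceIntegrand (hψ : ContDiff ℝ (⊤ : ℕ∞) ψ) (hq : ContDiff ℝ (⊤ : ℕ∞) q)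
    (y : Plane) (ε : ℝ) :
    HasDerivAt (fun ε => laplaceIntegrand q ψ ε y) (laplaceIntegrand q (radialDeriv ψ) ε y -
      laplaceIntegrand q (fun p => ψ p * radialDeriv q p) ε y) ε := by
  have h := (hasDerivAt_comp_smul_prod hψ y ε).mul (hasDerivAt_comp_smul_prod hq y ε).neg.exp
  convert! h using 1
  simp only [laplaceIntegrand, Pi.neg_apply]
  ring

theorem IsAmplitude.hasDerivAt_integral (hψ : IsAmplitude δ n ψ) (hq : IsPhase δ c q)
    (hc : 0 < c) (ε : ℝ) :
    HasDerivAt (fun ε => ∫ y, laplaceIntegrand q ψ ε y)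
      ((∫ y, laplaceIntegrand q (_root_.radialDeriv ψ) ε y) -
        ∫ y, laplaceIntegrand q (fun p => ψ p * _root_.radialDeriv q p) ε y) ε := by
  have h1 := hψ.radialDeriv
  have h2 := hψ.mul (contDiff_radialDeriv hq.contDiff) (radialDeriv_smul hq.contDiff hq.map_smul)
  obtain ⟨M₁, hM₁⟩ := h1.exists_bound_laplaceIntegrand hq
  obtain ⟨M₂, hM₂⟩ := h2.exists_bound_laplaceIntegrand hq
  have i1 := h1.integrable_laplaceIntegrand hq hc ε
  have i2 := h2.integrable_laplaceIntegrand hq hc ε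
  rw [← integral_sub i1 i2]
  refine (hasDerivAt_integral_of_dominated_loc_of_deriv_le
    (F' := fun ε y => laplaceIntegrand q (_root_.radialDeriv ψ) ε y -
      laplaceIntegrand q (fun p => ψ p * _root_.radialDeriv q p) ε y)
    univ_mem (Eventually.of_forall fun ε =>
      (hψ.integrable_laplaceIntegrand hq hc ε).aestronglyMeasurable)
    (hψ.integrable_laplaceIntegrand hq hc ε) (i1.sub i2).aestronglyMeasurable
    (Eventually.of_forall fun y ε _ => (norm_sub_le _ _).trans (add_le_add (hM₁ ε y) (hM₂ ε y)))
    (((integrable_norm_pow_mul_exp_neg_mul_sq _ hc).const_mul M₁).add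
      ((integrable_norm_pow_mul_exp_neg_mul_sq _ hc).const_mul M₂))
    (Eventually.of_forall fun y ε _ =>
      hasDerivAt_laplaceIntegrand hψ.contDiff hq.contDiff y ε)).2

theorem contDiff_laplaceIntegrand (hψ : ContDiff ℝ (⊤ : ℕ∞) ψ) (hq : ContDiff ℝ (⊤ : ℕ∞) q)
    (y : Plane) : ContDiff ℝ (⊤ : ℕ∞) fun ε => laplaceIntegrand q ψ ε y := by
  have h : ContDiff ℝ (⊤ : ℕ∞) fun ε : ℝ => ((ε • y, y) : Plane × Plane) := by fun_prop
  exact (hψ.comp h).mul (hq.comp h).neg.exp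

/-- A Laplace integral is a smooth function of the parameter, and it may be differentiated under
the integral sign any number of times. The derivative of a Laplace integral is a difference of two
Laplace integrals, which allows an induction over all amplitudes at once. -/
theorem IsAmplitude.iteratedDeriv_integral (hq : IsPhase δ c q) (hc : 0 < c) (k : ℕ)
    (hψ : IsAmplitude δ n ψ) :
    ContDiff ℝ k (fun ε => ∫ y, laplaceIntegrand q ψ ε y) ∧
      (∀ ε, Integrable fun y => iteratedDeriv k (fun ε => laplaceIntegrand q ψ ε y) ε) ∧
      ∀ ε, iteratedDeriv k (fun ε => ∫ y, laplaceIntegrand q ψ ε y) ε =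
        ∫ y, iteratedDeriv k (fun ε => laplaceIntegrand q ψ ε y) ε := by
  induction k generalizing n ψ with
  | zero =>
    refine ⟨contDiff_zero.2 ?_, fun ε => ?_, fun ε => ?_⟩
    · exact continuous_iff_continuousAt.2 fun ε => (hψ.hasDerivAt_integral hq hc ε).continuousAt
    · simpa using hψ.integrable_laplaceIntegrand hq hc ε
    · simp
  | succ k ih =>
    have h1 := hψ.radialDeriv
    have h2 := hψ.mul (contDiff_radialDeriv hq.contDiff)
      (radialDeriv_smul hq.contDiff hq.map_smul)
    obtain ⟨c1, i1, e1⟩ := ih h1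
    obtain ⟨c2, i2, e2⟩ := ih h2
    have hd := fun ε => hψ.hasDerivAt_integral hq hc ε
    have hder := funext fun ε => (hd ε).deriv
    have hder' := fun y => funext fun ε =>
      (hasDerivAt_laplaceIntegrand hψ.contDiff hq.contDiff y ε).deriv
    have hsplit : ∀ y ε, iteratedDeriv (k + 1) (fun ε => laplaceIntegrand q ψ ε y) ε =
        iteratedDeriv k (fun ε => laplaceIntegrand q (_root_.radialDeriv ψ) ε y) ε -
        iteratedDeriv k
          (fun ε => laplaceIntegrand q (fun p => ψ p * _root_.radialDeriv q p) ε y) ε := by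
      intro y ε
      rw [iteratedDeriv_succ', hder', iteratedDeriv_fun_sub
        (contDiff_infty.1 (contDiff_laplaceIntegrand h1.contDiff hq.contDiff y) k).contDiffAt
        (contDiff_infty.1 (contDiff_laplaceIntegrand h2.contDiff hq.contDiff y) k).contDiffAt]
    refine ⟨?_, fun ε => ?_, fun ε => ?_⟩
    · rw [Nat.cast_add, Nat.cast_one, contDiff_succ_iff_deriv, hder]
      exact ⟨fun ε => (hd ε).differentiableAt, by simp, c1.sub c2⟩
    · simp only [hsplit]
      exact (i1 ε).sub (i2 ε)
    · rw [iteratedDeriv_succ', hder, iteratedDeriv_fun_sub c1.contDiffAt c2.contDiffAt, e1, e2,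
        ← integral_sub (i1 ε) (i2 ε)]
      simp only [hsplit]

end LaplaceIntegral

/-! ### Derivatives of the Laplace integrand at zero -/

section DerivativesAtZero

theorem iteratedDeriv_succ_id_mul {f : ℝ → ℝ} (hf : ContDiff ℝ (⊤ : ℕ∞) f) (k : ℕ) :
    iteratedDeriv (k + 1) (fun x => x * f x) 0 = (k + 1) * iteratedDeriv k f 0 := by
  induction k generalizing f with
  | zero =>
    have h := (hasDerivAt_id' (0 : ℝ)).fun_mul (hf.differentiable (by simp) 0).hasDerivAt
    simpa using h.deriv
  | succ k ih =>
    have hd : ContDiff ℝ (⊤ : ℕ∞) (deriv f) := (contDiff_infty_iff_deriv.1 hf).2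
    have h : deriv (fun x => x * f x) = fun x => f x + x * deriv f x := funext fun x => by
      simpa using ((hasDerivAt_id' x).fun_mul (hf.differentiable (by simp) x).hasDerivAt).deriv
    rw [iteratedDeriv_succ', h, iteratedDeriv_fun_add (contDiff_infty.1 hf _).contDiffAt
      (contDiff_infty.1 (contDiff_fun_id.mul hd) _).contDiffAt, ih hd, ← iteratedDeriv_succ']
    push_cast
    ring

theorem iteratedDeriv_add_two_sq_mul {f : ℝ → ℝ} (hf : ContDiff ℝ (⊤ : ℕ∞) f) (k : ℕ) :
    iteratedDeriv (k + 2) (fun x => x ^ 2 * f x) 0 = (k + 2) * (k + 1) * iteratedDeriv k f 0 := by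
  have h := iteratedDeriv_succ_id_mul (contDiff_fun_id.mul hf) (k + 1)
  simp only [← mul_assoc, ← pow_two] at h
  rw [h, iteratedDeriv_succ_id_mul hf]
  push_cast
  ring

theorem deriv_exp_neg {g : ℝ → ℝ} (hg : ContDiff ℝ (⊤ : ℕ∞) g) (x : ℝ) :
    deriv (fun x => Real.exp (-g x)) x = -(deriv g x * Real.exp (-g x)) := by
  rw [((hg.differentiable (by simp) x).hasDerivAt.fun_neg.exp).deriv]
  ring

/-- Leibniz' rule for `E' = -g' E`, where `E = exp (-g)`. -/
theorem iteratedDeriv_succ_exp_neg {g : ℝ → ℝ} (hg : ContDiff ℝ (⊤ : ℕ∞) g) (k : ℕ) (x : ℝ) :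
    iteratedDeriv (k + 1) (fun x => Real.exp (-g x)) x =
      -∑ i ∈ Finset.range (k + 1), (k.choose i : ℝ) * iteratedDeriv (i + 1) g x *
        iteratedDeriv (k - i) (fun x => Real.exp (-g x)) x := by
  have hd : ContDiff ℝ (⊤ : ℕ∞) (deriv g) := (contDiff_infty_iff_deriv.1 hg).2
  rw [iteratedDeriv_succ', funext (deriv_exp_neg hg), iteratedDeriv_fun_neg,
    iteratedDeriv_fun_mul (contDiff_infty.1 hd _).contDiffAt
      (contDiff_infty.1 hg.neg.exp _).contDiffAt]
  simp only [iteratedDeriv_succ']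

theorem iteratedDeriv_two_exp_neg {g : ℝ → ℝ} (hg : ContDiff ℝ (⊤ : ℕ∞) g) (x : ℝ) :
    iteratedDeriv 2 (fun x => Real.exp (-g x)) x =
      (-iteratedDeriv 2 g x + iteratedDeriv 1 g x ^ 2) * Real.exp (-g x) := by
  have h1 := iteratedDeriv_succ_exp_neg hg 0 x
  have h2 := iteratedDeriv_succ_exp_neg hg 1 x
  simp only [Finset.sum_range_succ, Finset.sum_range_zero, Nat.choose, iteratedDeriv_zero,
    Nat.reduceAdd, Nat.reduceSub] at h1 h2
  rw [h2, h1]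
  push_cast
  ring

theorem iteratedDeriv_four_exp_neg {g : ℝ → ℝ} (hg : ContDiff ℝ (⊤ : ℕ∞) g) (x : ℝ) :
    iteratedDeriv 4 (fun x => Real.exp (-g x)) x =
      (-iteratedDeriv 4 g x + 4 * (iteratedDeriv 1 g x * iteratedDeriv 3 g x)
        + 3 * iteratedDeriv 2 g x ^ 2 - 6 * (iteratedDeriv 1 g x ^ 2 * iteratedDeriv 2 g x)
        + iteratedDeriv 1 g x ^ 4) * Real.exp (-g x) := by
  have h1 := iteratedDeriv_succ_exp_neg hg 0 x
  have h2 := iteratedDeriv_two_exp_neg hg x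
  have h3 := iteratedDeriv_succ_exp_neg hg 2 x
  have h4 := iteratedDeriv_succ_exp_neg hg 3 x
  simp only [Finset.sum_range_succ, Finset.sum_range_zero, Nat.choose, iteratedDeriv_zero,
    Nat.reduceAdd, Nat.reduceSub] at h1 h2 h3 h4
  rw [h4, h3, h2, h1]
  push_cast
  ring

end DerivativesAtZero

section LaplaceExpansion

variable {S : Plane → ℝ} {ξ : Plane}

/-- At a critical zero of `S`, the form `q(ε y, y)` is `S(ξ + ε y) / ε²`, also at `ε = 0`. -/
theorem sq_mul_taylorQuadraticForm (hS : ContDiff ℝ (⊤ : ℕ∞) S) (h0 : S ξ = 0)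
    (h1 : fderiv ℝ S ξ = 0) (y : Plane) (ε : ℝ) :
    ε ^ 2 * taylorQuadraticForm S ξ (ε • y, y) = S (ξ + ε • y) := by
  rw [eq_add_taylorQuadraticForm hS, h0, h1, taylorQuadraticForm_smul]
  simp

theorem contDiff_taylorQuadraticForm_line (hS : ContDiff ℝ (⊤ : ℕ∞) S) (y : Plane) :
    ContDiff ℝ (⊤ : ℕ∞) fun ε : ℝ => taylorQuadraticForm S ξ (ε • y, y) := by
  have h : ContDiff ℝ (⊤ : ℕ∞) fun ε : ℝ => ((ε • y, y) : Plane × Plane) := by fun_prop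
  exact (contDiff_taylorQuadraticForm hS ξ).comp h

theorem iteratedDeriv_taylorQuadraticForm_line (hS : ContDiff ℝ (⊤ : ℕ∞) S) (h0 : S ξ = 0)
    (h1 : fderiv ℝ S ξ = 0) (y : Plane) (k : ℕ) :
    (k + 2) * (k + 1) * iteratedDeriv k (fun ε : ℝ => taylorQuadraticForm S ξ (ε • y, y)) 0 =
      tensorPoly (derivTensor S ξ (k + 2)) y := by
  rw [← iteratedDeriv_add_two_sq_mul (contDiff_taylorQuadraticForm_line hS y),
    ← iteratedDeriv_line_eq_tensorPoly hS]
  simp only [sq_mul_taylorQuadraticForm hS h0 h1]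

theorem taylorQuadraticForm_zero_smul (hS : ContDiff ℝ (⊤ : ℕ∞) S) (y : Plane) :
    taylorQuadraticForm S ξ ((0 : ℝ) • y, y) = tensorPoly (derivTensor S ξ 2) y / 2 := by
  rw [zero_smul, taylorQuadraticForm_zero_left hS]

theorem iteratedDeriv_two_exp_taylorQuadraticForm (hS : ContDiff ℝ (⊤ : ℕ∞) S) (h0 : S ξ = 0)
    (h1 : fderiv ℝ S ξ = 0) (y : Plane) :
    iteratedDeriv 2 (fun ε : ℝ => Real.exp (-taylorQuadraticForm S ξ (ε • y, y))) 0 =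
      2 * (secondOrderTerm (derivTensor S ξ) y *
        Real.exp (-(tensorPoly (derivTensor S ξ 2) y / 2))) := by
  have h := iteratedDeriv_taylorQuadraticForm_line hS h0 h1 y
  rw [iteratedDeriv_two_exp_neg (contDiff_taylorQuadraticForm_line hS y),
    taylorQuadraticForm_zero_smul hS, secondOrderTerm, ← h 1, ← h 2]
  push_cast
  ring

theorem iteratedDeriv_four_exp_taylorQuadraticForm (hS : ContDiff ℝ (⊤ : ℕ∞) S) (h0 : S ξ = 0)
    (h1 : fderiv ℝ S ξ = 0) (y : Plane) :
    iteratedDeriv 4 (fun ε : ℝ => Real.exp (-taylorQuadraticForm S ξ (ε • y, y))) 0 =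
      24 * (fourthOrderTerm (derivTensor S ξ) y *
        Real.exp (-(tensorPoly (derivTensor S ξ 2) y / 2))) := by
  have h := iteratedDeriv_taylorQuadraticForm_line hS h0 h1 y
  rw [iteratedDeriv_four_exp_neg (contDiff_taylorQuadraticForm_line hS y),
    taylorQuadraticForm_zero_smul hS, fourthOrderTerm, ← h 1, ← h 2, ← h 3, ← h 4]
  push_cast
  ring

theorem isAmplitude_contDiffBump (χ : ContDiffBump (0 : Plane)) :
    IsAmplitude χ.rOut 0 fun p => χ p.1 where
  contDiff := χ.contDiff.comp contDiff_fst
  map_smul x y r := by simp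
  eq_zero x y hx := χ.zero_of_le_dist (by simpa using hx.le)

theorem isPhase_taylorQuadraticForm (hS : ContDiff ℝ (⊤ : ℕ∞) S) {δ c : ℝ}
    (h : ∀ x y : Plane, ‖x‖ ≤ δ → c * ‖y‖ ^ 2 ≤ taylorQuadraticForm S ξ (x, y)) :
    IsPhase δ c (taylorQuadraticForm S ξ) where
  contDiff := contDiff_taylorQuadraticForm hS ξ
  map_smul := taylorQuadraticForm_smul ξ
  le := h

/-- A cut-off near `0` does not affect the derivatives at `ε = 0`. -/
theorem iteratedDeriv_laplaceIntegrand_bump (χ : ContDiffBump (0 : Plane))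
    (q : Plane × Plane → ℝ) (y : Plane) (k : ℕ) :
    iteratedDeriv k (fun ε => laplaceIntegrand q (fun p => χ p.1) ε y) 0 =
      iteratedDeriv k (fun ε : ℝ => Real.exp (-q (ε • y, y))) 0 := by
  refine Filter.EventuallyEq.iteratedDeriv_eq k ?_
  have h : Tendsto (fun ε : ℝ => ε • y) (𝓝 0) (𝓝 0) := by
    have hc : Continuous fun ε : ℝ => ε • y := by fun_prop
    simpa using hc.tendsto 0
  filter_upwards [h.eventually χ.eventuallyEq_one] with ε hε
  simp only [laplaceIntegrand, hε, Pi.one_apply, one_mul]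

/-- The localized Laplace integral `∫ χ(ε y) exp (-S(ξ + ε y) / ε²) dy`, extended smoothly to
`ε = 0`. -/
noncomputable def localIntegral (S : Plane → ℝ) (ξ : Plane) (χ : ContDiffBump (0 : Plane))
    (ε : ℝ) : ℝ :=
  ∫ y, laplaceIntegrand (taylorQuadraticForm S ξ) (fun p => χ p.1) ε y

theorem localIntegral_neg (χ : ContDiffBump (0 : Plane)) (ε : ℝ) :
    localIntegral S ξ χ (-ε) = localIntegral S ξ χ ε := by
  rw [localIntegral, ← integral_neg_eq_self, localIntegral]
  congr 1
  ext y
  have h := taylorQuadraticForm_smul (f := S) ξ (ε • y) y (-1)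
  simp only [neg_smul, one_smul] at h
  simp [laplaceIntegrand, h]

/-- Even functions have even Taylor polynomials. -/
theorem Function.Even.taylorWithinEval_zero {F : ℝ → ℝ} (hF : ∀ x, F (-x) = F x) (N : ℕ) (x : ℝ) :
    taylorWithinEval F (2 * N) Set.univ 0 x =
      ∑ k ∈ Finset.range (N + 1), iteratedDeriv (2 * k) F 0 / (2 * k).factorial * x ^ (2 * k) := by
  have hodd : ∀ k, iteratedDeriv (2 * k + 1) F 0 = 0 := by
    intro k
    have h := iteratedDeriv_comp_neg (2 * k + 1) F 0
    rw [neg_zero, Odd.neg_one_pow ⟨k, rfl⟩, neg_one_smul] at h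
    simp only [hF] at h
    linarith
  induction N with
  | zero => simp
  | succ N ih =>
    rw [show 2 * (N + 1) = 2 * N + 1 + 1 by ring, taylorWithinEval_succ, taylorWithinEval_succ, ih,
      Finset.sum_range_succ _ (N + 1), iteratedDerivWithin_univ, hodd]
    rw [smul_zero, add_zero, iteratedDerivWithin_univ, sub_zero, smul_eq_mul,
      show 2 * (N + 1) = 2 * N + 1 + 1 by ring, Nat.factorial_succ (2 * N + 1)]
    congr 1
    push_cast
    ring

end LaplaceExpansion

/-! ### Localization at the minimum -/

section LaplaceMethod

/-- The hypotheses of Laplace's method for the exponent `S`: `ξ` is the only minimum, its value is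
`0`, the Hessian there is positive definite, and `S` grows at least like a power at infinity. -/
structure IsLaplaceExponent (S : Plane → ℝ) (ξ : Plane) : Prop where
  contDiff : ContDiff ℝ (⊤ : ℕ∞) S
  map_zero : S ξ = 0
  pos : ∀ x, x ≠ ξ → 0 < S x
  fderiv_eq_zero : fderiv ℝ S ξ = 0
  hessian_pos : ∀ y : Plane, y ≠ 0 → 0 < tensorPoly (derivTensor S ξ 2) y
  growth : ∃ p R c : ℝ, 0 < p ∧ 0 < R ∧ 0 < c ∧
    ∀ x : Plane, R ^ 2 / 2 < ‖x‖ ^ 2 / 2 → c * (‖x‖ ^ 2 / 2) ^ p ≤ S x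

variable {S : Plane → ℝ} {ξ : Plane}

theorem IsLaplaceExponent.nonneg (hS : IsLaplaceExponent S ξ) (x : Plane) : 0 ≤ S x := by
  rcases eq_or_ne x ξ with rfl | hx
  · exact hS.map_zero.ge
  · exact (hS.pos x hx).le

theorem IsLaplaceExponent.integrable_exp (hS : IsLaplaceExponent S ξ) {a : ℝ} (ha : 0 < a) :
    Integrable fun x => Real.exp (-(a * S x)) := by
  obtain ⟨p, R, c, hp, hR, hc, hgrowth⟩ := hS.growth
  have hcont : Continuous fun x => Real.exp (-(a * S x)) := by
    have := hS.contDiff.continuous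
    fun_prop
  have hg : Integrable fun x : Plane => ((1 : ℝ) + ‖x‖ ^ 2) ^ (-(4 : ℝ) / 2) :=
    integrable_rpow_neg_one_add_norm_sq (by simp; norm_num)
  -- Both steps of the comparison hold for `w = ‖x‖² / 2` large: `exp (-a c w ^ p)` is at most a
  -- multiple of `w ^ (-2)`, and this is at most a multiple of `(1 + ‖x‖²) ^ (-2)`.
  refine hcont.locallyIntegrable.integrable_of_isBigO_cocompact
    (g := fun x : Plane => ((1 : ℝ) + ‖x‖ ^ 2) ^ (-(4 : ℝ) / 2)) ?_ (hg.integrableAtFilter _)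
  have hw : Tendsto (fun x : Plane => ‖x‖ ^ 2 / 2) (cocompact Plane) atTop :=
    ((tendsto_pow_atTop two_ne_zero).comp tendsto_norm_cocompact_atTop).atTop_div_const
      two_pos
  have h1 := ((isLittleO_exp_neg_mul_rpow_atTop (mul_pos ha hc) (-2 / p)).comp_tendsto
    ((tendsto_rpow_atTop hp).comp hw)).isBigO
  refine (Asymptotics.IsBigO.of_bound 1 ?_).trans (h1.trans (Asymptotics.IsBigO.of_bound 16 ?_))
  · filter_upwards [hw.eventually_gt_atTop (R ^ 2 / 2)] with x hx
    simp only [Function.comp_apply, Real.norm_eq_abs, Real.abs_exp, one_mul]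
    refine Real.exp_le_exp.2 ?_
    have := mul_le_mul_of_nonneg_left (hgrowth x hx) ha.le
    linarith
  · filter_upwards [hw.eventually_ge_atTop (1 / 2)] with x hx
    have h2 : -(4 : ℝ) / 2 = -(2 : ℕ) := by norm_num
    have h0 : 0 ≤ ‖x‖ ^ 2 / 2 := by positivity
    have h3 : ((‖x‖ ^ 2 / 2) ^ p) ^ (-2 / p) = (‖x‖ ^ 2 / 2) ^ (-(2 : ℕ) : ℝ) := by
      rw [← Real.rpow_mul h0]
      congr 1
      field_simp
      norm_num
    simp only [Function.comp_apply]
    rw [h2, h3, Real.rpow_neg h0, Real.rpow_neg (by positivity), Real.rpow_natCast,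
      Real.rpow_natCast, norm_inv, norm_inv, norm_pow, norm_pow, Real.norm_of_nonneg h0,
      Real.norm_of_nonneg (by positivity : 0 ≤ 1 + ‖x‖ ^ 2), inv_le_iff_one_le_mul₀ (by positivity)]
    have h4 : 1 + ‖x‖ ^ 2 ≤ 4 * (‖x‖ ^ 2 / 2) := by linarith
    have h5 : 0 < 1 + ‖x‖ ^ 2 := by positivity
    rw [mul_assoc, mul_comm _ ((‖x‖ ^ 2 / 2) ^ 2), ← mul_assoc, ← div_eq_mul_inv,
      le_div_iff₀ (by positivity)]
    nlinarith [pow_le_pow_left₀ h5.le h4 2]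

/-- Away from its minimum, `S` has a positive lower bound: by compactness near the origin, and by the
growth condition elsewhere. -/
theorem IsLaplaceExponent.exists_le_of_le_dist (hS : IsLaplaceExponent S ξ) {r : ℝ} (hr : 0 < r) :
    ∃ η > 0, ∀ x, r ≤ dist x ξ → η ≤ S x := by
  obtain ⟨p, R, c, hp, hR, hc, hgrowth⟩ := hS.growth
  have hK : IsCompact (Metric.closedBall (0 : Plane) R ∩ {x | r ≤ dist x ξ}) :=
    (isCompact_closedBall 0 R).inter_right
      (isClosed_le continuous_const (continuous_id.dist continuous_const))
  obtain ⟨η, hη, hle⟩ : ∃ η > 0, ∀ x ∈ Metric.closedBall (0 : Plane) R ∩ {x | r ≤ dist x ξ},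
      η ≤ S x := by
    rcases Set.eq_empty_or_nonempty (Metric.closedBall (0 : Plane) R ∩ {x | r ≤ dist x ξ}) with
      he | hne
    · exact ⟨1, one_pos, by simp [he]⟩
    · obtain ⟨w, hw, hmin⟩ := hK.exists_isMinOn hne hS.contDiff.continuous.continuousOn
      refine ⟨S w, hS.pos w ?_, fun x hx => hmin hx⟩
      rintro rfl
      exact absurd hw.2 (by simpa using hr)
  refine ⟨min η (c * (R ^ 2 / 2) ^ p), lt_min hη (by positivity), fun x hx => ?_⟩
  rcases le_or_gt ‖x‖ R with h | h
  · exact (min_le_left _ _).trans (hle x ⟨by simpa using h, hx⟩)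
  · have h2 : R ^ 2 / 2 < ‖x‖ ^ 2 / 2 := by gcongr
    refine (min_le_right _ _).trans (le_trans ?_ (hgrowth x h2))
    gcongr

/-- The part of the integral away from the minimum is smaller than any power of `t`. -/
theorem IsLaplaceExponent.tail_isLittleO (hS : IsLaplaceExponent S ξ)
    (χ : ContDiffBump (0 : Plane)) (N : ℕ) :
    (fun t : ℝ => t⁻¹ * ∫ x, (1 - χ (x - ξ)) * Real.exp (-(S x / (2 * t))))
      =o[𝓝[>] (0 : ℝ)] fun t : ℝ => t ^ N := by
  obtain ⟨η, hη, hle⟩ := hS.exists_le_of_le_dist χ.rIn_pos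
  set I := ∫ x, Real.exp (-(1 / 4 * S x)) with hI
  have hint := hS.integrable_exp (a := 1 / 4) (by norm_num)
  have h1 := (isLittleO_exp_neg_mul_rpow_atTop (a := η / 4) (by positivity)
    (-(N + 1 : ℕ))).comp_tendsto tendsto_inv_nhdsGT_zero
  have h2 := ((Asymptotics.isBigO_refl (fun t : ℝ => t⁻¹) (𝓝[>] (0 : ℝ))).mul_isLittleO
    h1).const_mul_left I
  refine (Asymptotics.IsBigO.of_bound 1 ?_).trans_isLittleO (h2.congr' EventuallyEq.rfl ?_)
  · filter_upwards [Ioc_mem_nhdsGT (zero_lt_one (α := ℝ))] with t ht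
    -- Where `1 - χ` does not vanish, `S / 2t` is the sum of `S / 4t ≥ η / 4t` and `S / 4t ≥ S / 4`.
    have hpt : ∀ x, ‖(1 - χ (x - ξ)) * Real.exp (-(S x / (2 * t)))‖ ≤
        Real.exp (-(η / 4) * t⁻¹) * Real.exp (-(1 / 4 * S x)) := by
      intro x
      have hχ : 0 ≤ 1 - χ (x - ξ) := sub_nonneg.2 χ.le_one
      rw [norm_mul, Real.norm_of_nonneg hχ, Real.norm_of_nonneg (Real.exp_pos _).le,
        ← Real.exp_add]
      rcases lt_or_ge (dist x ξ) χ.rIn with hx | hx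
      · rw [χ.one_of_mem_closedBall (by simpa [dist_eq_norm] using hx.le)]
        simp [(Real.exp_pos _).le]
      · refine (mul_le_of_le_one_left (Real.exp_pos _).le
          (by linarith [χ.nonneg (x := x - ξ)])).trans (Real.exp_le_exp.2 ?_)
        have hη' := hle x hx
        have ht1 : 1 ≤ t⁻¹ := (one_le_inv₀ ht.1).2 ht.2
        have : S x / (2 * t) = 1 / 2 * (S x * t⁻¹) := by field_simp
        rw [this]
        have h3 := mul_le_mul_of_nonneg_right hη' (zero_le_one.trans ht1)
        have h4 := mul_le_mul_of_nonneg_left ht1 (hS.nonneg x)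
        linarith
    have hbound := norm_integral_le_of_norm_le (hint.const_mul (Real.exp (-(η / 4) * t⁻¹)))
      (Eventually.of_forall hpt)
    rw [integral_const_mul, ← hI] at hbound
    have hI0 : 0 ≤ I := integral_nonneg fun x => (Real.exp_pos _).le
    simp only [Function.comp_apply, one_mul]
    rw [norm_mul, norm_mul, norm_mul, Real.norm_of_nonneg hI0,
      Real.norm_of_nonneg (Real.exp_pos _).le]
    calc _ ≤ ‖t⁻¹‖ * (Real.exp (-(η / 4) * t⁻¹) * I) := by gcongr
      _ = _ := by ring
  · filter_upwards [self_mem_nhdsWithin] with t ht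
    have ht0 : (0 : ℝ) < t := ht
    simp only [Function.comp_apply]
    rw [Real.rpow_neg (inv_pos.2 ht0).le, Real.rpow_natCast, inv_pow, inv_inv, pow_succ]
    field_simp

/-- Rescaling by `ε = √(2t)` around `ξ`. -/
theorem IsLaplaceExponent.integral_bump_mul_exp (hS : IsLaplaceExponent S ξ)
    (χ : ContDiffBump (0 : Plane)) {t : ℝ} (ht : 0 < t) :
    ∫ x, χ (x - ξ) * Real.exp (-(S x / (2 * t))) =
      2 * t * localIntegral S ξ χ (Real.sqrt (2 * t)) := by
  set ε := Real.sqrt (2 * t) with hε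
  have hε2 : ε ^ 2 = 2 * t := Real.sq_sqrt (by positivity)
  have hε0 : 0 < ε := Real.sqrt_pos.2 (by positivity)
  have h := Measure.integral_comp_smul volume
    (fun x : Plane => χ x * Real.exp (-(S (ξ + x) / (2 * t)))) ε
  have h2 := integral_add_left_eq_self (μ := volume)
    (fun x : Plane => χ (x - ξ) * Real.exp (-(S x / (2 * t)))) ξ
  simp only [add_sub_cancel_left] at h2
  rw [← h2, localIntegral]
  simp only [finrank_euclideanSpace, Fintype.card_fin, hε2, smul_eq_mul] at h
  have hpt : ∀ y, laplaceIntegrand (taylorQuadraticForm S ξ) (fun p => χ p.1) ε y =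
      χ (ε • y) * Real.exp (-(S (ξ + ε • y) / (2 * t))) := by
    intro y
    rw [laplaceIntegrand, ← sq_mul_taylorQuadraticForm hS.contDiff hS.map_zero hS.fderiv_eq_zero,
      hε2, mul_div_cancel_left₀ _ (by positivity)]
  simp only [hpt, h]
  rw [abs_of_pos (by positivity), ← mul_assoc, mul_inv_cancel₀ (by positivity), one_mul]

end LaplaceMethod

/-! ### The asymptotic expansion -/

section Asymptotics

variable {S : Plane → ℝ} {ξ : Plane}

theorem IsLaplaceExponent.integral_exp_eq (hS : IsLaplaceExponent S ξ)
    (χ : ContDiffBump (0 : Plane)) {t : ℝ} (ht : 0 < t) :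
    ∫ x, Real.exp (-(S x / (2 * t))) =
      2 * t * localIntegral S ξ χ (Real.sqrt (2 * t)) +
        ∫ x, (1 - χ (x - ξ)) * Real.exp (-(S x / (2 * t))) := by
  have hint : Integrable fun x => Real.exp (-(S x / (2 * t))) := by
    simpa only [div_eq_inv_mul] using hS.integrable_exp (a := (2 * t)⁻¹) (by positivity)
  have hχ : Integrable fun x => χ (x - ξ) * Real.exp (-(S x / (2 * t))) := by
    refine hint.bdd_mul (c := 1) ?_ (Eventually.of_forall fun x => ?_)
    · exact (χ.continuous.comp (continuous_id.sub continuous_const)).aestronglyMeasurable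
    · rw [Real.norm_of_nonneg χ.nonneg]
      exact χ.le_one
  rw [← hS.integral_bump_mul_exp χ ht]
  simp only [sub_mul, one_mul]
  rw [integral_sub hint hχ]
  ring

/-- The coefficients of the expansion: the even Taylor coefficients of the localized integral `F`.
The factor `2 ^ k` comes from `ε² = 2t`, the factor `(2π)⁻¹` from `(4πt)⁻¹ ε² = (2π)⁻¹`. -/
noncomputable def laplaceCoeff (S : Plane → ℝ) (ξ : Plane) (χ : ContDiffBump (0 : Plane))
    (k : ℕ) : ℝ :=
  (2 * Real.pi)⁻¹ * (2 ^ k * (iteratedDeriv (2 * k) (localIntegral S ξ χ) 0 / (2 * k).factorial))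

theorem IsLaplaceExponent.hasPowerAsymptotics (hS : IsLaplaceExponent S ξ)
    (χ : ContDiffBump (0 : Plane)) (hsm : ∀ k : ℕ, ContDiff ℝ k (localIntegral S ξ χ)) :
    HasPowerAsymptotics (fun t => (4 * Real.pi * t)⁻¹ * ∫ x, Real.exp (-(S x / (2 * t))))
      (laplaceCoeff S ξ χ) := by
  intro N
  have hε : Tendsto (fun t : ℝ => Real.sqrt (2 * t)) (𝓝[>] 0) (𝓝 0) := by
    have hc : Continuous fun t : ℝ => Real.sqrt (2 * t) := by fun_prop
    simpa using (hc.tendsto 0).mono_left nhdsWithin_le_nhds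
  have h1 := ((taylor_isLittleO_univ (x₀ := 0) (hsm (2 * N))).comp_tendsto hε).const_mul_left
    (2 * Real.pi)⁻¹
  have h2 : (fun t : ℝ => (2 * Real.pi)⁻¹ * (localIntegral S ξ χ (Real.sqrt (2 * t)) -
      taylorWithinEval (localIntegral S ξ χ) (2 * N) Set.univ 0 (Real.sqrt (2 * t))))
      =o[𝓝[>] 0] fun t : ℝ => t ^ N := by
    refine h1.trans_isBigO (Asymptotics.IsBigO.of_bound (2 ^ N) ?_)
    filter_upwards [self_mem_nhdsWithin] with t ht
    have ht0 : (0 : ℝ) < t := ht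
    simp only [Function.comp_apply, sub_zero]
    rw [pow_mul, Real.sq_sqrt (by positivity), mul_pow, norm_mul, norm_pow, Real.norm_two]
  refine (h2.add ((hS.tail_isLittleO χ N).const_mul_left (4 * Real.pi)⁻¹)).congr' ?_
    EventuallyEq.rfl
  filter_upwards [self_mem_nhdsWithin] with t ht
  have ht0 : (0 : ℝ) < t := ht
  have hsum : ∑ k ∈ Finset.range (N + 1), t ^ k * laplaceCoeff S ξ χ k = (2 * Real.pi)⁻¹ *
      taylorWithinEval (localIntegral S ξ χ) (2 * N) Set.univ 0 (Real.sqrt (2 * t)) := by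
    rw [Function.Even.taylorWithinEval_zero (localIntegral_neg χ), Finset.mul_sum]
    refine Finset.sum_congr rfl fun k _ => ?_
    rw [laplaceCoeff, pow_mul, Real.sq_sqrt (by positivity), mul_pow]
    ring
  rw [hsum, hS.integral_exp_eq χ ht0]
  have hpi := Real.pi_ne_zero
  field_simp
  ring

/-- The coefficients of an asymptotic power expansion are unique. -/
theorem HasPowerAsymptotics.unique {f : ℝ → ℝ} {A B : ℕ → ℝ} (hA : HasPowerAsymptotics f A)
    (hB : HasPowerAsymptotics f B) : A = B := by
  ext n
  induction n using Nat.strong_induction_on with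
  | _ n ih =>
    have h := (hB n).sub (hA n)
    have h2 : (fun t : ℝ => (A n - B n) * t ^ n) =o[𝓝[>] (0 : ℝ)] fun t : ℝ => t ^ n := by
      refine h.congr_left fun t => ?_
      rw [Finset.sum_range_succ, Finset.sum_range_succ, Finset.sum_congr rfl fun k hk => by
        rw [← ih k (Finset.mem_range.1 hk)]]
      ring
    by_contra hne
    have h3 := (Asymptotics.isLittleO_const_mul_left_iff (sub_ne_zero.2 hne)).1 h2
    have h4 : ∃ᶠ t in 𝓝[>] (0 : ℝ), t ^ n ≠ 0 := by
      refine Eventually.frequently ?_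
      filter_upwards [self_mem_nhdsWithin] with t ht
      exact pow_ne_zero n (ne_of_gt ht)
    exact Asymptotics.isLittleO_irrefl h4 h3

theorem IsLaplaceExponent.exists_bump (hS : IsLaplaceExponent S ξ) :
    ∃ χ : ContDiffBump (0 : Plane), ∃ c > 0, IsPhase χ.rOut c (taylorQuadraticForm S ξ) := by
  obtain ⟨δ, hδ, c, hc, h⟩ := exists_le_taylorQuadraticForm hS.contDiff hS.hessian_pos
  exact ⟨⟨δ / 2, δ, half_pos hδ, half_lt_self hδ⟩, c, hc,
    isPhase_taylorQuadraticForm hS.contDiff h⟩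

/-- The first three coefficients of the expansion of `∫ exp (-S / (2 t))`, as Gaussian
integrals. -/
theorem IsLaplaceExponent.exists_hasPowerAsymptotics (hS : IsLaplaceExponent S ξ) :
    ∃ A, HasPowerAsymptotics
        (fun t => (4 * Real.pi * t)⁻¹ * ∫ x, Real.exp (-(S x / (2 * t)))) A ∧
      2 * Real.pi * A 0 = ∫ y, Real.exp (-(tensorPoly (derivTensor S ξ 2) y / 2)) ∧
      2 * Real.pi * A 1 = 2 * ∫ y, secondOrderTerm (derivTensor S ξ) y *
        Real.exp (-(tensorPoly (derivTensor S ξ 2) y / 2)) ∧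
      2 * Real.pi * A 2 = 4 * ∫ y, fourthOrderTerm (derivTensor S ξ) y *
        Real.exp (-(tensorPoly (derivTensor S ξ 2) y / 2)) := by
  obtain ⟨χ, c, hc, hq⟩ := hS.exists_bump
  have hF := fun k => IsAmplitude.iteratedDeriv_integral hq hc k (isAmplitude_contDiffBump χ)
  have hd : ∀ k, iteratedDeriv k (localIntegral S ξ χ) 0 = ∫ y, iteratedDeriv k
      (fun ε : ℝ => Real.exp (-taylorQuadraticForm S ξ (ε • y, y))) 0 := fun k => by
    simp only [← iteratedDeriv_laplaceIntegrand_bump χ]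
    exact (hF k).2.2 0
  have hpi := Real.pi_ne_zero
  refine ⟨laplaceCoeff S ξ χ, hS.hasPowerAsymptotics χ fun k => (hF k).1, ?_, ?_, ?_⟩
  · simp only [laplaceCoeff, mul_zero, hd, iteratedDeriv_zero,
      taylorQuadraticForm_zero_smul hS.contDiff]
    simp
    field_simp
  · simp only [laplaceCoeff, mul_one, hd,
      iteratedDeriv_two_exp_taylorQuadraticForm hS.contDiff hS.map_zero hS.fderiv_eq_zero,
      integral_const_mul]
    simp [Nat.factorial]
    field_simp
  · simp only [laplaceCoeff, Nat.reduceMul, hd,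
      iteratedDeriv_four_exp_taylorQuadraticForm hS.contDiff hS.map_zero hS.fderiv_eq_zero,
      integral_const_mul]
    simp [Nat.factorial]
    field_simp
    ring

end Asymptotics

/-! ### The world function of a map with one fixed point -/

section Hypotheses

theorem worldFunction_nonneg (x x' : Plane) : 0 ≤ worldFunction x x' := by
  unfold worldFunction
  positivity

theorem worldFunction_eq_zero_iff {x x' : Plane} : worldFunction x x' = 0 ↔ x = x' := by
  constructor
  · intro h
    simp only [worldFunction, Fin.sum_univ_two] at h
    ext α
    fin_cases α <;> simp <;> nlinarith [sq_nonneg (x' 0 - x 0), sq_nonneg (x' 1 - x 1)]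
  · rintro rfl
    simp [worldFunction]

theorem worldFunction_zero_right (x : Plane) : worldFunction x 0 = ‖x‖ ^ 2 / 2 := by
  rw [worldFunction, EuclideanSpace.norm_sq_eq]
  simp
  ring

theorem tensorPoly_hessian_eq_dotProduct (f : Plane → ℝ) (ξ y : Plane) :
    tensorPoly (derivTensor f ξ 2) y =
      dotProduct y.ofLp ((hessianMatrix f ξ).mulVec y.ofLp) := by
  simp only [tensorPoly, sum_fin_succ_fun, sum_fin_zero_fun, hessianMatrix, dotProduct,
    Matrix.mulVec, Matrix.of_apply, Fin.sum_univ_two, Fin.prod_univ_two, Matrix.cons_val_zero,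
    Matrix.cons_val_one]
  ring

/-- At a zero of a nonnegative function the Hessian is positive semidefinite. -/
theorem tensorPoly_hessian_nonneg {S : Plane → ℝ} {ξ : Plane} (hS : ContDiff ℝ (⊤ : ℕ∞) S)
    (hnonneg : ∀ x, 0 ≤ S x) (h0 : S ξ = 0) (h1 : fderiv ℝ S ξ = 0) (y : Plane) :
    0 ≤ tensorPoly (derivTensor S ξ 2) y := by
  have hc := (contDiff_taylorQuadraticForm_line (ξ := ξ) hS y).continuous
  have h : 0 ≤ taylorQuadraticForm S ξ ((0 : ℝ) • y, y) := by
    have ht := (hc.tendsto 0).mono_left (nhdsWithin_le_nhds (s := Set.Ioi 0))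
    refine ge_of_tendsto ht ?_
    filter_upwards [self_mem_nhdsWithin] with ε hε
    have hε0 : (0 : ℝ) < ε := hε
    have := hnonneg (ξ + ε • y)
    rw [← sq_mul_taylorQuadraticForm hS h0 h1] at this
    exact nonneg_of_mul_nonneg_right this (by positivity)
  rw [taylorQuadraticForm_zero_smul hS] at h
  linarith

/-- At a zero of a nonnegative function the Hessian cannot be negative definite. -/
theorem posDef_hessianMatrix_of_nonneg {S : Plane → ℝ} {ξ : Plane} (hS : ContDiff ℝ (⊤ : ℕ∞) S)
    (hnonneg : ∀ x, 0 ≤ S x) (h0 : S ξ = 0) (hcrit : IsNondegenerateCriticalPoint S ξ) :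
    (hessianMatrix S ξ).PosDef := by
  refine hcrit.2.resolve_right fun h => ?_
  have h1 := tensorPoly_hessian_nonneg hS hnonneg h0 hcrit.1 (EuclideanSpace.single 0 1)
  have hne : (EuclideanSpace.single 0 1 : Plane).ofLp ≠ 0 := by
    intro he
    have := congrFun he 0
    simp at this
  have h2 := h.dotProduct_mulVec_pos hne
  rw [tensorPoly_hessian_eq_dotProduct] at h1
  simp only [star_trivial, Matrix.neg_mulVec, dotProduct_neg] at h2
  linarith

end Hypotheses

theorem mainTheorem7
    (Φ : Plane → Plane) (hΦ : ContDiff ℝ (⊤ : ℕ∞) Φ)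
    (S : Plane → ℝ) (hS : ∀ x, S x = worldFunction (Φ x) x)
    (ξ₀ : Plane) (hfix : {x : Plane | Φ x = x} = {ξ₀})
    (hgrowth : ∃ p R c : ℝ, 0 < p ∧ 0 < R ∧ 0 < c ∧
      ∀ x : Plane, R ^ 2 / 2 < worldFunction x 0 → c * (worldFunction x 0) ^ p ≤ S x)
    (hcrit : IsNondegenerateCriticalPoint S ξ₀)
    (Q : Matrix (Fin 2) (Fin 2) ℝ) (hQ : Q * hessianMatrix S ξ₀ = 1)
    (T : (m : ℕ) → PlaneTensor m) (hT : ∀ m, T m = derivTensor S ξ₀ m)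
    (C : (k m : ℕ) → PlaneTensor m) (hC : ∀ k m, C k m = contractedDeriv Q S ξ₀ k m)
    (P : (m : ℕ) → Fin 2 → PlaneTensor m)
    (hP : ∀ m μ, P m μ = derivTensor (fun x => Φ x μ) ξ₀ m) :
    -- the deformed heat trace is a convergent integral and has an asymptotic expansion
    (∀ t : ℝ, 0 < t → Integrable (fun x : Plane => planeHeatKernel t (Φ x) x)) ∧
    (∃ A : ℕ → ℝ, HasPowerAsymptotics (deformedHeatTrace Φ) A) ∧
    -- the first three coefficients of the expansion
    (∀ A : ℕ → ℝ, HasPowerAsymptotics (deformedHeatTrace Φ) A →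
      A 0 = Real.sqrt Q.det ∧
      A 1 = Real.sqrt Q.det * (
          -(1 / 4) * C 2 0 ![]
          + (1 / 4) * (∑ ν : Fin 2 → Fin 2, C 1 1 ![ν 0] * C 1 1 ![ν 1] * Q (ν 0) (ν 1))
          + (1 / 6) * (∑ ν : Fin 6 → Fin 2,
              T 3 ![ν 0, ν 1, ν 2] * T 3 ![ν 3, ν 4, ν 5]
              * Q (ν 0) (ν 3) * Q (ν 1) (ν 4) * Q (ν 2) (ν 5))) ∧
      A 2 = Real.sqrt Q.det * (
          -(1 / 12) * C 3 0 ![]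
          + (1 / 4) * (∑ ν : Fin 2 → Fin 2, C 1 1 ![ν 0] * C 2 1 ![ν 1] * Q (ν 0) (ν 1))
          + (1 / 3) * (∑ ν : Fin 6 → Fin 2,
              T 3 ![ν 0, ν 1, ν 2] * C 1 3 ![ν 3, ν 4, ν 5]
              * Q (ν 0) (ν 3) * Q (ν 1) (ν 4) * Q (ν 2) (ν 5))
          + (1 / 32) * (C 2 0 ![] * C 2 0 ![])
          + (1 / 4) * (∑ ν : Fin 4 → Fin 2,
              C 1 2 ![ν 0, ν 1] * C 1 2 ![ν 2, ν 3]
              * Q (ν 0) (ν 2) * Q (ν 1) (ν 3))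
          + (1 / 12) * (∑ ν : Fin 8 → Fin 2,
              T 4 ![ν 0, ν 1, ν 2, ν 3] * T 4 ![ν 4, ν 5, ν 6, ν 7]
              * Q (ν 0) (ν 4) * Q (ν 1) (ν 5) * Q (ν 2) (ν 6) * Q (ν 3) (ν 7))
          - (1 / 16) * (∑ ν : Fin 2 → Fin 2,
              C 1 1 ![ν 0] * C 1 1 ![ν 1] * C 2 0 ![]
              * Q (ν 0) (ν 1))
          - (1 / 2) * (∑ ν : Fin 6 → Fin 2,
              C 1 1 ![ν 0] * T 3 ![ν 1, ν 2, ν 3] * C 1 2 ![ν 4, ν 5]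
              * Q (ν 0) (ν 1) * Q (ν 2) (ν 4) * Q (ν 3) (ν 5))
          - (1 / 4) * (∑ ν : Fin 4 → Fin 2,
              C 1 1 ![ν 0] * C 1 1 ![ν 1] * C 1 2 ![ν 2, ν 3]
              * Q (ν 0) (ν 2) * Q (ν 1) (ν 3))
          - (1 / 3) * (∑ ν : Fin 8 → Fin 2,
              C 1 1 ![ν 0] * T 3 ![ν 1, ν 2, ν 3] * T 4 ![ν 4, ν 5, ν 6, ν 7]
              * Q (ν 0) (ν 4) * Q (ν 1) (ν 5) * Q (ν 2) (ν 6) * Q (ν 3) (ν 7))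
          - (1 / 24) * (∑ ν : Fin 6 → Fin 2,
              T 3 ![ν 0, ν 1, ν 2] * T 3 ![ν 3, ν 4, ν 5] * C 2 0 ![]
              * Q (ν 0) (ν 3) * Q (ν 1) (ν 4) * Q (ν 2) (ν 5))
          - (1 / 2) * (∑ ν : Fin 8 → Fin 2,
              T 3 ![ν 0, ν 1, ν 2] * T 3 ![ν 3, ν 4, ν 5] * C 1 2 ![ν 6, ν 7]
              * Q (ν 0) (ν 3) * Q (ν 1) (ν 4) * Q (ν 2) (ν 6) * Q (ν 5) (ν 7))
          - (1 / 2) * (∑ ν : Fin 10 → Fin 2,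
              T 3 ![ν 0, ν 1, ν 2] * T 3 ![ν 3, ν 4, ν 5] * T 4 ![ν 6, ν 7, ν 8, ν 9]
              * Q (ν 0) (ν 3) * Q (ν 1) (ν 6) * Q (ν 2) (ν 7) * Q (ν 4) (ν 8) * Q (ν 5) (ν 9))
          + (1 / 32) * (∑ ν : Fin 4 → Fin 2,
              C 1 1 ![ν 0] * C 1 1 ![ν 1] * C 1 1 ![ν 2] * C 1 1 ![ν 3]
              * Q (ν 0) (ν 1) * Q (ν 2) (ν 3))
          + (1 / 24) * (∑ ν : Fin 8 → Fin 2,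
              C 1 1 ![ν 0] * C 1 1 ![ν 1] * T 3 ![ν 2, ν 3, ν 4] * T 3 ![ν 5, ν 6, ν 7]
              * Q (ν 0) (ν 1) * Q (ν 2) (ν 5) * Q (ν 3) (ν 6) * Q (ν 4) (ν 7))
          + (1 / 4) * (∑ ν : Fin 8 → Fin 2,
              C 1 1 ![ν 0] * T 3 ![ν 1, ν 2, ν 3] * T 3 ![ν 4, ν 5, ν 6] * C 1 1 ![ν 7]
              * Q (ν 0) (ν 1) * Q (ν 2) (ν 4) * Q (ν 3) (ν 5) * Q (ν 6) (ν 7))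
          + (1 / 12) * (∑ ν : Fin 6 → Fin 2,
              C 1 1 ![ν 0] * T 3 ![ν 1, ν 2, ν 3] * C 1 1 ![ν 4] * C 1 1 ![ν 5]
              * Q (ν 0) (ν 1) * Q (ν 2) (ν 4) * Q (ν 3) (ν 5))
          + (1 / 2) * (∑ ν : Fin 10 → Fin 2,
              C 1 1 ![ν 0] * T 3 ![ν 1, ν 2, ν 3] * T 3 ![ν 4, ν 5, ν 6] * T 3 ![ν 7, ν 8, ν 9]
              * Q (ν 0) (ν 1) * Q (ν 2) (ν 4) * Q (ν 3) (ν 7) * Q (ν 5) (ν 8) * Q (ν 6) (ν 9))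
          + (1 / 72) * (∑ ν : Fin 12 → Fin 2,
              T 3 ![ν 0, ν 1, ν 2] * T 3 ![ν 3, ν 4, ν 5] * T 3 ![ν 6, ν 7, ν 8] * T 3 ![ν 9, ν 10, ν 11]
              * Q (ν 0) (ν 3) * Q (ν 1) (ν 4) * Q (ν 2) (ν 5) * Q (ν 6) (ν 9) * Q (ν 7) (ν 10) * Q (ν 8) (ν 11))
          + (1 / 4) * (∑ ν : Fin 12 → Fin 2,
              T 3 ![ν 0, ν 1, ν 2] * T 3 ![ν 3, ν 4, ν 5] * T 3 ![ν 6, ν 7, ν 8] * T 3 ![ν 9, ν 10, ν 11]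
              * Q (ν 0) (ν 3) * Q (ν 1) (ν 4) * Q (ν 2) (ν 6) * Q (ν 5) (ν 9) * Q (ν 7) (ν 10) * Q (ν 8) (ν 11))
          + (1 / 6) * (∑ ν : Fin 12 → Fin 2,
              T 3 ![ν 0, ν 1, ν 2] * T 3 ![ν 3, ν 4, ν 5] * T 3 ![ν 6, ν 7, ν 8] * T 3 ![ν 9, ν 10, ν 11]
              * Q (ν 0) (ν 3) * Q (ν 1) (ν 6) * Q (ν 2) (ν 9) * Q (ν 4) (ν 7) * Q (ν 5) (ν 10) * Q (ν 8) (ν 11)))) ∧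
    -- the derivatives of `S` in terms of the derivatives of `Φ`
    (∀ ν, T 2 ν = symmetrize (fun a : Fin 2 → Fin 2 =>
      (1 : Matrix (Fin 2) (Fin 2) ℝ) (a 0) (a 1) - 2 * P 1 (a 0) ![a 1]
        + ∑ μ : Fin 2, P 1 μ ![a 0] * P 1 μ ![a 1]) ν) ∧
    (∀ ν, T 3 ν = symmetrize (fun a : Fin 3 → Fin 2 =>
      -3 * P 2 (a 0) ![a 1, a 2]
        + 3 * ∑ μ : Fin 2, P 1 μ ![a 0] * P 2 μ ![a 1, a 2]) ν) ∧
    (∀ ν, T 4 ν = symmetrize (fun a : Fin 4 → Fin 2 =>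
      -4 * P 3 (a 0) ![a 1, a 2, a 3]
        + 4 * (∑ μ : Fin 2, P 1 μ ![a 0] * P 3 μ ![a 1, a 2, a 3])
        + 3 * (∑ μ : Fin 2, P 2 μ ![a 0, a 1] * P 2 μ ![a 2, a 3])) ν) ∧
    (∀ ν, T 5 ν = symmetrize (fun a : Fin 5 → Fin 2 =>
      -5 * P 4 (a 0) ![a 1, a 2, a 3, a 4]
        + 5 * (∑ μ : Fin 2, P 1 μ ![a 0] * P 4 μ ![a 1, a 2, a 3, a 4])
        + 10 * (∑ μ : Fin 2, P 2 μ ![a 0, a 1] * P 3 μ ![a 2, a 3, a 4])) ν) ∧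
    (∀ ν, T 6 ν = symmetrize (fun a : Fin 6 → Fin 2 =>
      -6 * P 5 (a 0) ![a 1, a 2, a 3, a 4, a 5]
        + 6 * (∑ μ : Fin 2, P 1 μ ![a 0] * P 5 μ ![a 1, a 2, a 3, a 4, a 5])
        + 15 * (∑ μ : Fin 2, P 2 μ ![a 0, a 1] * P 4 μ ![a 2, a 3, a 4, a 5])
        + 10 * (∑ μ : Fin 2, P 3 μ ![a 0, a 1, a 2] * P 3 μ ![a 3, a 4, a 5])) ν) := by
  have hSsm := contDiff_worldFunction_comp hΦ hS
  have hΦξ : Φ ξ₀ = ξ₀ := (hfix.ge rfl : ξ₀ ∈ {x : Plane | Φ x = x})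
  have hnonneg : ∀ x, 0 ≤ S x := fun x => hS x ▸ worldFunction_nonneg _ _
  have hS0 : S ξ₀ = 0 := by rw [hS, worldFunction_eq_zero_iff, hΦξ]
  have hH := posDef_hessianMatrix_of_nonneg hSsm hnonneg hS0 hcrit
  have hQpos : Q.PosDef := by
    rw [← Matrix.inv_eq_left_inv hQ]
    exact hH.inv
  have hL : IsLaplaceExponent S ξ₀ :=
    { contDiff := hSsm
      map_zero := hS0
      pos := fun x hx => (hnonneg x).lt_of_ne' fun h => hx
        (hfix.le (worldFunction_eq_zero_iff.1 (hS x ▸ h) : Φ x = x))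
      fderiv_eq_zero := hcrit.1
      hessian_pos := fun y hy => by
        rw [tensorPoly_hessian_eq_dotProduct]
        exact hH.dotProduct_mulVec_pos fun h => hy (by ext i; exact congrFun h i)
      growth := by simpa only [worldFunction_zero_right] using hgrowth }
  have hΘ : deformedHeatTrace Φ =
      fun t => (4 * Real.pi * t)⁻¹ * ∫ x, Real.exp (-(S x / (2 * t))) := by
    ext t
    simp only [deformedHeatTrace, planeHeatKernel, ← hS, integral_const_mul]
  obtain ⟨A, hA, hA0, hA1, hA2⟩ := hL.exists_hasPowerAsymptotics
  rw [← hΘ] at hA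
  obtain rfl : T = derivTensor S ξ₀ := funext hT
  have hsymm := isSymmTensor_derivTensor hSsm ξ₀
  have hC₀ : ∀ m, C 0 m = derivTensor S ξ₀ m := fun m => hC 0 m
  have hC₁ : ∀ k m, C (k + 1) m = contractPair Q (C k (m + 2)) := fun k m => by
    rw [hC, hC, contractedDeriv]
  have hpi : (2 * Real.pi) ≠ 0 := by positivity
  refine ⟨fun t ht => ?_, ⟨A, hA⟩, fun B hB => ?_,
    fun ν => by rw [derivTensor_two hΦ hS hΦξ hP], fun ν => by rw [derivTensor_three hΦ hS hΦξ hP],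
    fun ν => by rw [derivTensor_four hΦ hS hΦξ hP], fun ν => by rw [derivTensor_five hΦ hS hΦξ hP],
    fun ν => by rw [derivTensor_six hΦ hS hΦξ hP]⟩
  · simp only [planeHeatKernel, ← hS, div_eq_inv_mul]
    exact (hL.integrable_exp (by positivity)).const_mul _
  · rw [hB.unique hA]
    refine ⟨mul_left_cancel₀ hpi ?_, mul_left_cancel₀ hpi ?_, mul_left_cancel₀ hpi ?_⟩
    · rw [hA0, integral_exp_neg_half_quadratic hQ hQpos]
    · rw [hA1, integral_secondOrderTerm hQ hQpos hsymm hC₀ hC₁]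
    · rw [hA2, integral_fourthOrderTerm hQ hQpos hsymm hC₀ hC₁]
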